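/- Let $\mathbb{R}^{3,4}$ be $\mathbb{R}^7$ with a bilinear form $q$ of signature $(3,4)$, realized as the imaginary split octonions, and let $\times$ be its cross product, $x\times y=\mathrm{Im}(xy)$. Let $G_2'=\mathrm{Aut}(\mathbb{R}^{3,4},\times)=\{g\in \mathrm{GL}(7,\mathbb{R}) : g(x\times y)=g(x)\times g(y)\}$ be the split real group of type $G_2$. Its flag manifolds are \[ \mathrm{Ein}^{2,3}=\{\ell \text{ an isotropic line}\},\quad \mathrm{Pho}^\times=\{\omega \text{ a totally isotropic } 2\text{-plane with } \omega\times\omega=0\},\quad \mathcal{F}_{1,2}^\times=\{(\ell,\omega)\in \mathrm{Ein}^{2,3}\times\mathrm{Pho}^\times : \ell\subset\omega\}. \] Elements of $\mathrm{Pho}^\times$ are called annihilator photons, and elements of $\mathcal{F}_{1,2}^\times$ pointed annihilator photons. For a subspace $W$ put $\mathrm{Ein}(W)=\{\ell\in\mathrm{Ein}^{2,3}:\ell\subset W\}$ and $\mathrm{Pho}^\times(W)=\{\omega\in\mathrm{Pho}^\times:\omega\subset W\}$. Two points of a flag manifold $\mathcal{F}$ of $G_2'$ are transverse if they lie in the open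 $G_2'$-orbit of $\mathcal{F}\times\mathcal{F}$; a subset of $\mathcal{F}$ is transverse if any two of its distinct points are transverse, and maximally transverse if moreover it is not properly contained in another transverse subset of $\mathcal{F}$. Let $P$ be a point of the symmetric space of $G_2'$, that is, a $3$-plane $P\subset\mathbb{R}^{3,4}$ on which $q$ is positive definite and with $P\times P=P$. Let $P^\perp$ be its $q$-orthogonal complement, $\pi_P:\mathbb{R}^{3,4}\to P$ the $q$-orthogonal projection, and $H_P=\{\varphi\in G_2' : \varphi(x)=x \text{ for all } x\in P\}$. Then $H_P$ is isomorphic, as a Lie group, to $\mathrm{Sp}(1)$, and the following hold. (a) $\ell\mapsto\pi_P(\ell)$ defines a principal $H_P$-bundle $\mathrm{Ein}^{2,3}\to\mathrm{Gr}_1(P)$. The fiber over $U^1$ is $\mathrm{Ein}(U^1\oplus P^\perp)$; here $U^1\oplus P^\perp$ is isometric to $\mathbb{R}^{1,4}$, and such an isometry identifies the fiber with $\mathrm{Ein}^{0,3}$, the space of isotropic lines of $\mathbb{R}^{1,4}$. (b) $\omega\mapsto\pi_P(\omega)$ defines a principal $H_P$-bundle $\mathrm{Pho}^\times\to\mathrm{Gr}_2(P)$.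 The fiber over $U^2$ is $\mathrm{Pho}^\times(U^2\oplus P^\perp)$; here $U^2\oplus P^\perp$ has signature $(2,4)$, and for every subspace $W\subset\mathbb{R}^{3,4}$ of signature $(2,4)$ some element of $G_2'$ carries the fiber onto $\mathrm{Pho}^\times(W)$. (c) $(\ell,\omega)\mapsto(\pi_P(\ell),\pi_P(\omega))$ defines a principal $H_P$-bundle $\mathcal{F}_{1,2}^\times\to\mathrm{Flag}(P)$, where $\mathrm{Flag}(P)$ is the space of full flags $U^1\subset U^2\subset P$. The fiber over $(U^1,U^2)$ consists of all pointed annihilator photons $(\ell,\omega)$ such that $\ell$ is the graph of a linear map $U^1\to P^\perp$ and $\omega$ is the graph of a linear map $U^2\to P^\perp$. The bundles are smooth, and in each of (a), (b), (c) every fiber is a $3$-sphere that is maximally transverse in the flag manifold. -/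

import Mathlib

open scoped Quaternion ContDiff

noncomputable section

namespace SplitG2

/-! ### Pseudo-Euclidean spaces -/

/-- The diagonal symmetric bilinear form `∑ wᵢ xᵢ yᵢ` on `ℝⁿ`. -/
def diagForm {n : ℕ} (w : Fin n → ℝ) : LinearMap.BilinForm ℝ (EuclideanSpace ℝ (Fin n)) :=
  LinearMap.mk₂ ℝ (fun x y => ∑ i, w i * x i * y i)
    (fun x x' y => by simp [mul_add, add_mul, Finset.sum_add_distrib])
    (fun c x y => by
      simp only [PiLp.smul_apply, smul_eq_mul, Finset.mul_sum]
      exact Finset.sum_congr rfl fun i _ => by ring)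
    (fun x y y' => by simp [mul_add, Finset.sum_add_distrib])
    (fun c x y => by
      simp only [PiLp.smul_apply, smul_eq_mul, Finset.mul_sum]
      exact Finset.sum_congr rfl fun i _ => by ring)

/-- Weights of `ℝ^{3,4}`, `ℝ^{1,4}` and `ℝ^{2,4}`. -/
def w34 : Fin 7 → ℝ := ![1, 1, 1, -1, -1, -1, -1]

def w14 : Fin 5 → ℝ := ![1, -1, -1, -1, -1]

def w24 : Fin 6 → ℝ := ![1, 1, -1, -1, -1, -1]

/-- The vector space underlying `ℝ^{3,4}`. Its Euclidean structure is used only to put the usual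
smooth structure on Grassmannians; the geometry is that of the form `q`. -/
abbrev V : Type := EuclideanSpace ℝ (Fin 7)

/-- The form of signature `(3,4)`. -/
def q : LinearMap.BilinForm ℝ V := diagForm w34

lemma q_apply (x y : V) :
    q x y = x 0 * y 0 + x 1 * y 1 + x 2 * y 2 - x 3 * y 3 - x 4 * y 4 - x 5 * y 5 - x 6 * y 6 := by
  simp [q, diagForm, w34, Fin.sum_univ_succ]
  ring

lemma q_comm (x y : V) : q x y = q y x := by
  simp only [q_apply]; ring

/-! ### The cross product of `ℝ^{3,4}` -/

/-- `V` is identified with the imaginary split octonions `Im ℍ ⊕ ℍ`; first component. -/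
def fstQ (x : V) : ℍ[ℝ] := ⟨0, x 0, x 1, x 2⟩

/-- Second component. -/
def sndQ (x : V) : ℍ[ℝ] := ⟨x 3, x 4, x 5, x 6⟩

@[simp] lemma fstQ_re (x : V) : (fstQ x).re = 0 := rfl

@[simp] lemma fstQ_imI (x : V) : (fstQ x).imI = x 0 := rfl

@[simp] lemma fstQ_imJ (x : V) : (fstQ x).imJ = x 1 := rfl

@[simp] lemma fstQ_imK (x : V) : (fstQ x).imK = x 2 := rfl

@[simp] lemma sndQ_re (x : V) : (sndQ x).re = x 3 := rfl

@[simp] lemma sndQ_imI (x : V) : (sndQ x).imI = x 4 := rfl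

@[simp] lemma sndQ_imJ (x : V) : (sndQ x).imJ = x 5 := rfl

@[simp] lemma sndQ_imK (x : V) : (sndQ x).imK = x 6 := rfl

/-- First component of the split octonion product
`(a, b)(c, d) = (ac + d b*, a* d + c b)` on `ℍ ⊕ ℍ`. -/
def mulFst (a b c d : ℍ[ℝ]) : ℍ[ℝ] := a * c + d * star b

/-- Second component of the split octonion product. -/
def mulSnd (a b c d : ℍ[ℝ]) : ℍ[ℝ] := star a * d + c * b

/-- The cross product `x × y = Im (x y)` of imaginary split octonions. -/
def crossFun (x y : V) : V :=
  let s := mulFst (fstQ x) (sndQ x) (fstQ y) (sndQ y)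
  let t := mulSnd (fstQ x) (sndQ x) (fstQ y) (sndQ y)
  !₂[s.imI, s.imJ, s.imK, t.re, t.imI, t.imJ, t.imK]

/-- The cross product in coordinates. -/
lemma crossFun_eq (x y : V) : crossFun x y =
    !₂[x 1 * y 2 - x 2 * y 1 - y 3 * x 4 + y 4 * x 3 - y 5 * x 6 + y 6 * x 5,
      x 2 * y 0 - x 0 * y 2 - y 3 * x 5 + y 4 * x 6 + y 5 * x 3 - y 6 * x 4,
      x 0 * y 1 - x 1 * y 0 - y 3 * x 6 - y 4 * x 5 + y 5 * x 4 + y 6 * x 3,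
      x 0 * y 4 + x 1 * y 5 + x 2 * y 6 - y 0 * x 4 - y 1 * x 5 - y 2 * x 6,
      -x 0 * y 3 - x 1 * y 6 + x 2 * y 5 + y 0 * x 3 + y 1 * x 6 - y 2 * x 5,
      x 0 * y 6 - x 1 * y 3 - x 2 * y 4 - y 0 * x 6 + y 1 * x 3 + y 2 * x 4,
      -x 0 * y 5 + x 1 * y 4 - x 2 * y 3 + y 0 * x 5 - y 1 * x 4 + y 2 * x 3] := by
  ext i
  fin_cases i <;> simp [crossFun, mulFst, mulSnd] <;> ring

lemma crossFun_add_left (x x' y : V) :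
    crossFun (x + x') y = crossFun x y + crossFun x' y := by
  simp only [crossFun_eq]
  ext i
  fin_cases i <;> simp <;> ring

lemma crossFun_smul_left (c : ℝ) (x y : V) : crossFun (c • x) y = c • crossFun x y := by
  simp only [crossFun_eq]
  ext i
  fin_cases i <;> simp <;> ring

lemma crossFun_add_right (x y y' : V) :
    crossFun x (y + y') = crossFun x y + crossFun x y' := by
  simp only [crossFun_eq]
  ext i
  fin_cases i <;> simp <;> ring

lemma crossFun_smul_right (c : ℝ) (x y : V) : crossFun x (c • y) = c • crossFun x y := by
  simp only [crossFun_eq]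
  ext i
  fin_cases i <;> simp <;> ring

/-- The cross product as a bilinear map. -/
def cross : V →ₗ[ℝ] V →ₗ[ℝ] V :=
  LinearMap.mk₂ ℝ crossFun crossFun_add_left crossFun_smul_left crossFun_add_right
    crossFun_smul_right

lemma cross_apply (x y : V) : cross x y = crossFun x y := rfl

/-- The cross product is alternating. -/
lemma cross_self (x : V) : cross x x = 0 := by
  rw [cross_apply, crossFun_eq]
  ext i
  fin_cases i <;> simp <;> ring

/-- The cross product is orthogonal to its first factor (hence to both). -/
lemma q_cross_left (x y : V) : q (cross x y) x = 0 := by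
  rw [q_apply, cross_apply, crossFun_eq]
  simp
  ring

/-- The normalization of the cross product. -/
lemma q_cross_cross (x y : V) : q (cross x y) (cross x y) = q x x * q y y - q x y ^ 2 := by
  simp only [q_apply, cross_apply, crossFun_eq]
  simp
  ring

/-- The double cross product identity. -/
lemma cross_cross (x y : V) : cross x (cross x y) = -(q x x) • y + q x y • x := by
  simp only [q_apply, cross_apply, crossFun_eq]
  ext i
  fin_cases i <;> simp <;> ring

/-! ### The group `G₂'` -/

/-- `G₂' = Aut(ℝ^{3,4}, ×)`, with the topology of `GL(V)`. -/
def G2 : Subgroup (V →L[ℝ] V)ˣ where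
  carrier := {g | ∀ x y : V, (g : V →L[ℝ] V) (cross x y) =
    cross ((g : V →L[ℝ] V) x) ((g : V →L[ℝ] V) y)}
  mul_mem' := by
    intro a b ha hb x y
    have hb' := hb x y
    have ha' := ha ((b : V →L[ℝ] V) x) ((b : V →L[ℝ] V) y)
    simp only [Units.val_mul, mul_apply_eq_comp]
    rw [hb', ha']
  one_mem' := by intro x y; simp
  inv_mem' := by
    intro a ha x y
    have h1 : ∀ z, a.val (a⁻¹.val z) = z := fun z => by
      have h := a.mul_inv
      exact DFunLike.congr_fun h z
    have h2 : ∀ z, a⁻¹.val (a.val z) = z := fun z => by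
      have h := a.inv_mul
      exact DFunLike.congr_fun h z
    have h := ha (a⁻¹.val x) (a⁻¹.val y)
    rw [h1, h1] at h
    rw [← h, h2]

/-- The linear map of `V` given by an element of `G₂'`. -/
def lin (g : G2) : V →ₗ[ℝ] V := (((g : (V →L[ℝ] V)ˣ) : V →L[ℝ] V) : V →ₗ[ℝ] V)

lemma lin_one : lin 1 = LinearMap.id := rfl

lemma lin_mul (g h : G2) : lin (g * h) = lin g ∘ₗ lin h := rfl

lemma lin_injective (g : G2) : Function.Injective (lin g) := by
  have h : lin g⁻¹ ∘ₗ lin g = LinearMap.id := by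
    rw [← lin_mul, inv_mul_cancel, lin_one]
  exact Function.LeftInverse.injective (g := lin g⁻¹) fun x => LinearMap.congr_fun h x

lemma lin_cross (g : G2) (x y : V) : lin g (cross x y) = cross (lin g x) (lin g y) := g.2 x y

lemma q_lin_self (g : G2) (x : V) : q (lin g x) (lin g x) = q x x := by
  by_cases hx : x = 0
  · simp [hx]
  obtain ⟨y, hy⟩ : ∃ y : V, y ∉ Submodule.span ℝ {x} := by
    by_contra! hall
    have h1 : Submodule.span ℝ {x} = ⊤ := Submodule.eq_top_iff'.2 hall
    have h2 := finrank_span_singleton (K := ℝ) hx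
    rw [h1, finrank_top] at h2
    simp at h2
  have e1 := congrArg (lin g) (cross_cross x y)
  rw [lin_cross, lin_cross, cross_cross] at e1
  have e2 : lin g ((q x x - q (lin g x) (lin g x)) • y) =
      lin g ((q x y - q (lin g x) (lin g y)) • x) := by
    simp only [map_add, map_smul, neg_smul, map_neg, sub_smul] at e1 ⊢
    rw [map_sub, map_sub]
    simp only [map_smul]
    linear_combination (norm := module) e1
  have e3 := lin_injective g e2
  by_contra hne
  apply hy
  have hc : q x x - q (lin g x) (lin g x) ≠ 0 := fun h => hne (by linarith)
  rw [Submodule.mem_span_singleton]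
  refine ⟨(q x x - q (lin g x) (lin g x))⁻¹ * (q x y - q (lin g x) (lin g y)), ?_⟩
  rw [mul_smul, ← e3, smul_smul, inv_mul_cancel₀ hc, one_smul]

lemma q_lin (g : G2) (x y : V) : q (lin g x) (lin g y) = q x y := by
  have h := q_lin_self g (x + y)
  simp only [map_add, LinearMap.add_apply, q_lin_self] at h
  have h1 := q_comm (lin g x) (lin g y)
  have h2 := q_comm x y
  linarith

/-! ### Smooth maps between embedded submanifolds of vector spaces -/

section Smooth

variable {X Y E E' : Type*} [NormedAddCommGroup E] [NormedSpace ℝ E]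
  [NormedAddCommGroup E'] [NormedSpace ℝ E']

/-- Smoothness of a map between spaces embedded in normed vector spaces by `eX` and `eY`: locally
it extends to a smooth map of the ambient spaces. -/
def SmoothMap (eX : X → E) (eY : Y → E') (f : X → Y) : Prop :=
  ∀ x, ∃ O : Set E, IsOpen O ∧ eX x ∈ O ∧ ∃ g : E → E', ContDiffOn ℝ ∞ g O ∧
    ∀ y, eX y ∈ O → g (eX y) = eY (f y)

/-- A bijection that is smooth in both directions. -/
def IsDiffeo (eX : X → E) (eY : Y → E') (f : X ≃ Y) : Prop :=
  SmoothMap eX eY f ∧ SmoothMap eY eX f.symm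

/-- The set `S` is a smooth 3-sphere: it is diffeomorphic to the unit sphere of `ℝ⁴`. -/
def IsThreeSphere (eX : X → E) (S : Set X) : Prop :=
  ∃ f : Metric.sphere (0 : EuclideanSpace ℝ (Fin 4)) 1 ≃ S,
    IsDiffeo (fun x : Metric.sphere (0 : EuclideanSpace ℝ (Fin 4)) 1 => x.1) (fun s : S => eX s) f

end Smooth

/-- `π : F → B` is a smooth principal bundle with structure group `H` acting on `F`. -/
structure IsPrincipalBundle {F B H E₁ E₂ E₃ : Type*}
    [NormedAddCommGroup E₁] [NormedSpace ℝ E₁] [NormedAddCommGroup E₂] [NormedSpace ℝ E₂]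
    [NormedAddCommGroup E₃] [NormedSpace ℝ E₃] [Group H] [MulAction H F]
    (eF : F → E₁) (eB : B → E₂) (eH : H → E₃) (π : F → B) : Prop where
  smooth_action : SmoothMap (fun p : H × F => (eH p.1, eF p.2)) eF (fun p => p.1 • p.2)
  smooth_proj : SmoothMap eF eB π
  surjective : Function.Surjective π
  /-- The fibers are exactly the orbits. -/
  fiber_iff : ∀ x y, π x = π y ↔ ∃ h : H, h • x = y
  free : ∀ (h : H) (x : F), h • x = x → h = 1
  /-- Equivariant local triviality over an open neighborhood of every point of the base. -/
  locally_trivial : ∀ b : B, ∃ N : Set B, b ∈ N ∧ (∃ O : Set E₂, IsOpen O ∧ N = eB ⁻¹' O) ∧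
    ∃ Φ : N × H ≃ π ⁻¹' N,
      (∀ p, π (Φ p) = p.1) ∧
      (∀ (c : N) (h k : H), (Φ (c, h * k) : F) = h • (Φ (c, k) : F)) ∧
      IsDiffeo (fun p : N × H => (eB p.1, eH p.2)) (fun x : π ⁻¹' N => eF x) Φ

/-! ### Transversality -/

section Transversality

variable (G : Type*) {F : Type*} [Group G] [TopologicalSpace F] [MulAction G F]

/-- Two points are transverse if they lie in the open `G`-orbit of `F × F`. -/
def Transverse (x y : F) : Prop := IsOpen (MulAction.orbit G ((x, y) : F × F))

def TransverseSet (S : Set F) : Prop := S.Pairwise (Transverse G)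

/-- A transverse subset not properly contained in another transverse subset. -/
def MaximallyTransverse (S : Set F) : Prop :=
  TransverseSet G S ∧ ∀ T : Set F, TransverseSet G T → S ⊆ T → T = S

end Transversality

/-! ### Flag manifolds -/

/-- The embedding of Grassmannians of a Euclidean space into its endomorphisms: a subspace is sent
to the Euclidean orthogonal projection onto it. -/
def grEmb {n : ℕ} (W : Submodule ℝ (EuclideanSpace ℝ (Fin n))) :
    EuclideanSpace ℝ (Fin n) →L[ℝ] EuclideanSpace ℝ (Fin n) :=
  W.starProjection

/-- Totally isotropic `k`-planes for the diagonal form with weights `w`. -/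
def Iso {n : ℕ} (w : Fin n → ℝ) (k : ℕ) : Type :=
  {W : Submodule ℝ (EuclideanSpace ℝ (Fin n)) //
    Module.finrank ℝ W = k ∧ ∀ x ∈ W, ∀ y ∈ W, diagForm w x y = 0}

/-- `Ein^{2,3}`, the isotropic lines of `ℝ^{3,4}`. -/
abbrev Ein : Type := Iso w34 1

/-- `Ein^{0,3}`, the isotropic lines of `ℝ^{1,4}`. -/
abbrev Ein03 : Type := Iso w14 1

/-- Annihilator photons: isotropic planes of `ℝ^{3,4}` with vanishing cross product. -/
def Pho : Type := {W : Iso w34 2 // ∀ x ∈ W.1, ∀ y ∈ W.1, cross x y = 0}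

def Pho.plane (W : Pho) : Submodule ℝ V := W.1.1

/-- Pointed annihilator photons, the full flag manifold of `G₂'`. -/
def F12 : Type := {p : Ein × Pho // p.1.1 ≤ p.2.plane}

def F12.line (p : F12) : Submodule ℝ V := p.1.1.1

def F12.plane (p : F12) : Submodule ℝ V := p.1.2.plane

def Iso.emb {n k : ℕ} {w : Fin n → ℝ} (W : Iso w k) :
    EuclideanSpace ℝ (Fin n) →L[ℝ] EuclideanSpace ℝ (Fin n) := grEmb W.1

def Pho.emb (W : Pho) : V →L[ℝ] V := grEmb W.plane

def F12.emb (p : F12) : (V →L[ℝ] V) × (V →L[ℝ] V) := (grEmb p.line, grEmb p.plane)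

instance {n k : ℕ} {w : Fin n → ℝ} : TopologicalSpace (Iso w k) := .induced Iso.emb inferInstance

instance : TopologicalSpace Pho := .induced Pho.emb inferInstance

instance : TopologicalSpace F12 := .induced F12.emb inferInstance

lemma finrank_map (g : G2) (W : Submodule ℝ V) :
    Module.finrank ℝ (W.map (lin g)) = Module.finrank ℝ W :=
  (Submodule.equivMapOfInjective (lin g) (lin_injective g) W).finrank_eq.symm

/-- `G₂'` acts on all its flag manifolds by taking images of subspaces. -/
instance {k : ℕ} : MulAction G2 (Iso w34 k) where
  smul g W := ⟨W.1.map (lin g), (finrank_map g W.1).trans W.2.1, by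
    rintro _ ⟨x, hx, rfl⟩ _ ⟨y, hy, rfl⟩
    exact (q_lin g x y).trans (W.2.2 x hx y hy)⟩
  one_smul W := Subtype.ext (Submodule.map_id _)
  mul_smul g h W := Subtype.ext (Submodule.map_comp _ _ _)

instance : MulAction G2 Pho where
  smul g W := ⟨g • W.1, by
    rintro _ ⟨x, hx, rfl⟩ _ ⟨y, hy, rfl⟩
    rw [← lin_cross, W.2 x hx y hy, map_zero]⟩
  one_smul W := Subtype.ext (one_smul _ _)
  mul_smul g h W := Subtype.ext (mul_smul _ _ _)

instance : MulAction G2 F12 where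
  smul g p := ⟨(g • p.1.1, g • p.1.2), Submodule.map_mono p.2⟩
  one_smul p := Subtype.ext (Prod.ext (one_smul G2 p.1.1) (one_smul G2 p.1.2))
  mul_smul g h p := Subtype.ext (Prod.ext (mul_smul g h p.1.1) (mul_smul g h p.1.2))

/-! ### The symmetric space -/

/-- The symmetric space of `G₂'`: positive definite 3-planes `P` with `P × P = P`. -/
def SymSpace : Type :=
  {P : Submodule ℝ V // Module.finrank ℝ P = 3 ∧ (∀ x ∈ P, x ≠ 0 → 0 < q x x) ∧
    Submodule.map₂ cross P P = P}

namespace SymSpace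

variable (P : SymSpace)

/-- The `q`-orthogonal complement of `P`. -/
def perp : Submodule ℝ V := q.orthogonal P.1

lemma isCompl : IsCompl P.1 P.perp := by
  have hr : q.IsRefl := fun x y h => by rw [q_comm]; exact h
  refine (LinearMap.BilinForm.isCompl_orthogonal_iff_disjoint hr).2 ?_
  rw [Submodule.disjoint_def]
  intro x hx hx'
  by_contra hne
  have h0 : q x x = 0 := hx' x hx
  exact absurd h0 (P.2.2.1 x hx hne).ne'

/-- The `q`-orthogonal projection onto `P`. -/
def proj : V →ₗ[ℝ] V := P.1.projection P.perp P.isCompl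

/-- The pointwise stabilizer of `P` in `G₂'`. -/
def H : Subgroup G2 where
  carrier := {g | ∀ x ∈ P.1, lin g x = x}
  mul_mem' := by
    intro a b ha hb x hx
    rw [lin_mul, LinearMap.comp_apply, hb x hx, ha x hx]
  one_mem' := fun x _ => rfl
  inv_mem' := by
    intro a ha x hx
    have h : lin a⁻¹ (lin a x) = x := by
      rw [← LinearMap.comp_apply, ← lin_mul, inv_mul_cancel]; rfl
    rwa [ha x hx] at h

def hEmb (h : P.H) : V →L[ℝ] V := ((h : G2) : (V →L[ℝ] V)ˣ)

/-- The Grassmannian of `k`-planes in `P`. -/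
def Gr (k : ℕ) : Type := {U : Submodule ℝ V // U ≤ P.1 ∧ Module.finrank ℝ U = k}

/-- Full flags in `P`. -/
def Flag : Type := {U : P.Gr 1 × P.Gr 2 // U.1.1 ≤ U.2.1}

variable {P}

def Gr.emb {k : ℕ} (U : P.Gr k) : V →L[ℝ] V := grEmb U.1

def Flag.emb (U : P.Flag) : (V →L[ℝ] V) × (V →L[ℝ] V) := (U.1.1.emb, U.1.2.emb)

variable (P)

/-- `W` is the graph of a linear map `U → P^⊥`. -/
def IsGraphOver (U W : Submodule ℝ V) : Prop :=
  ∃ φ : U →ₗ[ℝ] V, (∀ u, φ u ∈ P.perp) ∧ W = LinearMap.range (U.subtype + φ)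

end SymSpace

/-- A linear map `f : ℝⁿ → ℝ^{3,4}` is isometric for the diagonal form with weights `w`. -/
def IsIsometric {n : ℕ} (w : Fin n → ℝ) (f : EuclideanSpace ℝ (Fin n) →ₗ[ℝ] V) : Prop :=
  ∀ x y, q (f x) (f y) = diagForm w x y

/-- Annihilator photons contained in a subspace. -/
def PhoIn (W : Submodule ℝ V) : Set Pho := {T | T.plane ≤ W}

end SplitG2

end

open SplitG2

/-!
Extend `x, y ∈ P` and `z ∈ P^⊥` of norms `1, 1, -1` with `x ⟂ y` to a basis of `ℝ^{3,4}` by taking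
cross products: `G₂'` acts simply transitively on such triads, so `H_P`, which fixes `x` and `y`,
acts simply transitively on the 3-sphere of vectors of norm `-1` in `P^⊥`.

An isotropic subspace `W` with `W × W = 0` meets `P^⊥` trivially, so it is a graph over
`U = π_P(W)`. If `a + b ∈ W` with `a ∈ U` of norm `1`, then `b` has norm `-1`, and expanding
`(a + b) × (x + y) = 0` shows that `W` is the graph of `x ↦ -a × (x × b)`. Thus `W` is determined
by `U`, `a` and `b`; conversely every unit vector `b ∈ P^⊥` occurs. Hence the fibers are free
`H_P`-orbits, and an analytic choice of `a ∈ U` gives local sections.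

The transverse pairs contain the opposite pairs (nonorthogonal lines, planes in perfect duality),
which form a single open orbit. Two points of one fiber are opposite since their vectors
`b ≠ b'` in the definite space `P^⊥` satisfy `1 + q(b, b') > 0`. A fiber is maximal because for
every point `p` outside it there are `p'` in the fiber and a `G₂'`-invariant property that
`(p, p')` has but that `(p, h • p')` lacks for some `h ∈ H_P` arbitrarily close to `1`, so
`(p, p')` is not in an open orbit. The property is orthogonality for lines, and meeting
nontrivially for planes; a flag outside the fiber has its line or its plane outside the
corresponding fiber.
-/

noncomputable section

namespace SplitG2

/-! ### Triads and the elements of `G₂'` they define -/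

lemma cross_anticomm (x y : V) : cross x y = -cross y x :=
  (LinearMap.IsAlt.neg (B := cross) cross_self y x).symm

lemma q_cross_right (x y : V) : q (cross x y) y = 0 := by
  rw [cross_anticomm, map_neg, LinearMap.neg_apply, q_cross_left, neg_zero]

lemma q_cross_cyclic (x y z : V) : q (cross x y) z = q (cross y z) x := by
  have h := q_cross_left (x + z) y
  simp only [map_add, LinearMap.add_apply, q_cross_left] at h
  rw [cross_anticomm y z, map_neg, LinearMap.neg_apply]
  linarith

lemma q_cross_left_comm (x y z : V) : q (cross x y) z = -q y (cross x z) := by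
  rw [q_cross_cyclic, q_cross_cyclic, cross_anticomm, map_neg, LinearMap.neg_apply, q_comm y]

lemma q_cross_cross_left (x y z : V) :
    q (cross x y) (cross x z) = q x x * q y z - q x y * q x z := by
  rw [q_cross_left_comm, cross_cross, map_add, map_smul, map_smul, q_comm y x, smul_eq_mul,
    smul_eq_mul]
  ring

lemma cross_cross_self_left (x y : V) : cross x (cross y x) = q x x • y - q x y • x := by
  rw [cross_anticomm y, map_neg, cross_cross]
  module

lemma cross_left_comm_polarized (x y z : V) :
    cross x (cross y z) = -cross y (cross x z) - (2 * q x y) • z + q x z • y + q y z • x := by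
  have h := cross_cross (x + y) z
  simp only [map_add, LinearMap.add_apply, cross_cross x z, cross_cross y z, q_comm y x] at h
  linear_combination (norm := module) h

lemma cross_left_comm_of_orthogonal {x y z : V} (hxy : q x y = 0) (hxz : q x z = 0)
    (hyz : q y z = 0) : cross x (cross y z) = -cross y (cross x z) := by
  rw [cross_left_comm_polarized, hxy, hxz, hyz]
  module

lemma cross_antiassoc_of_orthogonal {x y z : V} (hxy : q x y = 0) (hxz : q x z = 0)
    (hyz : q y z = 0) : cross x (cross y z) = -cross (cross x y) z := by
  rw [cross_anticomm y z, map_neg, cross_left_comm_of_orthogonal hxz hxy (q_comm z y ▸ hyz),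
    neg_neg, cross_anticomm]

lemma eq_zero_of_forall_q_eq_zero {v : V} (h : ∀ u, q u v = 0) : v = 0 := by
  ext i
  have hi := h (EuclideanSpace.single i 1)
  rw [q_apply] at hi
  fin_cases i <;> simpa using hi

/-- The split octonions are a simple algebra. -/
lemma injective_of_map_cross {f : V →ₗ[ℝ] V} (hf : ∀ u v, f (cross u v) = cross (f u) (f v))
    (hne : f ≠ 0) : Function.Injective f := by
  rw [injective_iff_map_eq_zero]
  intro v hv
  -- apply `f` to `u × (u × v)` and use the double cross product identity
  have hsmul (u : V) : q u v • f u = 0 := by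
    have h : f (cross u (cross u v)) = 0 := by simp only [hf, hv, map_zero]
    simpa [cross_cross, hv] using h
  obtain ⟨w, hw⟩ : ∃ w, f w ≠ 0 := by
    by_contra! h
    exact hne (LinearMap.ext h)
  have hwv : q w v = 0 := (smul_eq_zero.1 (hsmul w)).resolve_right hw
  refine eq_zero_of_forall_q_eq_zero fun u => ?_
  have h : q u v • f w = 0 := by
    have huw := hsmul (u + w)
    rwa [map_add, LinearMap.add_apply, hwv, add_zero, map_add, smul_add, hsmul u,
      zero_add] at huw
  exact (smul_eq_zero.1 h).resolve_right hw

/-- Orthogonal vectors of square norms `1`, `1`, `-1`, the third of which is also orthogonal to the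
product of the others. Such a triple generates the split octonions, with the multiplication table
of the standard generators. -/
structure IsTriad (x y z : V) : Prop where
  xx : q x x = 1
  yy : q y y = 1
  zz : q z z = -1
  xy : q x y = 0
  xz : q x z = 0
  yz : q y z = 0
  xyz : q (cross x y) z = 0

/-- The linear map carrying the standard basis to the basis generated by `x`, `y`, `z`. The signs
are those of the multiplication table: the standard basis is
`e₀, e₁, e₀ × e₁, e₃, -e₀ × e₃, -e₁ × e₃, -(e₀ × e₁) × e₃`. -/
def frameMap (x y z : V) : V →L[ℝ] V :=
  (EuclideanSpace.proj 0 : V →L[ℝ] ℝ).smulRight x +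
  (EuclideanSpace.proj 1 : V →L[ℝ] ℝ).smulRight y +
  (EuclideanSpace.proj 2 : V →L[ℝ] ℝ).smulRight (cross x y) +
  (EuclideanSpace.proj 3 : V →L[ℝ] ℝ).smulRight z -
  (EuclideanSpace.proj 4 : V →L[ℝ] ℝ).smulRight (cross x z) -
  (EuclideanSpace.proj 5 : V →L[ℝ] ℝ).smulRight (cross y z) -
  (EuclideanSpace.proj 6 : V →L[ℝ] ℝ).smulRight (cross (cross x y) z)

lemma frameMap_apply (x y z v : V) : frameMap x y z v =
    v 0 • x + v 1 • y + v 2 • cross x y + v 3 • z - v 4 • cross x z - v 5 • cross y z -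
      v 6 • cross (cross x y) z := by
  simp [frameMap]

lemma lin_frameMap (g : G2) (x y z v : V) :
    lin g (frameMap x y z v) = frameMap (lin g x) (lin g y) (lin g z) v := by
  simp only [frameMap_apply, map_add, map_sub, map_smul, lin_cross]

lemma contDiff_frameMap {n : WithTop ℕ∞} (x y : V) : ContDiff ℝ n (frameMap x y) := by
  have hcross (w : V) : ContDiff ℝ n (cross w) := (cross w).toContinuousLinearMap.contDiff
  unfold frameMap
  fun_prop

namespace IsTriad

variable {x y z : V}

lemma cross_snd_cross_fst_snd (h : IsTriad x y z) : cross y (cross x y) = x := by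
  rw [cross_cross_self_left, h.yy, q_comm, h.xy]
  module

/-- The symmetry of order three of the multiplication table. -/
lemma rotate (h : IsTriad x y z) : IsTriad y (cross x y) z where
  xx := h.yy
  yy := by rw [q_cross_cross, h.xx, h.yy, h.xy]; norm_num
  zz := h.zz
  xy := by rw [q_comm, q_cross_right]
  xz := h.yz
  yz := h.xyz
  xyz := by rw [h.cross_snd_cross_fst_snd, h.xz]

lemma rotate_rotate (h : IsTriad x y z) : IsTriad (cross x y) x z := by
  simpa only [h.cross_snd_cross_fst_snd] using h.rotate.rotate

lemma cross_fst_cross_fst_thd (h : IsTriad x y z) : cross x (cross x z) = -z := by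
  rw [cross_cross, h.xx, h.xz]
  module

lemma cross_fst_cross_snd_thd (h : IsTriad x y z) : cross x (cross y z) = -cross (cross x y) z :=
  cross_antiassoc_of_orthogonal h.xy h.xz h.yz

lemma cross_snd_cross_fst_thd (h : IsTriad x y z) : cross y (cross x z) = cross (cross x y) z := by
  rw [cross_left_comm_of_orthogonal (q_comm x y ▸ h.xy) h.yz h.xz, h.cross_fst_cross_snd_thd,
    neg_neg]

lemma cross_thd_cross_fst_thd (h : IsTriad x y z) : cross z (cross x z) = -x := by
  rw [cross_cross_self_left, h.zz, q_comm, h.xz]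
  module

lemma cross_thd_cross_cross_thd (h : IsTriad x y z) :
    cross (cross x z) (cross y z) = cross x y := by
  have hx : q (cross y z) x = 0 := by rw [← q_cross_cyclic, h.xyz]
  rw [cross_anticomm, cross_left_comm_of_orthogonal hx (q_cross_right y z) h.xz, neg_neg,
    cross_anticomm _ z, h.rotate.cross_thd_cross_fst_thd, neg_neg]

/-- Both sides are expanded in the basis generated by the triad; the multiplication table consists
of the five preceding lemmas and their rotations. -/
lemma frameMap_cross (h : IsTriad x y z) (u v : V) :
    frameMap x y z (cross u v) = cross (frameMap x y z u) (frameMap x y z v) := by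
  have hy := h.rotate
  have hc := h.rotate_rotate
  have hyc : cross y (cross x y) = x := h.cross_snd_cross_fst_snd
  have hcx : cross (cross x y) x = y := by simpa only [hyc] using hy.cross_snd_cross_fst_snd
  simp only [frameMap_apply]
  obtain ⟨c, hxy⟩ : ∃ c, cross x y = c := ⟨_, rfl⟩
  simp only [hxy] at hy hc hyc hcx ⊢
  simp only [map_add, map_sub, map_smul, LinearMap.add_apply, LinearMap.sub_apply,
    LinearMap.smul_apply, cross_self, hxy, hyc, hcx,
    cross_anticomm y x, cross_anticomm c y, cross_anticomm x c,
    cross_anticomm z x, cross_anticomm z y, cross_anticomm z c,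
    cross_anticomm (cross x z) x, cross_anticomm (cross x z) y, cross_anticomm (cross x z) c,
    cross_anticomm (cross x z) z, cross_anticomm (cross y z) x, cross_anticomm (cross y z) y,
    cross_anticomm (cross y z) c, cross_anticomm (cross y z) z, cross_anticomm (cross c z) x,
    cross_anticomm (cross c z) y, cross_anticomm (cross c z) c, cross_anticomm (cross c z) z,
    cross_anticomm (cross y z) (cross x z), cross_anticomm (cross c z) (cross y z),
    cross_anticomm (cross x z) (cross c z),
    h.cross_fst_cross_fst_thd, hy.cross_fst_cross_fst_thd, hc.cross_fst_cross_fst_thd,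
    h.cross_fst_cross_snd_thd, hy.cross_fst_cross_snd_thd, hc.cross_fst_cross_snd_thd,
    h.cross_snd_cross_fst_thd, hy.cross_snd_cross_fst_thd, hc.cross_snd_cross_fst_thd,
    h.cross_thd_cross_fst_thd, hy.cross_thd_cross_fst_thd, hc.cross_thd_cross_fst_thd,
    h.cross_thd_cross_cross_thd, hy.cross_thd_cross_cross_thd, hc.cross_thd_cross_cross_thd]
  simp only [cross_apply u v, crossFun_eq u v, Matrix.cons_val]
  module

lemma frameMap_injective (h : IsTriad x y z) : Function.Injective (frameMap x y z) := by
  refine injective_of_map_cross (f := frameMap x y z) h.frameMap_cross fun h0 => ?_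
  have hx : frameMap x y z (EuclideanSpace.single 0 1) = x := by simp [frameMap_apply]
  have : x = 0 := hx ▸ LinearMap.congr_fun h0 _
  simpa [this] using h.xx

/-- The element of `G₂'` carrying the standard triad to `x`, `y`, `z`. -/
def frame (h : IsTriad x y z) : G2 :=
  ⟨ContinuousLinearEquiv.toUnit (LinearEquiv.ofInjectiveEndo (frameMap x y z : V →ₗ[ℝ] V)
    h.frameMap_injective).toContinuousLinearEquiv, h.frameMap_cross⟩

lemma lin_frame (h : IsTriad x y z) (v : V) : lin h.frame v = frameMap x y z v := rfl

end IsTriad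

lemma lin_ext {g h : G2} (e : ∀ v, lin g v = lin h v) : g = h :=
  Subtype.ext (Units.ext (ContinuousLinearMap.ext e))

lemma lin_inv_apply (g : G2) (v : V) : lin g⁻¹ (lin g v) = v := by
  rw [← LinearMap.comp_apply, ← lin_mul, inv_mul_cancel, lin_one, LinearMap.id_apply]

lemma lin_apply_inv (g : G2) (v : V) : lin g (lin g⁻¹ v) = v := by
  rw [← LinearMap.comp_apply, ← lin_mul, mul_inv_cancel, lin_one, LinearMap.id_apply]

/-! ### Analytic functions on embedded spaces -/

open Filter Topology in
/-- Near `x₀` the function `F` is the restriction along `eX` of an analytic function. Analyticity is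
used to obtain smooth maps because, unlike `ContDiffAt ℝ ∞`, it extends to a neighborhood. -/
def AnalyticNear {X E E' : Type*} [NormedAddCommGroup E] [NormedSpace ℝ E]
    [NormedAddCommGroup E'] [NormedSpace ℝ E'] (eX : X → E) (F : X → E') (x₀ : X) : Prop :=
  ∃ g : E → E', ContDiffAt ℝ ω g (eX x₀) ∧ ∀ᶠ y in comap eX (𝓝 (eX x₀)), g (eX y) = F y

section AnalyticNear

open Filter Topology

lemma of_eventually_comap_nhds {X E : Type*} [TopologicalSpace E] {eX : X → E} {x₀ : X}
    {p : X → Prop} (h : ∀ᶠ y in comap eX (𝓝 (eX x₀)), p y) : p x₀ := by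
  rw [eventually_comap] at h
  exact h.self_of_nhds x₀ rfl

variable {X Y E E' E'' E₃ : Type*} [NormedAddCommGroup E] [NormedSpace ℝ E]
  [NormedAddCommGroup E'] [NormedSpace ℝ E'] [NormedAddCommGroup E''] [NormedSpace ℝ E'']
  [NormedAddCommGroup E₃] [NormedSpace ℝ E₃]
  {eX : X → E} {eY : Y → E'} {x₀ : X}

lemma smoothMap_of_analyticNear {f : X → Y} (h : ∀ x, AnalyticNear eX (fun y => eY (f y)) x) :
    SmoothMap eX eY f := by
  intro x
  obtain ⟨g, hg, he⟩ := h x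
  rw [eventually_comap] at he
  obtain ⟨O, hO, hOo, hx⟩ := eventually_nhds_iff.1 (he.and (hg.eventually (by simp)))
  exact ⟨O, hOo, hx, g, fun y hy => ((hO y hy).2.of_le (by simp)).contDiffWithinAt,
    fun y hy => (hO _ hy).1 y rfl⟩

namespace AnalyticNear

lemma of_contDiffAt {F : E → E'} (h : ContDiffAt ℝ ω F (eX x₀)) :
    AnalyticNear eX (fun x => F (eX x)) x₀ := ⟨F, h, Eventually.of_forall fun _ => rfl⟩

lemma emb : AnalyticNear eX eX x₀ := of_contDiffAt (F := id) contDiffAt_id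

lemma const (c : E') : AnalyticNear eX (fun _ => c) x₀ :=
  of_contDiffAt (F := fun _ => c) contDiffAt_const

lemma congr {F G : X → E'} (h : AnalyticNear eX F x₀)
    (e : ∀ᶠ y in comap eX (𝓝 (eX x₀)), F y = G y) : AnalyticNear eX G x₀ := by
  obtain ⟨g, hg, he⟩ := h
  exact ⟨g, hg, by filter_upwards [he, e] with y h1 h2 using h1.trans h2⟩

lemma tendsto {F : X → E'} (h : AnalyticNear eX F x₀) :
    Tendsto F (comap eX (𝓝 (eX x₀))) (𝓝 (F x₀)) := by
  obtain ⟨g, hg, he⟩ := h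
  rw [← of_eventually_comap_nhds he]
  exact Tendsto.congr' he (hg.continuousAt.tendsto.comp tendsto_comap)

lemma comp {F : X → E'} (h : AnalyticNear eX F x₀) {G : E' → E''}
    (hG : ContDiffAt ℝ ω G (F x₀)) : AnalyticNear eX (fun x => G (F x)) x₀ := by
  obtain ⟨g, hg, he⟩ := h
  rw [← of_eventually_comap_nhds he] at hG
  exact ⟨G ∘ g, hG.comp _ hg, by filter_upwards [he] with y hy; simp [hy]⟩

lemma comp_map {f : X → Y} {F : Y → E''} (hF : AnalyticNear eY F (f x₀))
    (hf : AnalyticNear eX (fun x => eY (f x)) x₀) : AnalyticNear eX (fun x => F (f x)) x₀ := by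
  have ht : Tendsto f (comap eX (𝓝 (eX x₀))) (comap eY (𝓝 (eY (f x₀)))) :=
    tendsto_comap_iff.2 hf.tendsto
  obtain ⟨g, hg, he⟩ := hF
  exact (hf.comp hg).congr (ht.eventually he)

lemma prodMk {F : X → E'} {G : X → E''} (hF : AnalyticNear eX F x₀)
    (hG : AnalyticNear eX G x₀) : AnalyticNear eX (fun x => (F x, G x)) x₀ := by
  obtain ⟨f, hf, ef⟩ := hF
  obtain ⟨g, hg, eg⟩ := hG
  exact ⟨fun t => (f t, g t), hf.prodMk hg, by filter_upwards [ef, eg] with y h1 h2; simp [h1, h2]⟩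

lemma comp₂ {F : X → E'} {G : X → E''} (hF : AnalyticNear eX F x₀)
    (hG : AnalyticNear eX G x₀) {B : E' → E'' → E₃}
    (hB : ContDiffAt ℝ ω (fun p : E' × E'' => B p.1 p.2) (F x₀, G x₀)) :
    AnalyticNear eX (fun x => B (F x) (G x)) x₀ :=
  (hF.prodMk hG).comp (G := fun p : E' × E'' => B p.1 p.2) hB

lemma sub {F G : X → E'} (hF : AnalyticNear eX F x₀) (hG : AnalyticNear eX G x₀) :
    AnalyticNear eX (fun x => F x - G x) x₀ :=
  hF.comp₂ hG (contDiffAt_fst.sub contDiffAt_snd)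

lemma smul {c : X → ℝ} {G : X → E'} (hF : AnalyticNear eX c x₀) (hG : AnalyticNear eX G x₀) :
    AnalyticNear eX (fun x => c x • G x) x₀ :=
  hF.comp₂ hG (contDiffAt_fst.smul contDiffAt_snd)

lemma clm_comp {F : X → E'' →L[ℝ] E₃} {G : X → E' →L[ℝ] E''} (hF : AnalyticNear eX F x₀)
    (hG : AnalyticNear eX G x₀) : AnalyticNear eX (fun x => F x ∘L G x) x₀ :=
  hF.comp₂ hG (contDiffAt_fst.clm_comp contDiffAt_snd)

lemma clm_apply {F : X → E'' →L[ℝ] E₃} {G : X → E''} (hF : AnalyticNear eX F x₀)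
    (hG : AnalyticNear eX G x₀) : AnalyticNear eX (fun x => F x (G x)) x₀ :=
  hF.comp₂ hG (contDiffAt_fst.clm_apply contDiffAt_snd)

lemma clm (L : E' →L[ℝ] E'') {F : X → E'} (hF : AnalyticNear eX F x₀) :
    AnalyticNear eX (fun x => L (F x)) x₀ := hF.comp L.contDiff.contDiffAt

lemma linearMap [FiniteDimensional ℝ E'] (L : E' →ₗ[ℝ] E'') {F : X → E'}
    (hF : AnalyticNear eX F x₀) : AnalyticNear eX (fun x => L (F x)) x₀ :=
  hF.clm (LinearMap.toContinuousLinearMap L)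

lemma ringInverse {R : Type*} [NormedRing R] [NormedAlgebra ℝ R] [HasSummableGeomSeries R]
    {F : X → R} (hF : AnalyticNear eX F x₀) (hu : IsUnit (F x₀)) :
    AnalyticNear eX (fun x => Ring.inverse (F x)) x₀ := by
  obtain ⟨u, hu⟩ := hu
  exact hF.comp (hu ▸ contDiffAt_ringInverse ℝ u)

lemma eventually_isUnit {R : Type*} [NormedRing R] [NormedAlgebra ℝ R] [HasSummableGeomSeries R]
    {F : X → R} (hF : AnalyticNear eX F x₀) (hu : IsUnit (F x₀)) :
    ∀ᶠ x in comap eX (𝓝 (eX x₀)), IsUnit (F x) :=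
  hF.tendsto (Units.isOpen.mem_nhds hu)

end AnalyticNear

/-! ### Orthogonal projections depend analytically on the subspace -/

section StarProjection

variable {U F : Type*} [NormedAddCommGroup U] [InnerProductSpace ℝ U] [CompleteSpace U]
  [NormedAddCommGroup F] [InnerProductSpace ℝ F] [CompleteSpace F]

open ContinuousLinearMap

lemma contDiff_adjoint {n : WithTop ℕ∞} : ContDiff ℝ n fun A : U →L[ℝ] F => adjoint A :=
  IsBoundedLinearMap.contDiff
    { map_add := map_add adjoint
      map_smul := fun c A => by simp
      bound := ⟨1, one_pos, fun A => by simp⟩ }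

lemma injective_of_isUnit_adjoint_comp {B : U →L[ℝ] F} (hB : IsUnit (adjoint B ∘L B)) :
    Function.Injective B := by
  have hinv : Function.LeftInverse (Ring.inverse (adjoint B ∘L B) ∘L adjoint B) B :=
    DFunLike.congr_fun (Ring.inverse_mul_cancel _ hB)
  exact hinv.injective

lemma starProjection_eq_of_isUnit {B : U →L[ℝ] F} {W : Submodule ℝ F}
    [W.HasOrthogonalProjection] (hB : IsUnit (adjoint B ∘L B))
    (hW : LinearMap.range (B : U →ₗ[ℝ] F) = W) :
    W.starProjection = B ∘L Ring.inverse (adjoint B ∘L B) ∘L adjoint B := by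
  have hinv (w : U) : adjoint B (B (Ring.inverse (adjoint B ∘L B) w)) = w :=
    DFunLike.congr_fun (Ring.mul_inverse_cancel _ hB) w
  subst hW
  ext v
  refine Submodule.eq_starProjection_of_mem_of_inner_eq_zero ⟨_, rfl⟩ ?_
  rintro _ ⟨u, rfl⟩
  rw [ContinuousLinearMap.coe_coe, ← adjoint_inner_left, map_sub]
  simp only [ContinuousLinearMap.comp_apply, hinv, sub_self, inner_zero_left]

end StarProjection

variable {F : Type*} [NormedAddCommGroup F] [InnerProductSpace ℝ F] [FiniteDimensional ℝ F]

lemma exists_comp_eq_subtypeL (A : E' →L[ℝ] F) :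
    ∃ C : LinearMap.range (A : E' →ₗ[ℝ] F) →L[ℝ] E',
      A ∘L C = (LinearMap.range (A : E' →ₗ[ℝ] F)).subtypeL := by
  obtain ⟨s, hs⟩ := LinearMap.exists_rightInverse_of_surjective
    (LinearMap.rangeRestrict (A : E' →ₗ[ℝ] F)) (LinearMap.range_rangeRestrict _)
  exact ⟨LinearMap.toContinuousLinearMap s,
    ContinuousLinearMap.ext fun w => congrArg Subtype.val (LinearMap.congr_fun hs w)⟩

open ContinuousLinearMap in
/-- The projection onto the range of an injective `B` is `B (B* B)⁻¹ B*`. -/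
lemma AnalyticNear.starProjection {W : X → Submodule ℝ F} {A : X → E' →L[ℝ] F}
    (hA : AnalyticNear eX A x₀)
    (hrange : ∀ᶠ x in comap eX (𝓝 (eX x₀)), LinearMap.range (A x : E' →ₗ[ℝ] F) = W x)
    (hrank : ∀ x, Module.finrank ℝ (W x) = Module.finrank ℝ (W x₀)) :
    AnalyticNear eX (fun x => (W x).starProjection) x₀ := by
  have := FiniteDimensional.complete ℝ F
  -- a right inverse `C` of `A x₀` makes the fixed space `W x₀` a parameter space for all `W x`
  obtain ⟨C, hC⟩ : ∃ C : W x₀ →L[ℝ] E', A x₀ ∘L C = (W x₀).subtypeL := by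
    rw [← of_eventually_comap_nhds hrange]
    exact exists_comp_eq_subtypeL (A x₀)
  have hB : AnalyticNear eX (fun x => A x ∘L C) x₀ := hA.clm_comp (.const C)
  have hB' : AnalyticNear eX (fun x => adjoint (A x ∘L C)) x₀ := hB.comp contDiff_adjoint.contDiffAt
  have hgram : AnalyticNear eX (fun x => adjoint (A x ∘L C) ∘L (A x ∘L C)) x₀ := hB'.clm_comp hB
  have hunit₀ : IsUnit (adjoint (A x₀ ∘L C) ∘L (A x₀ ∘L C)) := by
    have hid : adjoint (A x₀ ∘L C) ∘L (A x₀ ∘L C) = 1 := by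
      ext w
      simp [hC, Submodule.adjoint_subtypeL]
    exact hid ▸ isUnit_one
  have hunit : ∀ᶠ x in comap eX (𝓝 (eX x₀)), IsUnit (adjoint (A x ∘L C) ∘L (A x ∘L C)) :=
    eventually_isUnit (R := W x₀ →L[ℝ] W x₀) hgram hunit₀
  refine (hB.clm_comp ((hgram.ringInverse hunit₀).clm_comp hB')).congr ?_
  filter_upwards [hunit, hrange] with x hx hWx
  refine (starProjection_eq_of_isUnit hx (Submodule.eq_of_le_of_finrank_eq ?_ ?_)).symm
  · rw [← hWx]
    exact LinearMap.range_comp_le_range (C : W x₀ →ₗ[ℝ] E') (A x : E' →ₗ[ℝ] F)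
  · rw [LinearMap.finrank_range_of_inj (injective_of_isUnit_adjoint_comp hx), hrank x]

lemma AnalyticNear.grEmb_map {m n : ℕ} {W : X → Submodule ℝ (EuclideanSpace ℝ (Fin m))}
    {W' : X → Submodule ℝ (EuclideanSpace ℝ (Fin n))}
    {A : X → EuclideanSpace ℝ (Fin m) →L[ℝ] EuclideanSpace ℝ (Fin n)}
    (hA : AnalyticNear eX A x₀) (hW : AnalyticNear eX (fun x => grEmb (W x)) x₀)
    (hmap : ∀ x, W' x = (W x).map (A x).toLinearMap)
    (hrank : ∀ x, Module.finrank ℝ (W' x) = Module.finrank ℝ (W' x₀)) :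
    AnalyticNear eX (fun x => grEmb (W' x)) x₀ := by
  refine (hA.clm_comp hW).starProjection (Eventually.of_forall fun x => ?_) hrank
  rw [hmap]
  exact (LinearMap.range_comp _ _).trans (congrArg _ (Submodule.range_starProjection (W x)))

end AnalyticNear

lemma grEmb_apply_mem {n : ℕ} (W : Submodule ℝ (EuclideanSpace ℝ (Fin n)))
    (v : EuclideanSpace ℝ (Fin n)) : grEmb W v ∈ W :=
  Submodule.starProjection_apply_mem W v

lemma grEmb_apply_eq {n : ℕ} {W : Submodule ℝ (EuclideanSpace ℝ (Fin n))}
    {v : EuclideanSpace ℝ (Fin n)} (hv : v ∈ W) : grEmb W v = v :=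
  Submodule.starProjection_eq_self_iff.2 hv

/-! ### Principal bundles from local sections -/

section Bundle

open Filter Topology

section SmoothMap

variable {X Y Z E E' E'' : Type*} [NormedAddCommGroup E] [NormedSpace ℝ E]
  [NormedAddCommGroup E'] [NormedSpace ℝ E'] [NormedAddCommGroup E''] [NormedSpace ℝ E'']
  {eX : X → E} {eY : Y → E'} {eZ : Z → E''}

lemma SmoothMap.comp {f : X → Y} {g : Y → Z} (hg : SmoothMap eY eZ g) (hf : SmoothMap eX eY f) :
    SmoothMap eX eZ (fun x => g (f x)) := by
  intro x
  obtain ⟨O, hO, hx, F, hF, hFf⟩ := hf x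
  obtain ⟨O', hO', hx', G, hG, hGg⟩ := hg (f x)
  refine ⟨O ∩ F ⁻¹' O', hF.continuousOn.isOpen_inter_preimage hO hO', ⟨hx, ?_⟩, G ∘ F,
    hG.comp (hF.mono Set.inter_subset_left) fun t ht => ht.2, ?_⟩
  · rwa [Set.mem_preimage, hFf x hx]
  · rintro y ⟨hy, hy'⟩
    rw [Set.mem_preimage, hFf y hy] at hy'
    rw [Function.comp_apply, hFf y hy, hGg _ hy']

lemma smoothMap_of_contDiff {f : X → Y} {F : E → E'} (hF : ContDiff ℝ ∞ F)
    (h : ∀ x, F (eX x) = eY (f x)) : SmoothMap eX eY f :=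
  fun _ => ⟨Set.univ, isOpen_univ, trivial, F, hF.contDiffOn, fun y _ => h y⟩

lemma IsDiffeo.trans {f : X ≃ Y} {g : Y ≃ Z} (hf : IsDiffeo eX eY f) (hg : IsDiffeo eY eZ g) :
    IsDiffeo eX eZ (f.trans g) :=
  ⟨hg.1.comp hf.1, hf.2.comp hg.2⟩

end SmoothMap

variable {F B H E₁ E₂ E₃ : Type*}
  [NormedAddCommGroup E₁] [NormedSpace ℝ E₁] [NormedAddCommGroup E₂] [NormedSpace ℝ E₂]
  [NormedAddCommGroup E₃] [NormedSpace ℝ E₃] [Group H] [MulAction H F]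
  {eF : F → E₁} {eB : B → E₂} {eH : H → E₃} {π : F → B}

/-- A section `s` of `π` over `N` that meets every orbit over `N`. The group element carrying
`s (π x)` to `x` is required to depend analytically on `x`, which makes the trivialization defined
by `s` a diffeomorphism. -/
structure IsAnalyticSection (eF : F → E₁) (eB : B → E₂) (eH : H → E₃) (π : F → B) {N : Set B}
    (s : N → F) : Prop where
  proj_eq : ∀ c, π (s c) = c
  analytic : ∀ c, AnalyticNear (fun c : N => eB c) (fun c => eF (s c)) c
  exists_smul_eq : ∀ (x : F) (hx : π x ∈ N), ∃ h : H, h • s ⟨π x, hx⟩ = x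
  exists_analytic_division : ∀ x₀ : F, π x₀ ∈ N → ∃ D : F → E₃, AnalyticNear eF D x₀ ∧
    ∀ᶠ x in comap eF (𝓝 (eF x₀)), ∀ (hx : π x ∈ N) (h : H), h • s ⟨π x, hx⟩ = x → D x = eH h

namespace IsAnalyticSection

variable {N : Set B} {s : N → F}

lemma proj_smul (hs : IsAnalyticSection eF eB eH π s) (hinv : ∀ (h : H) x, π (h • x) = π x)
    (p : N × H) : π (p.2 • s p.1) = p.1 := by
  rw [hinv, hs.proj_eq]

/-- The trivialization `(c, h) ↦ h • s c` over the domain of a section `s`. -/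
def trivialization (hs : IsAnalyticSection eF eB eH π s) (hinv : ∀ (h : H) x, π (h • x) = π x)
    (hfree : ∀ (h : H) (x : F), h • x = x → h = 1) : N × H ≃ π ⁻¹' N :=
  Equiv.ofBijective
    (fun p => ⟨p.2 • s p.1, by
      rw [Set.mem_preimage, hs.proj_smul hinv]
      exact p.1.2⟩) <| by
    constructor
    · rintro ⟨c, h⟩ ⟨d, k⟩ e
      have hval : h • s c = k • s d := congrArg Subtype.val e
      obtain rfl : c = d := Subtype.ext <| by
        rw [← hs.proj_smul hinv (c, h), ← hs.proj_smul hinv (d, k), hval]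
      have hone : k⁻¹ * h = 1 := hfree _ (s c) (by rw [mul_smul, hval, inv_smul_smul])
      rw [inv_mul_eq_one.1 hone]
    · rintro ⟨x, hx⟩
      obtain ⟨h, hh⟩ := hs.exists_smul_eq x hx
      exact ⟨(⟨π x, hx⟩, h), Subtype.ext hh⟩

variable (hs : IsAnalyticSection eF eB eH π s) (hinv : ∀ (h : H) x, π (h • x) = π x)
  (hfree : ∀ (h : H) (x : F), h • x = x → h = 1)
include hs hinv hfree

lemma trivialization_symm_fst (x : π ⁻¹' N) :
    ((hs.trivialization hinv hfree).symm x).1 = ⟨π x, x.2⟩ := by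
  refine Subtype.ext ?_
  conv_rhs => rw [← (hs.trivialization hinv hfree).apply_symm_apply x]
  exact (hs.proj_smul hinv _).symm

lemma trivialization_symm_snd_smul (x : π ⁻¹' N) :
    ((hs.trivialization hinv hfree).symm x).2 • s ⟨π x, x.2⟩ = x := by
  rw [← hs.trivialization_symm_fst hinv hfree]
  exact congrArg Subtype.val ((hs.trivialization hinv hfree).apply_symm_apply x)

lemma isDiffeo_trivialization
    (hact : ∀ p, AnalyticNear (fun p : H × F => (eH p.1, eF p.2)) (fun p => eF (p.1 • p.2)) p)
    (hproj : ∀ x, AnalyticNear eF (fun x => eB (π x)) x) :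
    IsDiffeo (fun p : N × H => (eB p.1, eH p.2)) (fun x : π ⁻¹' N => eF x)
      (hs.trivialization hinv hfree) := by
  constructor
  · refine smoothMap_of_analyticNear fun p => ?_
    have hfst : AnalyticNear (fun p : N × H => (eB p.1, eH p.2)) (fun p => eB p.1) p :=
      .of_contDiffAt (F := Prod.fst) contDiffAt_fst
    have hsnd : AnalyticNear (fun p : N × H => (eB p.1, eH p.2)) (fun p => eH p.2) p :=
      .of_contDiffAt (F := Prod.snd) contDiffAt_snd
    exact AnalyticNear.comp_map (f := fun p : N × H => (p.2, s p.1)) (hact (p.2, s p.1))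
      (hsnd.prodMk (.comp_map (f := fun p : N × H => p.1) (hs.analytic p.1) hfst))
  · refine smoothMap_of_analyticNear fun x => ?_
    have hval : AnalyticNear (fun x : π ⁻¹' N => eF x) (fun x => eF x) x := .emb
    obtain ⟨D, hD, hDeq⟩ := hs.exists_analytic_division x x.2
    refine AnalyticNear.congr (.prodMk (.comp_map (f := fun x : π ⁻¹' N => (x : F)) (hproj x) hval)
      (.comp_map (f := fun x : π ⁻¹' N => (x : F)) hD hval)) ?_
    have htendsto : Tendsto (fun x : π ⁻¹' N => (x : F))
        (comap (fun x : π ⁻¹' N => eF x) (𝓝 (eF x))) (comap eF (𝓝 (eF x))) :=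
      tendsto_comap_iff.2 tendsto_comap
    filter_upwards [htendsto.eventually hDeq] with y hy
    rw [hs.trivialization_symm_fst hinv hfree,
      hy y.2 _ (hs.trivialization_symm_snd_smul hinv hfree y)]

end IsAnalyticSection

theorem isPrincipalBundle_of_sections
    (hact : ∀ p, AnalyticNear (fun p : H × F => (eH p.1, eF p.2)) (fun p => eF (p.1 • p.2)) p)
    (hproj : ∀ x, AnalyticNear eF (fun x => eB (π x)) x)
    (hinv : ∀ (h : H) x, π (h • x) = π x)
    (hfree : ∀ (h : H) (x : F), h • x = x → h = 1)
    (hsec : ∀ b : B, ∃ N : Set B, b ∈ N ∧ (∃ O : Set E₂, IsOpen O ∧ N = eB ⁻¹' O) ∧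
      ∃ s : N → F, IsAnalyticSection eF eB eH π s) :
    IsPrincipalBundle eF eB eH π where
  smooth_action := smoothMap_of_analyticNear hact
  smooth_proj := smoothMap_of_analyticNear hproj
  surjective b := by
    obtain ⟨N, hb, -, s, hs⟩ := hsec b
    exact ⟨s ⟨b, hb⟩, hs.proj_eq _⟩
  fiber_iff x y := by
    refine ⟨fun hxy => ?_, fun ⟨h, hh⟩ => hh ▸ (hinv h x).symm⟩
    obtain ⟨N, hx, -, s, hs⟩ := hsec (π x)
    obtain ⟨h, hh⟩ := hs.exists_smul_eq x hx
    obtain ⟨k, hk⟩ := hs.exists_smul_eq y (hxy ▸ hx)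
    refine ⟨k * h⁻¹, ?_⟩
    simp only [← hxy] at hk
    rw [mul_smul, inv_smul_eq_iff.2 hh.symm, hk]
  free := hfree
  locally_trivial b := by
    obtain ⟨N, hb, hN, s, hs⟩ := hsec b
    exact ⟨N, hb, hN, hs.trivialization hinv hfree, hs.proj_smul hinv,
      fun c h k => mul_smul h k (s c), hs.isDiffeo_trivialization hinv hfree hact hproj⟩

theorem IsPrincipalBundle.exists_fiber_diffeo (hb : IsPrincipalBundle eF eB eH π) (b : B) :
    ∃ f : H ≃ π ⁻¹' {b}, IsDiffeo eH (fun x : π ⁻¹' {b} => eF x) f := by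
  obtain ⟨N, hN, -, Φ, hΦ, -, hsmooth, hsmooth_symm⟩ := hb.locally_trivial b
  let c : N := ⟨b, hN⟩
  have hmem (x : π ⁻¹' {b}) : π x ∈ N := by rwa [show π x = b from x.2]
  have hsymm (x : π ⁻¹' {b}) : (c, (Φ.symm ⟨x, hmem x⟩).2) = Φ.symm ⟨x, hmem x⟩ := by
    refine Prod.ext (Subtype.ext ?_) rfl
    have hfst := hΦ (Φ.symm ⟨x, hmem x⟩)
    rw [Φ.apply_symm_apply] at hfst
    exact (show π x = b from x.2).symm.trans hfst
  refine ⟨{ toFun := fun h => ⟨Φ (c, h), hΦ (c, h)⟩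
            invFun := fun x => (Φ.symm ⟨x, hmem x⟩).2
            left_inv := fun h => congrArg Prod.snd (Φ.symm_apply_apply (c, h))
            right_inv := fun x => Subtype.ext <| by
              dsimp only
              rw [hsymm, Φ.apply_symm_apply] }, ?_, ?_⟩
  · exact hsmooth.comp (smoothMap_of_contDiff (f := fun h => (c, h)) (F := fun t => (eB b, t))
      (contDiff_const.prodMk contDiff_id) fun _ => rfl)
  · have hincl : SmoothMap (fun x : π ⁻¹' {b} => eF x) (fun x : π ⁻¹' N => eF x)
        (fun x => ⟨x, hmem x⟩) := smoothMap_of_contDiff (F := id) contDiff_id fun _ => rfl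
    have hsnd : SmoothMap (fun p : N × H => (eB p.1, eH p.2)) eH Prod.snd :=
      smoothMap_of_contDiff (F := Prod.snd) contDiff_snd fun _ => rfl
    exact hsnd.comp (hsmooth_symm.comp hincl)

lemma mem_unitary_quaternion_iff (a : ℍ[ℝ]) : a ∈ unitary ℍ[ℝ] ↔ ‖a‖ = 1 := by
  rw [Unitary.mem_iff, Quaternion.star_mul_self, Quaternion.self_mul_star, and_self,
    Quaternion.normSq_eq_norm_mul_self, ← Quaternion.coe_one, Quaternion.coe_inj, ← pow_two,
    pow_eq_one_iff_of_nonneg (norm_nonneg a) two_ne_zero]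

lemma exists_sphere_diffeo_unitary :
    ∃ f : Metric.sphere (0 : EuclideanSpace ℝ (Fin 4)) 1 ≃ unitary ℍ[ℝ],
      IsDiffeo (fun x : Metric.sphere (0 : EuclideanSpace ℝ (Fin 4)) 1 => x.1)
        (fun a : unitary ℍ[ℝ] => a.1) f := by
  let e := Quaternion.linearIsometryEquivTuple
  refine ⟨e.symm.toEquiv.subtypeEquiv fun x => ?_, ?_, ?_⟩
  · rw [mem_unitary_quaternion_iff, mem_sphere_zero_iff_norm]
    exact (e.symm.norm_map x).symm ▸ Iff.rfl
  · exact smoothMap_of_contDiff (F := e.symm) e.symm.contDiff fun _ => rfl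
  · exact smoothMap_of_contDiff (F := e) e.contDiff fun _ => rfl

theorem IsPrincipalBundle.isThreeSphere (hb : IsPrincipalBundle eF eB eH π)
    (hH : ∃ φ : unitary ℍ[ℝ] ≃* H, IsDiffeo (fun a : unitary ℍ[ℝ] => a.1) eH φ.toEquiv) (b : B) :
    IsThreeSphere eF (π ⁻¹' {b}) := by
  obtain ⟨f, hf⟩ := hb.exists_fiber_diffeo b
  obtain ⟨φ, hφ⟩ := hH
  obtain ⟨k, hk⟩ := exists_sphere_diffeo_unitary
  exact ⟨k.trans (φ.toEquiv.trans f), hk.trans (hφ.trans hf)⟩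

end Bundle

/-! ### The splitting of `ℝ^{3,4}` at a point of the symmetric space -/

lemma exists_smul_q_eq_one {v : V} (hv : 0 < q v v) : ∃ c : ℝ, c ≠ 0 ∧ q (c • v) (c • v) = 1 := by
  refine ⟨(√(q v v))⁻¹, inv_ne_zero (Real.sqrt_ne_zero'.2 hv), ?_⟩
  simp only [map_smul, LinearMap.smul_apply, smul_eq_mul]
  rw [← mul_assoc, ← mul_inv, Real.mul_self_sqrt hv.le, inv_mul_cancel₀ hv.ne']

lemma exists_smul_q_eq_neg_one {v : V} (hv : q v v < 0) :
    ∃ c : ℝ, c ≠ 0 ∧ q (c • v) (c • v) = -1 := by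
  have hv' : 0 < -q v v := neg_pos.2 hv
  refine ⟨(√(-q v v))⁻¹, inv_ne_zero (Real.sqrt_ne_zero'.2 hv'), ?_⟩
  simp only [map_smul, LinearMap.smul_apply, smul_eq_mul]
  rw [← mul_assoc, ← mul_inv, Real.mul_self_sqrt hv'.le, inv_neg, neg_mul, inv_mul_cancel₀ hv.ne]

lemma fstQ_sndQ_ext {v w : V} (h : fstQ v = fstQ w) (h' : sndQ v = sndQ w) : v = w := by
  ext i
  fin_cases i
  · exact congrArg QuaternionAlgebra.imI h
  · exact congrArg QuaternionAlgebra.imJ h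
  · exact congrArg QuaternionAlgebra.imK h
  · exact congrArg QuaternionAlgebra.re h'
  · exact congrArg QuaternionAlgebra.imI h'
  · exact congrArg QuaternionAlgebra.imJ h'
  · exact congrArg QuaternionAlgebra.imK h'

lemma q_self_eq_normSq_sub_normSq (v : V) :
    q v v = Quaternion.normSq (fstQ v) - Quaternion.normSq (sndQ v) := by
  simp only [q_apply, Quaternion.normSq_def', fstQ_re, fstQ_imI, fstQ_imJ, fstQ_imK, sndQ_re,
    sndQ_imI, sndQ_imJ, sndQ_imK]
  ring

lemma q_self_neg_of_fstQ_eq_zero {w : V} (hfst : fstQ w = 0) (hw : w ≠ 0) : q w w < 0 := by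
  have hsnd : sndQ w ≠ 0 := fun h => hw <|
    fstQ_sndQ_ext (hfst.trans (by ext <;> simp)) (h.trans (by ext <;> simp))
  rw [q_self_eq_normSq_sub_normSq, hfst, map_zero, zero_sub, neg_lt_zero]
  exact lt_of_le_of_ne Quaternion.normSq_nonneg (Quaternion.normSq_ne_zero.2 hsnd).symm

namespace SymSpace

variable {P : SymSpace}

lemma q_eq_zero {x v : V} (hx : x ∈ P.1) (hv : v ∈ P.perp) : q x v = 0 := hv x hx

lemma q_eq_zero_symm {x v : V} (hx : x ∈ P.1) (hv : v ∈ P.perp) : q v x = 0 :=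
  (q_comm v x).trans (hv x hx)

lemma cross_mem {x y : V} (hx : x ∈ P.1) (hy : y ∈ P.1) : cross x y ∈ P.1 :=
  P.2.2.2 ▸ Submodule.apply_mem_map₂ cross hx hy

lemma cross_mem_perp_right {x v : V} (hx : x ∈ P.1) (hv : v ∈ P.perp) : cross x v ∈ P.perp := by
  intro y hy
  change q y (cross x v) = 0
  rw [q_comm, q_cross_left_comm, q_eq_zero_symm (cross_mem hx hy) hv, neg_zero]

lemma cross_mem_perp_left {x v : V} (hx : x ∈ P.1) (hv : v ∈ P.perp) : cross v x ∈ P.perp := by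
  rw [cross_anticomm]
  exact P.perp.neg_mem (cross_mem_perp_right hx hv)

lemma proj_mem (v : V) : P.proj v ∈ P.1 := Submodule.projection_apply_mem _ v

lemma sub_proj_mem (v : V) : v - P.proj v ∈ P.perp := Submodule.sub_projection_mem _ v

lemma proj_add {x v : V} (hx : x ∈ P.1) (hv : v ∈ P.perp) : P.proj (x + v) = x := by
  have hx' : P.proj x = x := Submodule.projection_apply_of_mem_left _ hx
  have hv' : P.proj v = 0 := (Submodule.projection_apply_eq_zero_iff _).2 hv
  rw [map_add, hx', hv', add_zero]

lemma add_eq_add {x x' v v' : V} (hx : x ∈ P.1) (hx' : x' ∈ P.1) (hv : v ∈ P.perp)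
    (hv' : v' ∈ P.perp) (h : x + v = x' + v') : x = x' ∧ v = v' := by
  obtain rfl : x = x' := by rw [← proj_add hx hv, h, proj_add hx' hv']
  exact ⟨rfl, add_left_cancel h⟩

lemma exists_unit {U : Submodule ℝ V} (hU : U ≤ P.1) (hd : 0 < Module.finrank ℝ U) :
    ∃ a ∈ U, q a a = 1 := by
  obtain ⟨v, hv, hv0⟩ := U.exists_mem_ne_zero_of_ne_bot (Submodule.one_le_finrank_iff.1 hd)
  obtain ⟨c, -, hc⟩ := exists_smul_q_eq_one (P.2.2.1 v (hU hv) hv0)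
  exact ⟨c • v, U.smul_mem _ hv, hc⟩

lemma exists_orthogonal {U : Submodule ℝ V} (hU : U ≤ P.1) (hd : 1 < Module.finrank ℝ U) {a : V}
    (ha : a ∈ U) (haa : q a a = 1) : ∃ c ∈ U, q c c = 1 ∧ q a c = 0 := by
  obtain ⟨v, hv, hva⟩ : ∃ v ∈ U, v ∉ Submodule.span ℝ {a} := by
    by_contra! hall
    have hspan := finrank_span_le_card (R := ℝ) ({a} : Set V)
    rw [Set.toFinset_singleton, Finset.card_singleton] at hspan
    exact absurd ((Submodule.finrank_mono hall).trans hspan) (not_le.2 hd)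
  have hw : v - q a v • a ≠ 0 := fun h0 => hva <| by
    rw [sub_eq_zero.1 h0]
    exact Submodule.smul_mem _ _ (Submodule.mem_span_singleton_self a)
  have hwU : v - q a v • a ∈ U := U.sub_mem hv (U.smul_mem _ ha)
  obtain ⟨c, -, hc⟩ := exists_smul_q_eq_one (P.2.2.1 _ (hU hwU) hw)
  exact ⟨c • (v - q a v • a), U.smul_mem _ hwU, hc, by simp [haa]⟩

section

variable (P)

lemma exists_orthonormal_pair : ∃ x ∈ P.1, ∃ y ∈ P.1, q x x = 1 ∧ q y y = 1 ∧ q x y = 0 := by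
  obtain ⟨x, hx, xx⟩ := exists_unit (P := P) le_rfl (by rw [P.2.1]; norm_num)
  obtain ⟨y, hy, yy, xy⟩ := exists_orthogonal (P := P) le_rfl (by rw [P.2.1]; norm_num) hx xx
  exact ⟨x, hx, y, hy, xx, yy, xy⟩

/-- The `P^⊥`-component of any negative vector is negative. -/
lemma exists_mem_perp : ∃ z ∈ P.perp, q z z = -1 := by
  obtain ⟨e, he⟩ : ∃ e : V, q e e = -1 := ⟨EuclideanSpace.single 3 1, by simp [q_apply]⟩
  have hp : 0 ≤ q (P.proj e) (P.proj e) := by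
    by_cases h0 : P.proj e = 0
    · simp [h0]
    · exact (P.2.2.1 _ (proj_mem e) h0).le
  have hneg : q (e - P.proj e) (e - P.proj e) < 0 := by
    have hsum : q (P.proj e + (e - P.proj e)) (P.proj e + (e - P.proj e)) = -1 := by
      rw [add_sub_cancel, he]
    have h0 := q_eq_zero (proj_mem (P := P) e) (sub_proj_mem e)
    have h0' := q_eq_zero_symm (proj_mem (P := P) e) (sub_proj_mem e)
    simp only [map_add, LinearMap.add_apply, h0, h0'] at hsum
    linarith
  obtain ⟨c, -, hc⟩ := exists_smul_q_eq_neg_one hneg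
  exact ⟨c • (e - P.proj e), P.perp.smul_mem _ (sub_proj_mem e), hc⟩

/-- `g` carries the splitting `Im ℍ ⊕ ℍ` to `P ⊕ P^⊥`. -/
def Adapted (g : G2) : Prop :=
  (∀ v, lin g v ∈ P.1 ↔ sndQ v = 0) ∧ ∀ v, lin g v ∈ P.perp ↔ fstQ v = 0

end

lemma isTriad {x y z : V} (hx : x ∈ P.1) (hy : y ∈ P.1) (hz : z ∈ P.perp) (xx : q x x = 1)
    (yy : q y y = 1) (xy : q x y = 0) (zz : q z z = -1) : IsTriad x y z :=
  ⟨xx, yy, zz, xy, q_eq_zero hx hz, q_eq_zero hy hz, q_eq_zero (cross_mem hx hy) hz⟩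

section Frame

variable {x y z : V} (hx : x ∈ P.1) (hy : y ∈ P.1) (hz : z ∈ P.perp)
include hx hy

lemma frameMap_mem {v : V} (hv : sndQ v = 0) : frameMap x y z v ∈ P.1 := by
  have h3 : v 3 = 0 := congrArg QuaternionAlgebra.re hv
  have h4 : v 4 = 0 := congrArg QuaternionAlgebra.imI hv
  have h5 : v 5 = 0 := congrArg QuaternionAlgebra.imJ hv
  have h6 : v 6 = 0 := congrArg QuaternionAlgebra.imK hv
  simp only [frameMap_apply, h3, h4, h5, h6, zero_smul, sub_zero, add_zero]
  exact P.1.add_mem (P.1.add_mem (P.1.smul_mem _ hx) (P.1.smul_mem _ hy))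
    (P.1.smul_mem _ (cross_mem hx hy))

include hz

lemma frameMap_mem_perp {v : V} (hv : fstQ v = 0) : frameMap x y z v ∈ P.perp := by
  have h0 : v 0 = 0 := congrArg QuaternionAlgebra.imI hv
  have h1 : v 1 = 0 := congrArg QuaternionAlgebra.imJ hv
  have h2 : v 2 = 0 := congrArg QuaternionAlgebra.imK hv
  simp only [frameMap_apply, h0, h1, h2, zero_smul, zero_add]
  exact P.perp.sub_mem (P.perp.sub_mem (P.perp.sub_mem (P.perp.smul_mem _ hz)
    (P.perp.smul_mem _ (cross_mem_perp_right hx hz)))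
    (P.perp.smul_mem _ (cross_mem_perp_right hy hz)))
    (P.perp.smul_mem _ (cross_mem_perp_right (cross_mem hx hy) hz))

lemma adapted_frame (h : IsTriad x y z) : P.Adapted h.frame := by
  have hq (i : Fin 7) (v : V) : q (EuclideanSpace.single i 1) v =
      q (frameMap x y z (EuclideanSpace.single i 1)) (frameMap x y z v) := by
    rw [← h.lin_frame, ← h.lin_frame, q_lin]
  refine ⟨fun v => ⟨fun hv => ?_, frameMap_mem hx hy⟩,
    fun v => ⟨fun hv => ?_, frameMap_mem_perp hx hy hz⟩⟩
  · have h0 (i : Fin 7) (hi : fstQ (EuclideanSpace.single i 1) = 0) :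
        q (EuclideanSpace.single i 1) v = 0 :=
      (hq i v).trans (q_eq_zero_symm hv (frameMap_mem_perp hx hy hz hi))
    have h3 := h0 3 (by ext <;> simp)
    have h4 := h0 4 (by ext <;> simp)
    have h5 := h0 5 (by ext <;> simp)
    have h6 := h0 6 (by ext <;> simp)
    ext <;> simp_all [q_apply]
  · have h0 (i : Fin 7) (hi : sndQ (EuclideanSpace.single i 1) = 0) :
        q (EuclideanSpace.single i 1) v = 0 :=
      (hq i v).trans (q_eq_zero (frameMap_mem hx hy hi) hv)
    have h0' := h0 0 (by ext <;> simp)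
    have h1 := h0 1 (by ext <;> simp)
    have h2 := h0 2 (by ext <;> simp)
    ext <;> simp_all [q_apply]

end Frame

variable (P) in
lemma exists_adapted : ∃ g, P.Adapted g := by
  obtain ⟨x, hx, y, hy, xx, yy, xy⟩ := P.exists_orthonormal_pair
  obtain ⟨z, hz, zz⟩ := P.exists_mem_perp
  exact ⟨_, adapted_frame hx hy hz (isTriad hx hy hz xx yy xy zz)⟩

lemma q_self_neg {v : V} (hv : v ∈ P.perp) (h0 : v ≠ 0) : q v v < 0 := by
  obtain ⟨g, -, hg⟩ := P.exists_adapted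
  obtain ⟨w, rfl⟩ : ∃ w, lin g w = v := ⟨_, lin_apply_inv g v⟩
  rw [q_lin]
  exact q_self_neg_of_fstQ_eq_zero ((hg w).1 hv) fun h => h0 (by rw [h, map_zero])

lemma cross_mem_of_perp {v w : V} (hv : v ∈ P.perp) (hw : w ∈ P.perp) : cross v w ∈ P.1 := by
  obtain ⟨g, hg, hg'⟩ := P.exists_adapted
  obtain ⟨v, rfl⟩ : ∃ w, lin g w = v := ⟨_, lin_apply_inv g v⟩
  obtain ⟨w, rfl⟩ : ∃ w', lin g w' = w := ⟨_, lin_apply_inv g w⟩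
  have hv' := (hg' v).1 hv
  have hw' := (hg' w).1 hw
  have hsnd : sndQ (cross v w) =
      mulSnd (fstQ v) (sndQ v) (fstQ w) (sndQ w) := rfl
  rw [← lin_cross, hg, hsnd, mulSnd, hv', hw', star_zero, zero_mul, zero_mul, add_zero]

/-! ### The stabilizer acts simply transitively on the unit sphere of `P^⊥` -/

lemma lin_mem_perp (h : P.H) {v : V} (hv : v ∈ P.perp) : lin h.1 v ∈ P.perp := by
  intro x hx
  change q x _ = 0
  rw [← h.2 x hx, q_lin, q_eq_zero hx hv]

lemma hEmb_injective : Function.Injective P.hEmb := fun _ _ e =>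
  Subtype.ext (lin_ext fun v => DFunLike.congr_fun e v)

lemma exists_transport {z : V} (hz : z ∈ P.perp) (zz : q z z = -1) :
    ∃ T : V → V →L[ℝ] V, ContDiff ℝ ω T ∧ ∀ h : P.H, T (lin h.1 z) = P.hEmb h := by
  obtain ⟨x, hx, y, hy, xx, yy, xy⟩ := P.exists_orthonormal_pair
  have ht := isTriad hx hy hz xx yy xy zz
  refine ⟨fun b => frameMap x y b ∘L (((ht.frame⁻¹ : G2) : (V →L[ℝ] V)ˣ) : V →L[ℝ] V),
    (contDiff_frameMap x y).clm_comp contDiff_const, fun h => ?_⟩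
  ext1 v
  change frameMap x y (lin h.1 z) (lin ht.frame⁻¹ v) = lin h.1 v
  nth_rw 2 [← lin_apply_inv ht.frame v]
  rw [ht.lin_frame, lin_frameMap, h.2 x hx, h.2 y hy]

lemma H_ext {b : V} (hb : b ∈ P.perp) (bb : q b b = -1) {h k : P.H}
    (e : lin h.1 b = lin k.1 b) : h = k := by
  obtain ⟨T, -, hT⟩ := P.exists_transport hb bb
  exact hEmb_injective (by rw [← hT h, ← hT k, e])

lemma H_eq_one {b : V} (hb : b ∈ P.perp) (bb : q b b = -1) {h : P.H}
    (e : lin h.1 b = b) : h = 1 := H_ext hb bb e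

lemma exists_H_apply_eq {b b' : V} (hb : b ∈ P.perp) (hb' : b' ∈ P.perp) (bb : q b b = -1)
    (bb' : q b' b' = -1) : ∃ h : P.H, lin h.1 b = b' := by
  obtain ⟨x, hx, y, hy, xx, yy, xy⟩ := P.exists_orthonormal_pair
  have ht := isTriad hx hy hb xx yy xy bb
  have ht' := isTriad hx hy hb' xx yy xy bb'
  have hbasis (z : V) : frameMap x y z (EuclideanSpace.single 3 1) = z := by simp [frameMap_apply]
  refine ⟨⟨ht'.frame * ht.frame⁻¹, fun p hp => ?_⟩, ?_⟩
  · obtain ⟨w, rfl⟩ : ∃ w, lin ht.frame w = p := ⟨_, lin_apply_inv _ p⟩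
    have hw := ((adapted_frame hx hy hb ht).1 w).1 hp
    have h3 : w 3 = 0 := congrArg QuaternionAlgebra.re hw
    have h4 : w 4 = 0 := congrArg QuaternionAlgebra.imI hw
    have h5 : w 5 = 0 := congrArg QuaternionAlgebra.imJ hw
    have h6 : w 6 = 0 := congrArg QuaternionAlgebra.imK hw
    rw [lin_mul, LinearMap.comp_apply, lin_inv_apply, ht.lin_frame, ht'.lin_frame]
    simp only [frameMap_apply, h3, h4, h5, h6, zero_smul]
  · have hinv : lin ht.frame⁻¹ b = EuclideanSpace.single 3 1 := by
      rw [← lin_inv_apply ht.frame (EuclideanSpace.single 3 1), ht.lin_frame, hbasis]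
    change lin (ht'.frame * ht.frame⁻¹) b = b'
    rw [lin_mul, LinearMap.comp_apply, hinv, ht'.lin_frame, hbasis]

end SymSpace

/-! ### `H_P` is the group of unit quaternions -/

/-- The map `(a, b) ↦ (a, b c*)` of `Im ℍ ⊕ ℍ`, an automorphism for a unit quaternion `c`. -/
def rightMul (c : ℍ[ℝ]) (v : V) : V :=
  !₂[v 0, v 1, v 2, (sndQ v * star c).re, (sndQ v * star c).imI, (sndQ v * star c).imJ,
    (sndQ v * star c).imK]

lemma fstQ_rightMul (c : ℍ[ℝ]) (v : V) : fstQ (rightMul c v) = fstQ v := by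
  ext <;> simp [rightMul]

lemma sndQ_rightMul (c : ℍ[ℝ]) (v : V) : sndQ (rightMul c v) = sndQ v * star c := by
  ext <;> simp [rightMul, sndQ]

lemma rightMul_rightMul (c d : ℍ[ℝ]) (v : V) :
    rightMul c (rightMul d v) = rightMul (c * d) v :=
  fstQ_sndQ_ext (by simp only [fstQ_rightMul])
    (by simp only [sndQ_rightMul, star_mul, mul_assoc])

lemma rightMul_one (v : V) : rightMul 1 v = v :=
  fstQ_sndQ_ext (by simp only [fstQ_rightMul]) (by simp only [sndQ_rightMul, star_one, mul_one])

lemma rightMul_cross {c : ℍ[ℝ]} (hc : star c * c = 1) (v w : V) :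
    rightMul c (cross v w) = cross (rightMul c v) (rightMul c w) := by
  have h1 : sndQ w * star c * star (sndQ v * star c) = sndQ w * star (sndQ v) := by
    rw [star_mul, star_star, mul_assoc, ← mul_assoc (star c), hc, one_mul]
  have h2 : star (fstQ v) * (sndQ w * star c) + fstQ w * (sndQ v * star c) =
      (star (fstQ v) * sndQ w + fstQ w * sndQ v) * star c := by
    rw [add_mul, mul_assoc, mul_assoc]
  apply fstQ_sndQ_ext
  · rw [fstQ_rightMul]
    ext <;> simp only [cross_apply, crossFun, mulFst, fstQ_rightMul, sndQ_rightMul, h1] <;> simp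
  · rw [sndQ_rightMul]
    have h3 : ∀ v w, sndQ (cross v w) = star (fstQ v) * sndQ w + fstQ w * sndQ v := fun v w => by
      ext <;> simp [cross_apply, crossFun, mulSnd]
    rw [h3, h3, fstQ_rightMul, fstQ_rightMul, sndQ_rightMul, sndQ_rightMul, h2]

/-- The part of `rightMul` that is linear in the quaternion. -/
def rightMulL : ℍ[ℝ] →ₗ[ℝ] V →ₗ[ℝ] V :=
  LinearMap.mk₂ ℝ (fun c v => rightMul c v - rightMul 0 v)
    (fun c d v => by ext i; fin_cases i <;> simp [rightMul] <;> ring)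
    (fun r c v => by ext i; fin_cases i <;> simp [rightMul])
    (fun c v w => by ext i; fin_cases i <;> simp [rightMul] <;> ring)
    (fun r c v => by ext i; fin_cases i <;> simp [rightMul] <;> ring)

/-- The projection to the first component, as `rightMul 0`. -/
def rightMulZeroL : V →ₗ[ℝ] V where
  toFun := rightMul 0
  map_add' v w := by ext i; fin_cases i <;> simp [rightMul]
  map_smul' c w := by ext i; fin_cases i <;> simp [rightMul]

/-- `rightMul c` as a continuous linear map. -/
def rightMulCLM (c : ℍ[ℝ]) : V →L[ℝ] V :=
  rightMulL.toContinuousBilinearMap c + LinearMap.toContinuousLinearMap rightMulZeroL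

lemma rightMulCLM_apply (c : ℍ[ℝ]) (v : V) : rightMulCLM c v = rightMul c v :=
  sub_add_cancel _ _

lemma contDiff_rightMulCLM : ContDiff ℝ ∞ rightMulCLM :=
  rightMulL.toContinuousBilinearMap.contDiff.add contDiff_const

/-- The embedding of the unit quaternions in `G₂'` given by `rightMul`. -/
def rightMulG2 : unitary ℍ[ℝ] →* G2 where
  toFun c := ⟨⟨rightMulCLM c, rightMulCLM ↑(c⁻¹),
    by ext1 v
       change rightMulCLM c (rightMulCLM ↑(c⁻¹) v) = v
       rw [rightMulCLM_apply, rightMulCLM_apply, rightMul_rightMul, ← Submonoid.coe_mul,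
         mul_inv_cancel, Submonoid.coe_one, rightMul_one],
    by ext1 v
       change rightMulCLM ↑(c⁻¹) (rightMulCLM c v) = v
       rw [rightMulCLM_apply, rightMulCLM_apply, rightMul_rightMul, ← Submonoid.coe_mul,
         inv_mul_cancel, Submonoid.coe_one, rightMul_one]⟩,
    fun v w => by
      change rightMulCLM c _ = cross (rightMulCLM c v) (rightMulCLM c w)
      simp only [rightMulCLM_apply]
      exact rightMul_cross (Unitary.star_mul_self_of_mem c.2) v w⟩
  map_one' := lin_ext fun v => (rightMulCLM_apply 1 v).trans (rightMul_one v)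
  map_mul' c d := lin_ext fun v => by
    change rightMulCLM ↑(c * d) v = rightMulCLM c (rightMulCLM d v)
    simp only [rightMulCLM_apply]
    exact (rightMul_rightMul _ _ _).symm

lemma lin_rightMulG2 (c : unitary ℍ[ℝ]) (v : V) : lin (rightMulG2 c) v = rightMul c v :=
  rightMulCLM_apply c v

/-- The linear map `(a, b) ↦ b*`, which recovers `c` from `rightMul c (0, 1)`. -/
def starSndQL : V →ₗ[ℝ] ℍ[ℝ] where
  toFun v := star (sndQ v)
  map_add' v w := by ext <;> simp <;> ring
  map_smul' c w := by ext <;> simp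

lemma sndQ_single_three : sndQ (EuclideanSpace.single 3 1) = 1 := by ext <;> simp

lemma fstQ_single_three : fstQ (EuclideanSpace.single 3 1) = 0 := by ext <;> simp

namespace SymSpace

variable {P : SymSpace}

namespace Adapted

variable {g : G2} (hg : P.Adapted g)
include hg

lemma apply_single_three_mem : lin g (EuclideanSpace.single 3 1) ∈ P.perp :=
  (hg.2 _).2 fstQ_single_three

omit hg in
lemma q_apply_single_three :
    q (lin g (EuclideanSpace.single 3 1)) (lin g (EuclideanSpace.single 3 1)) = -1 := by
  rw [q_lin, q_apply]
  simp

/-- The unit quaternions act on `P^⊥` by right multiplication in the coordinates given by `g`. -/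
def unitaryHom : unitary ℍ[ℝ] →* P.H where
  toFun c := ⟨g * rightMulG2 c * g⁻¹, fun x hx => by
    obtain ⟨w, rfl⟩ : ∃ w, lin g w = x := ⟨_, lin_apply_inv g x⟩
    have hw : rightMul c w = w := fstQ_sndQ_ext (fstQ_rightMul _ _) <| by
      rw [sndQ_rightMul, (hg.1 w).1 hx, zero_mul]
    rw [lin_mul, lin_mul, LinearMap.comp_apply, LinearMap.comp_apply, lin_inv_apply,
      lin_rightMulG2, hw]⟩
  map_one' := Subtype.ext (by simp)
  map_mul' c d := Subtype.ext (by simp [mul_assoc])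

lemma lin_unitaryHom (c : unitary ℍ[ℝ]) (v : V) :
    lin (hg.unitaryHom c).1 v = lin g (rightMul c (lin g⁻¹ v)) :=
  congrArg (lin g) (lin_rightMulG2 c _)

lemma starSndQL_unitaryHom (c : unitary ℍ[ℝ]) :
    starSndQL (lin g⁻¹ (lin (hg.unitaryHom c).1 (lin g (EuclideanSpace.single 3 1)))) = c := by
  rw [lin_unitaryHom, lin_inv_apply, lin_inv_apply]
  change star (sndQ _) = (c : ℍ[ℝ])
  rw [sndQ_rightMul, sndQ_single_three, one_mul, star_star]

lemma unitaryHom_bijective : Function.Bijective hg.unitaryHom := by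
  refine ⟨fun c d h => Subtype.ext ?_, fun h => ?_⟩
  · rw [← hg.starSndQL_unitaryHom c, h, hg.starSndQL_unitaryHom]
  obtain ⟨w, hw⟩ : ∃ w, lin g w = lin h.1 (lin g (EuclideanSpace.single 3 1)) :=
    ⟨_, lin_apply_inv _ _⟩
  have hfst : fstQ w = 0 := (hg.2 w).1 (hw ▸ lin_mem_perp h hg.apply_single_three_mem)
  have hunit : ‖sndQ w‖ = 1 := by
    have hq : q w w = -1 := by rw [← q_lin g, hw, q_lin, q_apply_single_three]
    rw [q_self_eq_normSq_sub_normSq, hfst, map_zero, zero_sub, neg_inj,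
      Quaternion.normSq_eq_norm_mul_self] at hq
    exact (mul_self_eq_one_iff.1 hq).resolve_right fun h => by linarith [norm_nonneg (sndQ w)]
  have hu : star (sndQ w) ∈ unitary ℍ[ℝ] := by rw [mem_unitary_quaternion_iff, norm_star, hunit]
  refine ⟨⟨star (sndQ w), hu⟩, H_ext hg.apply_single_three_mem q_apply_single_three ?_⟩
  rw [hg.lin_unitaryHom, lin_inv_apply, ← hw]
  refine congrArg (lin g) (fstQ_sndQ_ext ?_ ?_)
  · rw [fstQ_rightMul, fstQ_single_three, hfst]
  · rw [sndQ_rightMul, sndQ_single_three, one_mul, star_star]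

end Adapted

theorem exists_unitary_mulEquiv (P : SymSpace) :
    ∃ φ : unitary ℍ[ℝ] ≃* P.H, IsDiffeo (fun a : unitary ℍ[ℝ] => a.1) P.hEmb φ.toEquiv := by
  obtain ⟨g, hg⟩ := P.exists_adapted
  let φ := MulEquiv.ofBijective hg.unitaryHom hg.unitaryHom_bijective
  let A : V →L[ℝ] V := (g : (V →L[ℝ] V)ˣ)
  let A' : V →L[ℝ] V := ((g⁻¹ : G2) : (V →L[ℝ] V)ˣ)
  refine ⟨φ, ?_, ?_⟩
  · exact smoothMap_of_contDiff (F := fun c => A ∘L rightMulCLM c ∘L A')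
      (contDiff_const.clm_comp (contDiff_rightMulCLM.clm_comp contDiff_const)) fun c => rfl
  · refine smoothMap_of_contDiff (F := fun t => starSndQL.toContinuousLinearMap
      (A' (t (lin g (EuclideanSpace.single 3 1))))) (by fun_prop) fun h => ?_
    obtain ⟨c, rfl⟩ := φ.surjective h
    exact (hg.starSndQL_unitaryHom c).trans (congrArg Subtype.val (φ.symm_apply_apply c).symm)

end SymSpace

/-! ### Annihilator subspaces -/

/-- Isotropic subspaces with vanishing cross product: the isotropic lines, the annihilator photons
and the zero subspace. -/
structure IsAnnihilator (W : Submodule ℝ V) : Prop where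
  q_eq_zero : ∀ x ∈ W, ∀ y ∈ W, q x y = 0
  cross_eq_zero : ∀ x ∈ W, ∀ y ∈ W, cross x y = 0

lemma Iso.isAnnihilator (ℓ : Ein) : IsAnnihilator ℓ.1 := by
  refine ⟨ℓ.2.2, fun x hx y hy => ?_⟩
  obtain ⟨v, -, hv⟩ := finrank_eq_one_iff'.1 ℓ.2.1
  obtain ⟨c, hc⟩ := hv ⟨x, hx⟩
  obtain ⟨d, hd⟩ := hv ⟨y, hy⟩
  have hc' : c • (v : V) = x := congrArg Subtype.val hc
  have hd' : d • (v : V) = y := congrArg Subtype.val hd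
  rw [← hc', ← hd', map_smul, map_smul, LinearMap.smul_apply, cross_self, smul_zero, smul_zero]

lemma Pho.isAnnihilator (W : Pho) : IsAnnihilator W.plane := ⟨W.1.2.2, W.2⟩

lemma IsAnnihilator.disjoint_perp {P : SymSpace} {W : Submodule ℝ V} (hW : IsAnnihilator W) :
    Disjoint W P.perp := by
  refine Submodule.disjoint_def.2 fun w hw hw' => ?_
  by_contra h0
  exact (SymSpace.q_self_neg hw' h0).ne (hW.q_eq_zero w hw w hw)

namespace SymSpace

variable {P : SymSpace} {W U : Submodule ℝ V} {a b c x y z : V}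

lemma proj_eq_zero_iff {v : V} : P.proj v = 0 ↔ v ∈ P.perp :=
  Submodule.projection_apply_eq_zero_iff _

lemma proj_injOn (hW : Disjoint W P.perp) : Set.InjOn P.proj W := by
  refine LinearMap.disjoint_ker_iff_injOn.1 ?_
  rwa [proj, Submodule.ker_projection]

/-- The restriction of the orthogonal projection to a subspace transverse to `P^⊥`. -/
def projEquiv (hW : Disjoint W P.perp) : W ≃ₗ[ℝ] W.map P.proj :=
  .ofBijective (P.proj.submoduleMap W)
    ⟨LinearMap.submoduleMap_injective_of_injOn (proj_injOn hW), P.proj.submoduleMap_surjective W⟩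

lemma proj_projEquiv_symm (hW : Disjoint W P.perp) (u : W.map P.proj) :
    P.proj ((projEquiv hW).symm u) = u :=
  congrArg Subtype.val ((projEquiv hW).apply_symm_apply u)

lemma finrank_map_proj (hW : Disjoint W P.perp) :
    Module.finrank ℝ (W.map P.proj) = Module.finrank ℝ W :=
  (projEquiv hW).finrank_eq.symm

lemma map_proj_le : W.map P.proj ≤ P.1 := by
  rintro _ ⟨v, -, rfl⟩
  exact proj_mem v

lemma le_map_proj_sup_perp : W ≤ W.map P.proj ⊔ P.perp := fun w hw => by
  rw [← add_sub_cancel (P.proj w) w]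
  exact Submodule.add_mem_sup (Submodule.mem_map_of_mem hw) (sub_proj_mem w)

lemma map_proj_le_iff (hU : U ≤ P.1) : W.map P.proj ≤ U ↔ W ≤ U ⊔ P.perp := by
  refine ⟨fun h => le_map_proj_sup_perp.trans (sup_le_sup_right h _), ?_⟩
  rintro h _ ⟨w, hw, rfl⟩
  obtain ⟨u, hu, v, hv, rfl⟩ := Submodule.mem_sup.1 (h hw)
  rwa [proj_add (hU hu) hv]

lemma map_proj_eq_iff (hW : Disjoint W P.perp) (hU : U ≤ P.1)
    (hd : Module.finrank ℝ W = Module.finrank ℝ U) : W.map P.proj = U ↔ W ≤ U ⊔ P.perp := by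
  rw [← map_proj_le_iff hU]
  exact ⟨le_of_eq, fun h => Submodule.eq_of_le_of_finrank_eq h ((finrank_map_proj hW).trans hd)⟩

lemma IsGraphOver.map_proj_eq (h : P.IsGraphOver U W) (hU : U ≤ P.1) : W.map P.proj = U := by
  obtain ⟨φ, hφ, rfl⟩ := h
  have hp (u : U) : P.proj ((U.subtype + φ) u) = u := proj_add (hU u.2) (hφ u)
  apply le_antisymm
  · rintro _ ⟨_, ⟨u, rfl⟩, rfl⟩
    rw [hp]
    exact u.2
  · exact fun u hu => ⟨_, ⟨⟨u, hu⟩, rfl⟩, hp _⟩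

lemma isGraphOver_map_proj (hW : Disjoint W P.perp) : P.IsGraphOver (W.map P.proj) W := by
  refine ⟨W.subtype ∘ₗ (projEquiv hW).symm.toLinearMap - (W.map P.proj).subtype, fun u => ?_, ?_⟩
  · have hu : P.proj (u : V) = u := Submodule.projection_apply_of_mem_left _ (map_proj_le u.2)
    rw [← proj_eq_zero_iff, LinearMap.sub_apply, map_sub]
    exact sub_eq_zero.2 ((proj_projEquiv_symm hW u).trans hu.symm)
  · rw [add_sub_cancel, LinearMap.range_comp, LinearEquiv.range, Submodule.map_top,
      Submodule.range_subtype]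

lemma isGraphOver_iff (hW : Disjoint W P.perp) (hU : U ≤ P.1) :
    P.IsGraphOver U W ↔ W.map P.proj = U :=
  ⟨fun h => h.map_proj_eq hU, fun h => h ▸ isGraphOver_map_proj hW⟩

lemma proj_lin (h : P.H) (v : V) : P.proj (lin h.1 v) = P.proj v := by
  have hv : lin h.1 v = P.proj v + lin h.1 (v - P.proj v) := by
    rw [map_sub, h.2 _ (proj_mem v), add_sub_cancel]
  rw [hv, proj_add (proj_mem v) (lin_mem_perp h (sub_proj_mem v))]

lemma map_proj_map_lin (h : P.H) (W : Submodule ℝ V) :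
    (W.map (lin h.1)).map P.proj = W.map P.proj := by
  rw [← Submodule.map_comp]
  congr 1
  ext1 v
  exact proj_lin h v

lemma exists_add_mem (hW : IsAnnihilator W) (ha : a ∈ W.map P.proj) (haa : q a a = 1) :
    ∃ b ∈ P.perp, q b b = -1 ∧ a + b ∈ W := by
  obtain ⟨w, hw, rfl⟩ := ha
  have hb := sub_proj_mem (P := P) w
  have hsum : P.proj w + (w - P.proj w) = w := add_sub_cancel _ _
  refine ⟨w - P.proj w, hb, ?_, by rwa [hsum]⟩
  have hq := hW.q_eq_zero w hw w hw
  rw [← hsum] at hq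
  simp only [map_add, LinearMap.add_apply, haa, q_eq_zero (proj_mem w) hb,
    q_eq_zero_symm (proj_mem w) hb] at hq
  linarith

lemma H_eq_one_of_map_eq (hW : IsAnnihilator W) (hne : W ≠ ⊥) {h : P.H}
    (hh : W.map (lin h.1) = W) : h = 1 := by
  obtain ⟨a, ha, haa⟩ := exists_unit (P := P) (U := W.map P.proj) map_proj_le <| by
    rw [finrank_map_proj hW.disjoint_perp]
    exact Nat.pos_of_ne_zero fun h0 => hne (Submodule.finrank_eq_zero.1 h0)
  obtain ⟨b, hb, hbb, hab⟩ := exists_add_mem hW ha haa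
  have hfix : lin h.1 (a + b) = a + b :=
    proj_injOn (P := P) hW.disjoint_perp (hh ▸ Submodule.mem_map_of_mem hab) hab (proj_lin h _)
  rw [map_add, h.2 a (map_proj_le ha)] at hfix
  exact H_eq_one hb hbb (add_left_cancel hfix)

end SymSpace

/-! ### Annihilator subspaces as graphs -/

lemma map_eq_map_of_eqOn {f g : V →ₗ[ℝ] V} {W : Submodule ℝ V} (h : Set.EqOn f g W) :
    W.map f = W.map g :=
  SetLike.coe_injective (Set.image_congr h)

/-- The cross product as a continuous bilinear map. -/
def crossL : V →L[ℝ] V →L[ℝ] V := cross.toContinuousBilinearMap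

/-- The map whose graph over a line or plane `U ⊆ P` containing the unit vector `a` is the
annihilator subspace over `U` that contains `a + b`. -/
def graphMap (a b : V) : V →L[ℝ] V := .id ℝ V - crossL a ∘L crossL.flip b

lemma graphMap_apply (a b x : V) : graphMap a b x = x - cross a (cross x b) := rfl

lemma contDiff_graphMap {n : WithTop ℕ∞} (b : V) : ContDiff ℝ n fun a => graphMap a b :=
  contDiff_const.sub (crossL.contDiff.clm_comp contDiff_const)

/-- The image of `U` under `graphMap a b`. -/
def annihilatorOver (a b : V) (U : Submodule ℝ V) : Submodule ℝ V :=
  U.map (graphMap a b).toLinearMap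

lemma annihilatorOver_mono {a b : V} {U U' : Submodule ℝ V} (h : U ≤ U') :
    annihilatorOver a b U ≤ annihilatorOver a b U' :=
  Submodule.map_mono h

namespace SymSpace

variable {P : SymSpace} {W U : Submodule ℝ V} {a b b' c x y z : V}

lemma proj_graphMap (ha : a ∈ P.1) (hb : b ∈ P.perp) (hx : x ∈ P.1) :
    P.proj (graphMap a b x) = x := by
  rw [graphMap_apply, sub_eq_add_neg]
  exact proj_add hx (P.perp.neg_mem (cross_mem_perp_right ha (cross_mem_perp_right hx hb)))

lemma graphMap_self (ha : a ∈ P.1) (hb : b ∈ P.perp) (haa : q a a = 1) :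
    graphMap a b a = a + b := by
  rw [graphMap_apply, cross_cross, haa, q_eq_zero ha hb]
  module

lemma q_graphMap_graphMap (ha : a ∈ P.1) (hb : b ∈ P.perp) (hb' : b' ∈ P.perp) (haa : q a a = 1)
    (hx : x ∈ P.1) (hy : y ∈ P.1) :
    q (graphMap a b x) (graphMap a b' y) = q x y + q (cross x b) (cross y b') := by
  have hxb := cross_mem_perp_right hx hb
  have hyb := cross_mem_perp_right hy hb'
  simp only [graphMap_apply, map_sub, LinearMap.sub_apply]
  rw [q_cross_cross_left, haa, q_eq_zero ha hxb, q_eq_zero hx (cross_mem_perp_right ha hyb),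
    q_eq_zero_symm hy (cross_mem_perp_right ha hxb)]
  ring

lemma q_graphMap (ha : a ∈ P.1) (hb : b ∈ P.perp) (haa : q a a = 1) (hbb : q b b = -1)
    (hx : x ∈ P.1) (hy : y ∈ P.1) : q (graphMap a b x) (graphMap a b y) = 0 := by
  rw [q_graphMap_graphMap ha hb hb haa hx hy, cross_anticomm x b, cross_anticomm y b]
  simp only [map_neg, LinearMap.neg_apply, neg_neg]
  rw [q_cross_cross_left, hbb, q_eq_zero_symm hx hb]
  ring

lemma cross_graphMap (ha : a ∈ P.1) (hb : b ∈ P.perp) (haa : q a a = 1) (hbb : q b b = -1)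
    (hc : c ∈ P.1) : cross (a + b) (graphMap a b c) = 0 := by
  have hcb := cross_mem_perp_right hc hb
  have hbc : cross c b = -cross b c := cross_anticomm c b
  have hperp : cross a (cross a (cross c b)) = -cross c b := by
    rw [cross_cross, haa, q_eq_zero ha hcb]
    module
  have hP : cross b (cross a (cross c b)) = cross a c := by
    rw [cross_left_comm_of_orthogonal (q_eq_zero_symm ha hb) (by rw [q_comm, q_cross_right])
      (q_eq_zero ha hcb), hbc, map_neg, cross_cross, hbb, q_eq_zero_symm hc hb]
    simp
  rw [graphMap_apply]
  simp only [map_add, map_sub, LinearMap.add_apply, hperp, hP]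
  rw [hbc]
  abel

lemma isAnnihilator_annihilatorOver_of_le_span (hU : U ≤ P.1) (ha : a ∈ P.1) (hb : b ∈ P.perp)
    (haa : q a a = 1) (hbb : q b b = -1) (hc : c ∈ P.1) (hUac : U ≤ Submodule.span ℝ {a, c}) :
    IsAnnihilator (annihilatorOver a b U) := by
  constructor
  · rintro _ ⟨x, hx, rfl⟩ _ ⟨y, hy, rfl⟩
    exact q_graphMap ha hb haa hbb (hU hx) (hU hy)
  · rintro _ ⟨x, hx, rfl⟩ _ ⟨y, hy, rfl⟩
    obtain ⟨s, t, rfl⟩ := Submodule.mem_span_pair.1 (hUac hx)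
    obtain ⟨s', t', rfl⟩ := Submodule.mem_span_pair.1 (hUac hy)
    have h := cross_graphMap ha hb haa hbb hc
    have h' : cross (graphMap a b c) (a + b) = 0 := by rw [cross_anticomm, h, neg_zero]
    simp only [ContinuousLinearMap.coe_coe, map_add (graphMap a b), map_smul,
      graphMap_self ha hb haa]
    rw [map_add cross, LinearMap.add_apply, map_add, map_add]
    simp only [map_smul, LinearMap.smul_apply, h, h', cross_self, smul_zero, add_zero]

lemma finrank_annihilatorOver (hU : U ≤ P.1) (ha : a ∈ P.1) (hb : b ∈ P.perp) :
    Module.finrank ℝ (annihilatorOver a b U) = Module.finrank ℝ U := by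
  have hinj : Set.InjOn (graphMap a b).toLinearMap U := fun v hv w hw h => by
    rw [← proj_graphMap ha hb (hU hv), ← proj_graphMap ha hb (hU hw)]
    exact congrArg P.proj h
  exact (LinearEquiv.ofBijective _ ⟨LinearMap.submoduleMap_injective_of_injOn hinj,
    LinearMap.submoduleMap_surjective _ U⟩).finrank_eq.symm

lemma map_proj_annihilatorOver (hU : U ≤ P.1) (ha : a ∈ P.1) (hb : b ∈ P.perp) :
    (annihilatorOver a b U).map P.proj = U := by
  rw [annihilatorOver, ← Submodule.map_comp]
  exact (map_eq_map_of_eqOn fun u hu => proj_graphMap ha hb (hU hu)).trans (Submodule.map_id U)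

lemma map_lin_annihilatorOver (h : P.H) (hU : U ≤ P.1) (ha : a ∈ P.1) :
    (annihilatorOver a b U).map (lin h.1) = annihilatorOver a (lin h.1 b) U := by
  rw [annihilatorOver, ← Submodule.map_comp]
  refine map_eq_map_of_eqOn fun x hx => ?_
  change lin h.1 (graphMap a b x) = graphMap a (lin h.1 b) x
  simp only [graphMap_apply, map_sub, lin_cross, h.2 x (hU hx), h.2 a ha]

lemma cross_eq_cross_of_cross_add_add_eq_zero (ha : a ∈ P.1) (hb : b ∈ P.perp) (hx : x ∈ P.1)
    (hy : y ∈ P.perp) (h : cross (a + b) (x + y) = 0) : cross a y = cross x b := by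
  have hsplit : cross a x + cross b y + (cross a y + cross b x) = 0 + 0 := by
    simp only [map_add, LinearMap.add_apply] at h
    rw [add_zero, ← h]
    abel
  have hperp := (add_eq_add (P.1.add_mem (cross_mem ha hx) (cross_mem_of_perp hb hy)) P.1.zero_mem
    (P.perp.add_mem (cross_mem_perp_right ha hy) (cross_mem_perp_left hx hb)) P.perp.zero_mem
    hsplit).2
  rw [cross_anticomm x b]
  exact eq_neg_of_add_eq_zero_left hperp

lemma graphMap_proj (hW : IsAnnihilator W) (ha : a ∈ P.1) (hb : b ∈ P.perp) (haa : q a a = 1)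
    (hab : a + b ∈ W) {w : V} (hw : w ∈ W) : graphMap a b (P.proj w) = w := by
  have hsum : P.proj w + (w - P.proj w) = w := add_sub_cancel _ _
  have hcross := cross_eq_cross_of_cross_add_add_eq_zero ha hb (proj_mem w) (sub_proj_mem w)
    (by rw [hsum]; exact hW.cross_eq_zero _ hab _ hw)
  rw [graphMap_apply, ← hcross, cross_cross, haa, q_eq_zero ha (sub_proj_mem w)]
  module

lemma annihilatorOver_map_proj (hW : IsAnnihilator W) (ha : a ∈ P.1) (hb : b ∈ P.perp)
    (haa : q a a = 1) (hab : a + b ∈ W) : annihilatorOver a b (W.map P.proj) = W := by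
  rw [annihilatorOver, ← Submodule.map_comp]
  exact (map_eq_map_of_eqOn fun w hw => graphMap_proj hW ha hb haa hab hw).trans
    (Submodule.map_id W)

lemma exists_map_lin_annihilatorOver_eq (hz : z ∈ P.perp) (hzz : q z z = -1)
    (hW : IsAnnihilator W) (ha : a ∈ W.map P.proj) (haa : q a a = 1) :
    ∃ h : P.H, ∀ W', IsAnnihilator W' → W ≤ W' →
      (annihilatorOver a z (W'.map P.proj)).map (lin h.1) = W' := by
  obtain ⟨b, hb, hbb, hab⟩ := exists_add_mem hW ha haa
  obtain ⟨h, rfl⟩ := exists_H_apply_eq hz hb hzz hbb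
  have ha' : a ∈ P.1 := map_proj_le ha
  refine ⟨h, fun W' hW' hle => ?_⟩
  rw [map_lin_annihilatorOver h map_proj_le ha',
    annihilatorOver_map_proj hW' ha' hb haa (hle hab)]

/-- Any vector of an annihilator subspace determines the `P^⊥`-component of any other. -/
lemma eq_inv_smul_of_add_mem (hW : IsAnnihilator W) (ha : a ∈ P.1) (hb : b ∈ P.perp)
    (hab : a + b ∈ W) {w : V} (hw : w ∈ W) (hq : q (P.proj w) (P.proj w) ≠ 0) :
    b = (q (P.proj w) (P.proj w))⁻¹ •
      -crossL (P.proj w) (crossL a (w - P.proj w)) := by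
  have hsum : P.proj w + (w - P.proj w) = w := add_sub_cancel _ _
  have hcross := cross_eq_cross_of_cross_add_add_eq_zero ha hb (proj_mem w) (sub_proj_mem w)
    (by rw [hsum]; exact hW.cross_eq_zero _ hab _ hw)
  change b = _ • -cross _ (cross _ _)
  rw [hcross, cross_cross, q_eq_zero (proj_mem w) hb, zero_smul, add_zero, neg_smul, neg_neg,
    smul_smul, inv_mul_cancel₀ hq, one_smul]

open Filter Topology in
lemma exists_analytic_division {X E : Type*} [NormedAddCommGroup E] [NormedSpace ℝ E] {eX : X → E}
    {x₀ : X} {W : X → Submodule ℝ V} (hWan : AnalyticNear eX (fun x => grEmb (W x)) x₀)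
    (hW : ∀ x, IsAnnihilator (W x)) (hne : W x₀ ≠ ⊥) {a : X → V} (ha : AnalyticNear eX a x₀)
    (haW : ∀ᶠ x in comap eX (𝓝 (eX x₀)), a x ∈ (W x).map P.proj ∧ q (a x) (a x) = 1)
    (hz : z ∈ P.perp) (hzz : q z z = -1) :
    ∃ D : X → V →L[ℝ] V, AnalyticNear eX D x₀ ∧ ∀ᶠ x in comap eX (𝓝 (eX x₀)), ∀ h : P.H,
      (annihilatorOver (a x) z ((W x).map P.proj)).map (lin h.1) = W x → D x = P.hEmb h := by
  obtain ⟨T, hT, hTe⟩ := exists_transport hz hzz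
  obtain ⟨w₀, hw₀, hw₀0⟩ := Submodule.exists_mem_ne_zero_of_ne_bot hne
  let w : X → V := fun x => grEmb (W x) w₀
  have hw : AnalyticNear eX w x₀ := hWan.clm_apply (.const w₀)
  have hp : AnalyticNear eX (fun x => P.proj (w x)) x₀ := hw.linearMap _
  have hq : AnalyticNear eX (fun x => q (P.proj (w x)) (P.proj (w x))) x₀ :=
    (hp.clm q.toContinuousBilinearMap).clm_apply hp
  have hq0 : q (P.proj (w x₀)) (P.proj (w x₀)) ≠ 0 := by
    refine (P.2.2.1 _ (proj_mem _) fun h => hw₀0 ?_).ne'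
    have hx₀ : w x₀ = w₀ := grEmb_apply_eq hw₀
    rw [hx₀, proj_eq_zero_iff] at h
    exact Submodule.disjoint_def.1 (hW x₀).disjoint_perp w₀ hw₀ h
  have hcross : AnalyticNear eX
      (fun x => -crossL (P.proj (w x)) (crossL (a x) (w x - P.proj (w x)))) x₀ :=
    ((hp.clm crossL).clm_apply ((ha.clm crossL).clm_apply (hw.sub hp))).clm
      (-ContinuousLinearMap.id ℝ V)
  refine ⟨_, ((hq.comp (contDiffAt_inv ℝ hq0)).smul hcross).comp hT.contDiffAt, ?_⟩
  filter_upwards [haW, hq.tendsto.eventually_ne hq0] with x hx hqx h hh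
  have haP : a x ∈ P.1 := map_proj_le hx.1
  have hmem : a x + lin h.1 z ∈ W x := by
    rw [← hh, map_lin_annihilatorOver h map_proj_le haP,
      ← graphMap_self haP (lin_mem_perp h hz) hx.2]
    exact Submodule.mem_map_of_mem hx.1
  rw [← hTe h, eq_inv_smul_of_add_mem (hW x) haP (lin_mem_perp h hz) hmem
    (grEmb_apply_mem _ w₀) hqx]

end SymSpace

/-! ### The three bundles -/

lemma exists_le_span_pair {K E : Type*} [Field K] [AddCommGroup E] [Module K E]
    {U : Submodule K E} [FiniteDimensional K U] (hd : Module.finrank K U ≤ 2) {a : E} (ha : a ∈ U)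
    (ha0 : a ≠ 0) : ∃ c ∈ U, U ≤ Submodule.span K {a, c} := by
  by_cases hle : U ≤ Submodule.span K {a}
  · exact ⟨0, U.zero_mem, hle.trans (Submodule.span_mono (by simp))⟩
  obtain ⟨c, hc, hca⟩ := SetLike.not_le_iff_exists.1 hle
  have hli : LinearIndependent K ![a, c] :=
    (LinearIndependent.pair_iff' ha0).2 fun t ht => hca (Submodule.mem_span_singleton.2 ⟨t, ht⟩)
  have hspan : Submodule.span K {a, c} ≤ U := Submodule.span_le.2 (Set.pair_subset ha hc)
  refine ⟨c, hc, (Submodule.eq_of_le_of_finrank_le hspan (hd.trans_eq ?_)).ge⟩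
  rw [← Matrix.range_cons_cons_empty a c ![], finrank_span_eq_card hli, Fintype.card_fin]

/-- The vector `p u` rescaled to length one. -/
def unitVec (u : V) (p : V →L[ℝ] V) : V := (√(q (p u) (p u)))⁻¹ • p u

lemma contDiffAt_unitVec {u : V} {p : V →L[ℝ] V} (h : 0 < q (p u) (p u)) :
    ContDiffAt ℝ ω (unitVec u) p := by
  have happly : ContDiff ℝ ω fun p : V →L[ℝ] V => p u := contDiff_id.clm_apply contDiff_const
  have hq : ContDiff ℝ ω fun p : V →L[ℝ] V => q (p u) (p u) :=
    (q.toContinuousBilinearMap.contDiff.comp happly).clm_apply happly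
  have hsqrt : ContDiffAt ℝ ω (fun p : V →L[ℝ] V => √(q (p u) (p u))) p :=
    (Real.contDiffAt_sqrt h.ne').comp p hq.contDiffAt
  exact (hsqrt.inv (Real.sqrt_ne_zero'.2 h)).smul happly.contDiffAt

lemma q_unitVec {u : V} {p : V →L[ℝ] V} (h : 0 < q (p u) (p u)) :
    q (unitVec u p) (unitVec u p) = 1 := by
  simp only [unitVec, map_smul, LinearMap.smul_apply, smul_eq_mul]
  rw [← mul_assoc, ← mul_inv, Real.mul_self_sqrt h.le, inv_mul_cancel₀ h.ne']

lemma Iso.ne_bot (ℓ : Ein) : ℓ.1 ≠ ⊥ := Submodule.one_le_finrank_iff.1 ℓ.2.1.ge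

lemma Pho.finrank_plane (W : Pho) : Module.finrank ℝ W.plane = 2 := W.1.2.1

lemma Pho.ne_bot (W : Pho) : W.plane ≠ ⊥ :=
  Submodule.one_le_finrank_iff.1 (by rw [W.finrank_plane]; exact one_le_two)

lemma Pho.ext {W W' : Pho} (h : W.plane = W'.plane) : W = W' := Subtype.ext (Subtype.ext h)

lemma F12.ext {p p' : F12} (hline : p.line = p'.line) (hplane : p.plane = p'.plane) : p = p' :=
  Subtype.ext (Prod.ext (Subtype.ext hline) (Pho.ext hplane))

namespace SymSpace

variable {P : SymSpace} {U : Submodule ℝ V} {k : ℕ} {a b u z : V}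

lemma isAnnihilator_annihilatorOver (hU : U ≤ P.1) (hd : Module.finrank ℝ U ≤ 2) (ha : a ∈ U)
    (hb : b ∈ P.perp) (haa : q a a = 1) (hbb : q b b = -1) :
    IsAnnihilator (annihilatorOver a b U) := by
  obtain ⟨c, hc, hUac⟩ := exists_le_span_pair hd ha fun h => by simp [h] at haa
  exact isAnnihilator_annihilatorOver_of_le_span hU (hU ha) hb haa hbb (hU hc) hUac

lemma unitVec_mem (U : P.Gr k) (u : V) : unitVec u U.emb ∈ U.1 :=
  U.1.smul_mem _ (grEmb_apply_mem _ _)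

variable (P k) in
/-- The open set of subspaces of `P` to which `u` is not orthogonal for the Euclidean inner
product. -/
def grChart (u : V) : Set (P.Gr k) := {U | U.emb u ≠ 0}

lemma q_unitVec_of_mem_grChart {U : P.Gr k} (hU : U ∈ P.grChart k u) :
    q (unitVec u U.emb) (unitVec u U.emb) = 1 :=
  q_unitVec (P.2.2.1 _ (U.2.1 (grEmb_apply_mem _ _)) hU)

lemma exists_mem_grChart (hk : k ≠ 0) (U : P.Gr k) : ∃ u, U ∈ P.grChart k u := by
  have hne : U.1 ≠ ⊥ := fun h => hk (by rw [← U.2.2, h, finrank_bot])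
  obtain ⟨u, hu, hu0⟩ := Submodule.exists_mem_ne_zero_of_ne_bot hne
  exact ⟨u, (grEmb_apply_eq hu).trans_ne hu0⟩

lemma isOpen_apply_ne_zero (u : V) : IsOpen {p : V →L[ℝ] V | p u ≠ 0} :=
  isOpen_ne_fun (by fun_prop) continuous_const

section Analytic

open Filter Topology

variable {X E : Type*} [NormedAddCommGroup E] [NormedSpace ℝ E] {eX : X → E} {x₀ : X}

lemma analyticNear_map_lin {W : X → Submodule ℝ V} {h : X → P.H}
    (hh : AnalyticNear eX (fun x => P.hEmb (h x)) x₀)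
    (hW : AnalyticNear eX (fun x => grEmb (W x)) x₀)
    (hd : ∀ x, Module.finrank ℝ (W x) = Module.finrank ℝ (W x₀)) :
    AnalyticNear eX (fun x => grEmb ((W x).map (lin (h x).1))) x₀ :=
  hh.grEmb_map hW (fun _ => rfl) fun x => by rw [finrank_map, finrank_map, hd]

lemma analyticNear_map_proj {W : X → Submodule ℝ V}
    (hW : AnalyticNear eX (fun x => grEmb (W x)) x₀) (hdisj : ∀ x, Disjoint (W x) P.perp)
    (hd : ∀ x, Module.finrank ℝ (W x) = Module.finrank ℝ (W x₀)) :
    AnalyticNear eX (fun x => grEmb ((W x).map P.proj)) x₀ :=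
  AnalyticNear.grEmb_map (.const (LinearMap.toContinuousLinearMap P.proj)) hW (fun _ => rfl)
    fun x => by rw [finrank_map_proj (hdisj _), finrank_map_proj (hdisj _), hd]

lemma analyticNear_unitVec {U : X → P.Gr k} (hU : AnalyticNear eX (fun x => (U x).emb) x₀)
    (hu : U x₀ ∈ P.grChart k u) : AnalyticNear eX (fun x => unitVec u (U x).emb) x₀ :=
  hU.comp (contDiffAt_unitVec (P.2.2.1 _ ((U x₀).2.1 (grEmb_apply_mem _ _)) hu))

lemma analyticNear_annihilatorOver {U : X → P.Gr k} {a : X → V}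
    (hU : AnalyticNear eX (fun x => (U x).emb) x₀) (ha : AnalyticNear eX a x₀)
    (haP : ∀ x, a x ∈ P.1) (hz : z ∈ P.perp) :
    AnalyticNear eX (fun x => grEmb (annihilatorOver (a x) z (U x).1)) x₀ :=
  (ha.comp (contDiff_graphMap z).contDiffAt).grEmb_map hU (fun _ => rfl) fun x => by
    rw [finrank_annihilatorOver (U x).2.1 (haP x) hz,
      finrank_annihilatorOver (U x₀).2.1 (haP x₀) hz, (U x).2.2, (U x₀).2.2]

lemma eventually_mem_grChart {U : X → P.Gr k} (hU : AnalyticNear eX (fun x => (U x).emb) x₀)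
    (hu : U x₀ ∈ P.grChart k u) : ∀ᶠ x in comap eX (𝓝 (eX x₀)), U x ∈ P.grChart k u :=
  hU.tendsto.eventually ((isOpen_apply_ne_zero u).mem_nhds hu)

lemma exists_analytic_division_unitVec {W : X → Submodule ℝ V}
    (hWan : AnalyticNear eX (fun x => grEmb (W x)) x₀) (hW : ∀ x, IsAnnihilator (W x))
    (hne : W x₀ ≠ ⊥) {U : X → P.Gr k} (hUW : ∀ x, (U x).1 = (W x).map P.proj)
    (hU : AnalyticNear eX (fun x => (U x).emb) x₀) (hu : U x₀ ∈ P.grChart k u)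
    (hz : z ∈ P.perp) (hzz : q z z = -1) :
    ∃ D : X → V →L[ℝ] V, AnalyticNear eX D x₀ ∧ ∀ᶠ x in comap eX (𝓝 (eX x₀)), ∀ h : P.H,
      (annihilatorOver (unitVec u (U x).emb) z (U x).1).map (lin h.1) = W x →
        D x = P.hEmb h := by
  simp only [hUW]
  refine exists_analytic_division hWan hW hne (analyticNear_unitVec hU hu) ?_ hz hzz
  filter_upwards [eventually_mem_grChart hU hu] with x hx
  exact ⟨hUW x ▸ unitVec_mem _ u, q_unitVec_of_mem_grChart hx⟩

end Analytic

variable (P) in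
/-- The orthogonal projection of isotropic lines to lines of `P`. -/
def einProj (ℓ : Ein) : P.Gr 1 :=
  ⟨ℓ.1.map P.proj, map_proj_le, (finrank_map_proj ℓ.isAnnihilator.disjoint_perp).trans ℓ.2.1⟩

variable (P) in
/-- The orthogonal projection of annihilator photons to planes of `P`. -/
def phoProj (W : Pho) : P.Gr 2 :=
  ⟨W.plane.map P.proj, map_proj_le,
    (finrank_map_proj W.isAnnihilator.disjoint_perp).trans W.finrank_plane⟩

variable (P) in
/-- The orthogonal projection of pointed annihilator photons to full flags of `P`. -/
def flagProj (p : F12) : P.Flag :=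
  ⟨(P.einProj p.1.1, P.phoProj p.1.2), Submodule.map_mono p.2⟩

lemma einProj_smul (h : P.H) (ℓ : Ein) : P.einProj (h • ℓ) = P.einProj ℓ :=
  Subtype.ext (map_proj_map_lin h ℓ.1)

lemma phoProj_smul (h : P.H) (W : Pho) : P.phoProj (h • W) = P.phoProj W :=
  Subtype.ext (map_proj_map_lin h W.plane)

lemma flagProj_smul (h : P.H) (p : F12) : P.flagProj (h • p) = P.flagProj p :=
  Subtype.ext (Prod.ext (einProj_smul h p.1.1) (phoProj_smul h p.1.2))

lemma eq_one_of_smul_ein_eq (h : P.H) (ℓ : Ein) (e : h • ℓ = ℓ) : h = 1 :=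
  H_eq_one_of_map_eq ℓ.isAnnihilator ℓ.ne_bot (congrArg Subtype.val e)

lemma eq_one_of_smul_pho_eq (h : P.H) (W : Pho) (e : h • W = W) : h = 1 :=
  H_eq_one_of_map_eq W.isAnnihilator W.ne_bot (congrArg Pho.plane e)

lemma eq_one_of_smul_flag_eq (h : P.H) (p : F12) (e : h • p = p) : h = 1 :=
  eq_one_of_smul_ein_eq h p.1.1 (congrArg (fun p : F12 => p.1.1) e)

lemma analyticNear_einProj (ℓ : Ein) : AnalyticNear Iso.emb (fun ℓ => (P.einProj ℓ).emb) ℓ :=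
  analyticNear_map_proj .emb (fun ℓ : Ein => ℓ.isAnnihilator.disjoint_perp)
    fun ℓ' => ℓ'.2.1.trans ℓ.2.1.symm

lemma analyticNear_phoProj (W : Pho) : AnalyticNear Pho.emb (fun W => (P.phoProj W).emb) W :=
  analyticNear_map_proj .emb (fun W : Pho => W.isAnnihilator.disjoint_perp)
    fun W' => W'.finrank_plane.trans W.finrank_plane.symm

lemma analyticNear_einProj_line (p : F12) :
    AnalyticNear F12.emb (fun p => (P.einProj p.1.1).emb) p :=
  (analyticNear_einProj p.1.1).comp_map (f := fun p : F12 => p.1.1)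
    (.of_contDiffAt (F := Prod.fst) contDiffAt_fst)

lemma analyticNear_phoProj_plane (p : F12) :
    AnalyticNear F12.emb (fun p => (P.phoProj p.1.2).emb) p :=
  (analyticNear_phoProj p.1.2).comp_map (f := fun p : F12 => p.1.2)
    (.of_contDiffAt (F := Prod.snd) contDiffAt_snd)

section Sections

variable (hz : z ∈ P.perp) (hzz : q z z = -1)

/-- The isotropic line over the line `U` that contains `a + z`, for a unit vector `a ∈ U`. -/
def einOver (U : P.Gr 1) (ha : a ∈ U.1) (haa : q a a = 1) : Ein :=
  ⟨annihilatorOver a z U.1, (finrank_annihilatorOver U.2.1 (U.2.1 ha) hz).trans U.2.2,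
    (isAnnihilator_annihilatorOver U.2.1 (U.2.2.trans_le one_le_two) ha hz haa hzz).q_eq_zero⟩

/-- The annihilator photon over the plane `U` that contains `a + z`, for a unit vector `a ∈ U`. -/
def phoOver (U : P.Gr 2) (ha : a ∈ U.1) (haa : q a a = 1) : Pho :=
  have hW := isAnnihilator_annihilatorOver U.2.1 U.2.2.le ha hz haa hzz
  ⟨⟨annihilatorOver a z U.1, (finrank_annihilatorOver U.2.1 (U.2.1 ha) hz).trans U.2.2,
    hW.q_eq_zero⟩, hW.cross_eq_zero⟩

/-- The section of `P.einProj` over `P.grChart 1 u` that takes a line with unit vector `a` to the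
isotropic line through `a + z`. -/
def einSection (U : P.grChart 1 u) : Ein :=
  einOver hz hzz U.1 (unitVec_mem _ u) (q_unitVec_of_mem_grChart U.2)

/-- The section of `P.phoProj` over `P.grChart 2 u` that takes a plane to the annihilator photon
over it through `a + z`, where `a` is the unit vector along the projection of `u`. -/
def phoSection (U : P.grChart 2 u) : Pho :=
  phoOver hz hzz U.1 (unitVec_mem _ u) (q_unitVec_of_mem_grChart U.2)

variable (P) in
/-- The flags of `P` whose line is not orthogonal to `u` for the Euclidean inner product. -/
def flagChart (u : V) : Set P.Flag := {U | U.1.1 ∈ P.grChart 1 u}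

/-- The section of `P.flagProj` over `P.flagChart u` whose lines are those of `einSection`. -/
def flagSection (U : P.flagChart u) : F12 :=
  ⟨(einSection hz hzz ⟨U.1.1.1, U.2⟩, phoOver hz hzz U.1.1.2 (U.1.2 (unitVec_mem _ u))
    (q_unitVec_of_mem_grChart U.2)), annihilatorOver_mono U.1.2⟩

lemma isAnalyticSection_einSection :
    IsAnalyticSection Iso.emb Gr.emb P.hEmb P.einProj (einSection (u := u) hz hzz) where
  proj_eq U := Subtype.ext (map_proj_annihilatorOver U.1.2.1 (U.1.2.1 (unitVec_mem _ u)) hz)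
  analytic U :=
    analyticNear_annihilatorOver .emb (analyticNear_unitVec (u := u) .emb U.2)
      (fun U => U.1.2.1 (unitVec_mem _ u)) hz
  exists_smul_eq ℓ hℓ := by
    obtain ⟨h, hh⟩ := exists_map_lin_annihilatorOver_eq hz hzz ℓ.isAnnihilator
      (unitVec_mem (P.einProj ℓ) u) (q_unitVec_of_mem_grChart hℓ)
    exact ⟨h, Subtype.ext (hh _ ℓ.isAnnihilator le_rfl)⟩
  exists_analytic_division ℓ₀ hℓ₀ := by
    obtain ⟨D, hD, hDe⟩ := exists_analytic_division_unitVec .emb Iso.isAnnihilator ℓ₀.ne_bot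
      (fun _ => rfl) (analyticNear_einProj ℓ₀) hℓ₀ hz hzz
    exact ⟨D, hD, hDe.mono fun ℓ hℓ _ h hh => hℓ h (congrArg Subtype.val hh)⟩

lemma isAnalyticSection_phoSection :
    IsAnalyticSection Pho.emb Gr.emb P.hEmb P.phoProj (phoSection (u := u) hz hzz) where
  proj_eq U := Subtype.ext (map_proj_annihilatorOver U.1.2.1 (U.1.2.1 (unitVec_mem _ u)) hz)
  analytic U :=
    analyticNear_annihilatorOver .emb (analyticNear_unitVec (u := u) .emb U.2)
      (fun U => U.1.2.1 (unitVec_mem _ u)) hz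
  exists_smul_eq W hW := by
    obtain ⟨h, hh⟩ := exists_map_lin_annihilatorOver_eq hz hzz W.isAnnihilator
      (unitVec_mem (P.phoProj W) u) (q_unitVec_of_mem_grChart hW)
    exact ⟨h, Pho.ext (hh _ W.isAnnihilator le_rfl)⟩
  exists_analytic_division W₀ hW₀ := by
    obtain ⟨D, hD, hDe⟩ := exists_analytic_division_unitVec .emb Pho.isAnnihilator W₀.ne_bot
      (fun _ => rfl) (analyticNear_phoProj W₀) hW₀ hz hzz
    exact ⟨D, hD, hDe.mono fun W hW _ h hh => hW h (congrArg Pho.plane hh)⟩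

lemma isAnalyticSection_flagSection :
    IsAnalyticSection F12.emb Flag.emb P.hEmb P.flagProj (flagSection (u := u) hz hzz) where
  proj_eq U := by
    have ha := U.1.1.1.2.1 (unitVec_mem U.1.1.1 u)
    exact Subtype.ext (Prod.ext (Subtype.ext (map_proj_annihilatorOver U.1.1.1.2.1 ha hz))
      (Subtype.ext (map_proj_annihilatorOver U.1.1.2.2.1 ha hz)))
  analytic U := by
    have hline : AnalyticNear (fun U : P.flagChart u => U.1.emb) (fun U => U.1.1.1.emb) U :=
      .of_contDiffAt (F := Prod.fst) contDiffAt_fst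
    have hplane : AnalyticNear (fun U : P.flagChart u => U.1.emb) (fun U => U.1.1.2.emb) U :=
      .of_contDiffAt (F := Prod.snd) contDiffAt_snd
    have ha := analyticNear_unitVec hline U.2
    have haP (U : P.flagChart u) := U.1.1.1.2.1 (unitVec_mem U.1.1.1 u)
    exact (analyticNear_annihilatorOver hline ha haP hz).prodMk
      (analyticNear_annihilatorOver hplane ha haP hz)
  exists_smul_eq p hp := by
    obtain ⟨h, hh⟩ := exists_map_lin_annihilatorOver_eq hz hzz p.1.1.isAnnihilator
      (unitVec_mem (P.einProj p.1.1) u) (q_unitVec_of_mem_grChart hp)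
    exact ⟨h, F12.ext (hh _ p.1.1.isAnnihilator le_rfl) (hh _ p.1.2.isAnnihilator p.2)⟩
  exists_analytic_division p₀ hp₀ := by
    obtain ⟨D, hD, hDe⟩ := exists_analytic_division_unitVec
      (.of_contDiffAt (F := Prod.fst) contDiffAt_fst) (fun p : F12 => p.1.1.isAnnihilator)
      p₀.1.1.ne_bot (fun _ => rfl) (analyticNear_einProj_line p₀) hp₀ hz hzz
    exact ⟨D, hD, hDe.mono fun p hp _ h hh => hp h (congrArg F12.line hh)⟩

end Sections

theorem isPrincipalBundle_einProj : IsPrincipalBundle Iso.emb Gr.emb P.hEmb P.einProj := by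
  refine isPrincipalBundle_of_sections (fun p => ?_) analyticNear_einProj einProj_smul
    eq_one_of_smul_ein_eq fun U => ?_
  · exact analyticNear_map_lin (.of_contDiffAt (F := Prod.fst) contDiffAt_fst)
      (.of_contDiffAt (F := Prod.snd) contDiffAt_snd) fun p' => p'.2.2.1.trans p.2.2.1.symm
  · obtain ⟨z, hz, hzz⟩ := P.exists_mem_perp
    obtain ⟨u, hu⟩ := exists_mem_grChart one_ne_zero U
    exact ⟨_, hu, ⟨_, isOpen_apply_ne_zero u, rfl⟩, _, isAnalyticSection_einSection hz hzz⟩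

theorem isPrincipalBundle_phoProj : IsPrincipalBundle Pho.emb Gr.emb P.hEmb P.phoProj := by
  refine isPrincipalBundle_of_sections (fun p => ?_) analyticNear_phoProj phoProj_smul
    eq_one_of_smul_pho_eq fun U => ?_
  · exact analyticNear_map_lin (.of_contDiffAt (F := Prod.fst) contDiffAt_fst)
      (.of_contDiffAt (F := Prod.snd) contDiffAt_snd)
      fun p' => p'.2.finrank_plane.trans p.2.finrank_plane.symm
  · obtain ⟨z, hz, hzz⟩ := P.exists_mem_perp
    obtain ⟨u, hu⟩ := exists_mem_grChart two_ne_zero U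
    exact ⟨_, hu, ⟨_, isOpen_apply_ne_zero u, rfl⟩, _, isAnalyticSection_phoSection hz hzz⟩

theorem isPrincipalBundle_flagProj : IsPrincipalBundle F12.emb Flag.emb P.hEmb P.flagProj := by
  refine isPrincipalBundle_of_sections (fun p => ?_)
    (fun p => (analyticNear_einProj_line p).prodMk (analyticNear_phoProj_plane p))
    flagProj_smul eq_one_of_smul_flag_eq fun U => ?_
  · have hh := AnalyticNear.of_contDiffAt (eX := fun p : P.H × F12 => (P.hEmb p.1, p.2.emb))
      (x₀ := p) (F := Prod.fst) contDiffAt_fst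
    exact (analyticNear_map_lin hh
        (.of_contDiffAt (F := Prod.fst ∘ Prod.snd) (contDiffAt_fst.comp _ contDiffAt_snd))
        fun p' => p'.2.1.1.2.1.trans p.2.1.1.2.1.symm).prodMk
      (analyticNear_map_lin hh
        (.of_contDiffAt (F := Prod.snd ∘ Prod.snd) (contDiffAt_snd.comp _ contDiffAt_snd))
        fun p' => p'.2.1.2.finrank_plane.trans p.2.1.2.finrank_plane.symm)
  · obtain ⟨z, hz, hzz⟩ := P.exists_mem_perp
    obtain ⟨u, hu⟩ := exists_mem_grChart one_ne_zero U.1.1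
    exact ⟨P.flagChart u, hu,
      ⟨Prod.fst ⁻¹' {p | p u ≠ 0}, (isOpen_apply_ne_zero u).preimage continuous_fst, rfl⟩, _,
      isAnalyticSection_flagSection hz hzz⟩

end SymSpace

/-! ### Opposite pairs -/

/-- Two subspaces that are not orthogonal: the open relation on pairs of isotropic lines. -/
def NonOrthogonal (L L' : Submodule ℝ V) : Prop := ∃ v ∈ L, ∃ w ∈ L', q v w ≠ 0

/-- The pairing of the two subspaces by `q` has rank at least two: the open relation on pairs of
annihilator photons. -/
def PlaneOpposite (W W' : Submodule ℝ V) : Prop :=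
  ∃ v₁ ∈ W, ∃ v₂ ∈ W, ∃ w₁ ∈ W', ∃ w₂ ∈ W', q v₁ w₁ * q v₂ w₂ - q v₁ w₂ * q v₂ w₁ ≠ 0

lemma nonOrthogonal_map_lin_iff (g : G2) {L L' : Submodule ℝ V} :
    NonOrthogonal (L.map (lin g)) (L'.map (lin g)) ↔ NonOrthogonal L L' := by
  simp only [NonOrthogonal, Submodule.mem_map, exists_exists_and_eq_and, q_lin]

lemma planeOpposite_map_lin_iff (g : G2) {W W' : Submodule ℝ V} :
    PlaneOpposite (W.map (lin g)) (W'.map (lin g)) ↔ PlaneOpposite W W' := by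
  simp only [PlaneOpposite, Submodule.mem_map, exists_exists_and_eq_and, q_lin]

lemma nonOrthogonal_span_singleton_iff {v w : V} :
    NonOrthogonal (Submodule.span ℝ {v}) (Submodule.span ℝ {w}) ↔ q v w ≠ 0 := by
  refine ⟨?_, fun h => ⟨v, Submodule.mem_span_singleton_self v, w,
    Submodule.mem_span_singleton_self w, h⟩⟩
  rintro ⟨v', hv', w', hw', hne⟩ h
  obtain ⟨r, rfl⟩ := Submodule.mem_span_singleton.1 hv'
  obtain ⟨s, rfl⟩ := Submodule.mem_span_singleton.1 hw'
  exact hne (by simp only [map_smul, LinearMap.smul_apply, h, smul_zero])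

lemma NonOrthogonal.exists_q_eq_half {L L' : Submodule ℝ V} (h : NonOrthogonal L L') :
    ∃ v ∈ L, ∃ w ∈ L', q v w = 1 / 2 := by
  obtain ⟨v, hv, w, hw, hvw⟩ := h
  refine ⟨v, hv, (2 * q v w)⁻¹ • w, L'.smul_mem _ hw, ?_⟩
  rw [map_smul, smul_eq_mul]
  field_simp

lemma PlaneOpposite.nonOrthogonal {W W' : Submodule ℝ V} (h : PlaneOpposite W W') :
    NonOrthogonal W W' := by
  obtain ⟨v₁, h₁, v₂, -, w₁, k₁, w₂, k₂, e⟩ := h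
  by_contra! hall
  simp only [NonOrthogonal, not_exists, not_and, not_not] at hall
  exact e (by rw [hall v₁ h₁ w₁ k₁, hall v₁ h₁ w₂ k₂]; ring)

section Open

variable {X : Type*} [TopologicalSpace X] {W W' : X → Submodule ℝ V}

lemma continuous_q_grEmb (hW : Continuous fun x => grEmb (W x))
    (hW' : Continuous fun x => grEmb (W' x)) (v w : V) :
    Continuous fun x => q (grEmb (W x) v) (grEmb (W' x) w) := by
  have hv : Continuous fun x => grEmb (W x) v := hW.clm_apply continuous_const
  have hw : Continuous fun x => grEmb (W' x) w := hW'.clm_apply continuous_const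
  exact (q.toContinuousBilinearMap.continuous.comp hv).clm_apply hw

lemma isOpen_nonOrthogonal (hW : Continuous fun x => grEmb (W x))
    (hW' : Continuous fun x => grEmb (W' x)) : IsOpen {x | NonOrthogonal (W x) (W' x)} := by
  have hunion : {x | NonOrthogonal (W x) (W' x)} =
      ⋃ (v : V) (w : V), {x | q (grEmb (W x) v) (grEmb (W' x) w) ≠ 0} := by
    ext x
    simp only [Set.mem_ofPred_eq, Set.mem_iUnion]
    constructor
    · rintro ⟨v, hv, w, hw, e⟩
      exact ⟨v, w, by rwa [grEmb_apply_eq hv, grEmb_apply_eq hw]⟩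
    · rintro ⟨v, w, e⟩
      exact ⟨_, grEmb_apply_mem _ _, _, grEmb_apply_mem _ _, e⟩
  rw [hunion]
  exact isOpen_iUnion fun v => isOpen_iUnion fun w =>
    isOpen_ne_fun (continuous_q_grEmb hW hW' v w) continuous_const

lemma isOpen_planeOpposite (hW : Continuous fun x => grEmb (W x))
    (hW' : Continuous fun x => grEmb (W' x)) : IsOpen {x | PlaneOpposite (W x) (W' x)} := by
  have hunion : {x | PlaneOpposite (W x) (W' x)} = ⋃ (v₁ : V) (v₂ : V) (w₁ : V) (w₂ : V),
      {x | q (grEmb (W x) v₁) (grEmb (W' x) w₁) * q (grEmb (W x) v₂) (grEmb (W' x) w₂) -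
        q (grEmb (W x) v₁) (grEmb (W' x) w₂) * q (grEmb (W x) v₂) (grEmb (W' x) w₁) ≠ 0} := by
    ext x
    simp only [Set.mem_ofPred_eq, Set.mem_iUnion]
    constructor
    · rintro ⟨v₁, h₁, v₂, h₂, w₁, k₁, w₂, k₂, e⟩
      exact ⟨v₁, v₂, w₁, w₂, by
        rwa [grEmb_apply_eq h₁, grEmb_apply_eq h₂, grEmb_apply_eq k₁, grEmb_apply_eq k₂]⟩
    · rintro ⟨v₁, v₂, w₁, w₂, e⟩
      exact ⟨_, grEmb_apply_mem _ _, _, grEmb_apply_mem _ _, _, grEmb_apply_mem _ _, _,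
        grEmb_apply_mem _ _, e⟩
  rw [hunion]
  have hcont := continuous_q_grEmb hW hW'
  exact isOpen_iUnion fun v₁ => isOpen_iUnion fun v₂ => isOpen_iUnion fun w₁ =>
    isOpen_iUnion fun w₂ => isOpen_ne_fun
      (((hcont v₁ w₁).mul (hcont v₂ w₂)).sub ((hcont v₁ w₂).mul (hcont v₂ w₁))) continuous_const

end Open

/-! ### Transitivity on opposite pairs -/

lemma IsTriad.exists_map {x y z x' y' z' : V} (h : IsTriad x y z) (h' : IsTriad x' y' z') :
    ∃ g : G2, lin g x = x' ∧ lin g y = y' ∧ lin g z = z' := by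
  have frame_single : ∀ {x y z : V} (h : IsTriad x y z),
      lin h.frame (EuclideanSpace.single 0 1) = x ∧ lin h.frame (EuclideanSpace.single 1 1) = y ∧
        lin h.frame (EuclideanSpace.single 3 1) = z := fun h => by
    simp [h.lin_frame, frameMap_apply]
  obtain ⟨hx, hy, hz⟩ := frame_single h
  obtain ⟨hx', hy', hz'⟩ := frame_single h'
  have key : ∀ e v v', lin h.frame e = v → lin h'.frame e = v' →
      lin (h'.frame * h.frame⁻¹) v = v' := by
    rintro e _ _ rfl rfl
    rw [lin_mul, LinearMap.comp_apply, lin_inv_apply]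
  exact ⟨h'.frame * h.frame⁻¹, key _ _ _ hx hx', key _ _ _ hy hy', key _ _ _ hz hz'⟩

lemma q_self_pos_of_sndQ_eq_zero {u : V} (hsnd : sndQ u = 0) (hu : u ≠ 0) : 0 < q u u := by
  rw [q_self_eq_normSq_sub_normSq, hsnd, map_zero, sub_zero]
  refine Quaternion.normSq_nonneg.lt_of_ne' fun h => hu (fstQ_sndQ_ext ?_ ?_)
  · rw [Quaternion.normSq_eq_zero.1 h]; ext <;> simp
  · rw [hsnd]; ext <;> simp

lemma exists_pos_of_four_lt_finrank {W : Submodule ℝ V} (hd : 4 < Module.finrank ℝ W) :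
    ∃ u ∈ W, 0 < q u u := by
  have hker : LinearMap.ker (starSndQL ∘ₗ W.subtype) ≠ ⊥ :=
    LinearMap.ker_ne_bot_of_finrank_lt (by rwa [Quaternion.finrank_eq_four])
  obtain ⟨u, hu, hu0⟩ := Submodule.exists_mem_ne_zero_of_ne_bot hker
  exact ⟨u, u.2, q_self_pos_of_sndQ_eq_zero (star_eq_zero.1 (LinearMap.mem_ker.1 hu))
    fun h => hu0 (Subtype.ext h)⟩

lemma exists_pos_orthogonal (s t : V) : ∃ u, q u s = 0 ∧ q u t = 0 ∧ 0 < q u u := by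
  let f : V →ₗ[ℝ] ℝ × ℝ := (q.flip s).prod (q.flip t)
  have hrank := f.finrank_range_add_finrank_ker
  have hrange : Module.finrank ℝ (LinearMap.range f) ≤ 2 :=
    (Submodule.finrank_le _).trans_eq (by simp)
  rw [finrank_euclideanSpace_fin] at hrank
  have hker : 4 < Module.finrank ℝ (LinearMap.ker f) := by omega
  obtain ⟨u, hu, hpos⟩ := exists_pos_of_four_lt_finrank hker
  exact ⟨u, congrArg Prod.fst hu, congrArg Prod.snd hu, hpos⟩

lemma exists_isTriad {s t : V} (ss : q s s = 1) (tt : q t t = -1) (st : q s t = 0) :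
    ∃ j, IsTriad s j t := by
  obtain ⟨u, hus, hut, huu⟩ := exists_pos_orthogonal s t
  set c := cross s t with hc
  have cc : q c c = -1 := by rw [hc, q_cross_cross, ss, tt, st]; norm_num
  set j := u + q u c • c with hj
  have js : q j s = 0 := by
    rw [hj, map_add, map_smul, LinearMap.add_apply, LinearMap.smul_apply, hus, q_cross_left,
      smul_zero, add_zero]
  have jt : q j t = 0 := by
    rw [hj, map_add, map_smul, LinearMap.add_apply, LinearMap.smul_apply, hut, q_cross_right,
      smul_zero, add_zero]
  have jc : q j c = 0 := by
    rw [hj, map_add, map_smul, LinearMap.add_apply, LinearMap.smul_apply, cc, smul_eq_mul]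
    ring
  have jj : 0 < q j j := by
    have : q j j = q u u + q u c * q u c := by
      rw [hj, map_add (q _), ← hj, map_smul, jc, smul_zero, add_zero, q_comm, hj, map_add,
        map_smul, smul_eq_mul]
    linarith [mul_self_nonneg (q u c)]
  obtain ⟨r, -, hr⟩ := exists_smul_q_eq_one jj
  refine ⟨r • j, ss, hr, tt, ?_, st, ?_, ?_⟩
  · rw [map_smul, q_comm, js, smul_zero]
  · rw [map_smul, LinearMap.smul_apply, jt, smul_zero]
  · rw [q_cross_left_comm, map_smul, LinearMap.smul_apply, jc, smul_zero, neg_zero]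

lemma map_eq_of_map_add_of_map_sub {E F : Type*} [AddCommGroup E] [Module ℝ E] [AddCommGroup F]
    [Module ℝ F] {f : E →ₗ[ℝ] F} {x y : E} {x' y' : F} (hadd : f (x + y) = x' + y')
    (hsub : f (x - y) = x' - y') : f x = x' ∧ f y = y' := by
  rw [map_add] at hadd
  rw [map_sub] at hsub
  constructor
  · linear_combination (norm := module) (1 / 2 : ℝ) • hadd + (1 / 2 : ℝ) • hsub
  · linear_combination (norm := module) (1 / 2 : ℝ) • hadd - (1 / 2 : ℝ) • hsub

lemma exists_lin_eq_of_isotropic_pair {v w v' w' : V} (hv : q v v = 0) (hw : q w w = 0)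
    (hvw : q v w = 1 / 2) (hv' : q v' v' = 0) (hw' : q w' w' = 0) (hvw' : q v' w' = 1 / 2) :
    ∃ g : G2, lin g v = v' ∧ lin g w = w' := by
  have exists_triad : ∀ {v w : V}, q v v = 0 → q w w = 0 → q v w = 1 / 2 →
      ∃ j, IsTriad (v + w) j (v - w) := by
    intro v w hv hw hvw
    have hwv := q_comm w v
    apply exists_isTriad <;>
    simp only [map_add, map_sub, LinearMap.add_apply, LinearMap.sub_apply] <;>
    linarith
  obtain ⟨j, hj⟩ := exists_triad hv hw hvw
  obtain ⟨j', hj'⟩ := exists_triad hv' hw' hvw'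
  obtain ⟨g, hadd, -, hsub⟩ := hj.exists_map hj'
  exact ⟨g, map_eq_of_map_add_of_map_sub hadd hsub⟩

/-- Bases `x₁, x₂` and `y₁, y₂` of two annihilator subspaces which are dual to each other for
`2 q`; the factor makes `x₁ + y₁`, `x₂ + y₂`, `x₁ - y₁` a triad. -/
structure IsDualPair (x₁ x₂ y₁ y₂ : V) : Prop where
  left : IsAnnihilator (Submodule.span ℝ {x₁, x₂})
  right : IsAnnihilator (Submodule.span ℝ {y₁, y₂})
  q₁₁ : q x₁ y₁ = 1 / 2
  q₂₂ : q x₂ y₂ = 1 / 2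
  q₁₂ : q x₁ y₂ = 0
  q₂₁ : q x₂ y₁ = 0

namespace IsDualPair

variable {x₁ x₂ y₁ y₂ x₁' x₂' y₁' y₂' : V}

lemma symm (h : IsDualPair x₁ x₂ y₁ y₂) : IsDualPair y₁ y₂ x₁ x₂ :=
  ⟨h.right, h.left, by rw [q_comm, h.q₁₁], by rw [q_comm, h.q₂₂], by rw [q_comm, h.q₂₁],
    by rw [q_comm, h.q₁₂]⟩

lemma cross_left (h : IsDualPair x₁ x₂ y₁ y₂) : cross x₁ x₂ = 0 :=
  h.left.cross_eq_zero _ (Submodule.mem_span_of_mem (by simp)) _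
    (Submodule.mem_span_of_mem (by simp))

lemma q_left (h : IsDualPair x₁ x₂ y₁ y₂) : q x₁ x₁ = 0 ∧ q x₁ x₂ = 0 ∧ q x₂ x₂ = 0 := by
  have h₁ : x₁ ∈ Submodule.span ℝ {x₁, x₂} := Submodule.mem_span_of_mem (by simp)
  have h₂ : x₂ ∈ Submodule.span ℝ {x₁, x₂} := Submodule.mem_span_of_mem (by simp)
  exact ⟨h.left.q_eq_zero _ h₁ _ h₁, h.left.q_eq_zero _ h₁ _ h₂, h.left.q_eq_zero _ h₂ _ h₂⟩

lemma q_cross_left_right (h : IsDualPair x₁ x₂ y₁ y₂) : q (cross x₁ y₂) y₁ = 0 := by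
  rw [q_cross_cyclic, cross_anticomm y₂ y₁, h.symm.cross_left, neg_zero, map_zero,
    LinearMap.zero_apply]

lemma isTriad (h : IsDualPair x₁ x₂ y₁ y₂) : IsTriad (x₁ + y₁) (x₂ + y₂) (x₁ - y₁) := by
  obtain ⟨hx₁, hx, hx₂⟩ := h.q_left
  obtain ⟨hy₁, hy, hy₂⟩ := h.symm.q_left
  have hx₁y₂ : q (cross x₁ y₂) x₁ = 0 := q_cross_left _ _
  have hy₁x₂ : q (cross y₁ x₂) y₁ = 0 := q_cross_left _ _
  constructor <;>
  simp only [map_add, map_sub, LinearMap.add_apply, LinearMap.sub_apply, hx₁, hx, hx₂, hy₁, hy,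
    hy₂, h.q₁₁, h.q₂₂, h.q₁₂, h.q₂₁, h.symm.q₁₁, h.symm.q₂₂, h.symm.q₁₂, h.symm.q₂₁, hx₁y₂, hy₁x₂,
    h.cross_left, h.symm.cross_left, h.q_cross_left_right, h.symm.q_cross_left_right,
    q_comm x₂ x₁, q_comm y₂ y₁] <;>
  norm_num

lemma cross_cross (h : IsDualPair x₁ x₂ y₁ y₂) :
    cross (cross (x₂ + y₂) (x₁ - y₁)) (x₁ + y₁) = x₂ - y₂ := by
  have left_eq_zero : ∀ {x₁ x₂ y₁ y₂}, IsDualPair x₁ x₂ y₁ y₂ → cross x₁ (cross x₁ y₂) = 0 := by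
    intro x₁ x₂ y₁ y₂ h
    rw [SplitG2.cross_cross, h.q_left.1, h.q₁₂]
    simp
  have left_right : ∀ {x₁ x₂ y₁ y₂}, IsDualPair x₁ x₂ y₁ y₂ → cross x₁ (cross y₁ x₂) = -x₂ := by
    intro x₁ x₂ y₁ y₂ h
    rw [cross_left_comm_polarized, h.cross_left, h.q₁₁, h.q_left.2.1, h.symm.q₁₂]
    simp
  rw [cross_anticomm]
  simp only [map_add, map_sub, LinearMap.add_apply, cross_anticomm x₂, cross_anticomm y₂,
    h.cross_left, h.symm.cross_left, map_neg, left_eq_zero h, left_eq_zero h.symm, left_right h,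
    left_right h.symm, map_zero]
  module

lemma exists_lin_eq (h : IsDualPair x₁ x₂ y₁ y₂) (h' : IsDualPair x₁' x₂' y₁' y₂') :
    ∃ g : G2, (lin g x₁ = x₁' ∧ lin g y₁ = y₁') ∧ lin g x₂ = x₂' ∧ lin g y₂ = y₂' := by
  obtain ⟨g, hadd₁, hadd₂, hsub₁⟩ := h.isTriad.exists_map h'.isTriad
  refine ⟨g, map_eq_of_map_add_of_map_sub hadd₁ hsub₁, map_eq_of_map_add_of_map_sub hadd₂ ?_⟩
  rw [← h.cross_cross, ← h'.cross_cross, lin_cross, lin_cross, hadd₁, hadd₂, hsub₁]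

end IsDualPair

lemma span_pair_eq_of_q_ne_zero {W : Submodule ℝ V} (hd : Module.finrank ℝ W = 2)
    {x₁ x₂ y₁ y₂ : V} (h₁ : x₁ ∈ W) (h₂ : x₂ ∈ W) (h₁₁ : q x₁ y₁ ≠ 0) (h₂₂ : q x₂ y₂ ≠ 0)
    (h₁₂ : q x₁ y₂ = 0) (h₂₁ : q x₂ y₁ = 0) : Submodule.span ℝ {x₁, x₂} = W := by
  have hli : LinearIndependent ℝ ![x₁, x₂] := by
    refine LinearIndependent.pair_iff.2 fun s t h => ?_
    have hs := congrArg (q · y₁) h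
    have ht := congrArg (q · y₂) h
    simp only [map_add, map_smul, LinearMap.add_apply, LinearMap.smul_apply, map_zero, h₁₂, h₂₁,
      LinearMap.zero_apply, smul_eq_mul, mul_zero, add_zero, zero_add] at hs ht
    exact ⟨(mul_eq_zero.1 hs).resolve_right h₁₁, (mul_eq_zero.1 ht).resolve_right h₂₂⟩
  have hrange : Set.range ![x₁, x₂] = {x₁, x₂} := Matrix.range_cons_cons_empty _ _ _
  refine Submodule.eq_of_le_of_finrank_eq (Submodule.span_le.2 ?_) ?_
  · rintro x (rfl | rfl)
    exacts [h₁, h₂]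
  · rw [hd, ← hrange, finrank_span_eq_card hli, Fintype.card_fin]

lemma PlaneOpposite.exists_dual {W W' : Submodule ℝ V} (h : PlaneOpposite W W') {v w : V}
    (hv : v ∈ W) (hw : w ∈ W') (hvw : q v w = 1 / 2) :
    ∃ x ∈ W, ∃ y ∈ W', q x w = 0 ∧ q v y = 0 ∧ q x y = 1 / 2 := by
  let f : V → V := fun x => x - (2 * q x w) • v
  let f' : V → V := fun y => y - (2 * q v y) • w
  have hf : ∀ x, q (f x) w = 0 := fun x => by
    simp only [f, map_sub, LinearMap.sub_apply, map_smul, LinearMap.smul_apply, smul_eq_mul, hvw]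
    ring
  have hf' : ∀ y, q v (f' y) = 0 := fun y => by
    simp only [f', map_sub, map_smul, smul_eq_mul, hvw]
    ring
  have hff : ∀ x y, q (f x) (f' y) = q x y - 2 * q x w * q v y := fun x y => by
    have : q (f x) (f' y) = q (f x) y := by
      simp only [f', map_sub (q (f x)), map_smul, hf, smul_zero, sub_zero]
    rw [this]
    simp only [f, map_sub, LinearMap.sub_apply, map_smul, LinearMap.smul_apply, smul_eq_mul]
  have hne : ∃ x ∈ W, ∃ y ∈ W', q (f x) (f' y) ≠ 0 := by
    by_contra! hall
    simp only [hff, sub_eq_zero] at hall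
    obtain ⟨v₁, h₁, v₂, h₂, w₁, k₁, w₂, k₂, e⟩ := h
    refine e ?_
    rw [hall v₁ h₁ w₁ k₁, hall v₁ h₁ w₂ k₂, hall v₂ h₂ w₁ k₁, hall v₂ h₂ w₂ k₂]
    ring
  obtain ⟨x, hx, y, hy, hxy⟩ := hne
  refine ⟨f x, W.sub_mem hx (W.smul_mem _ hv), (2 * q (f x) (f' y))⁻¹ • f' y,
    W'.smul_mem _ (W'.sub_mem hy (W'.smul_mem _ hw)), hf x, ?_, ?_⟩
  · rw [map_smul, hf', smul_zero]
  · rw [map_smul, smul_eq_mul]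
    field_simp

lemma PlaneOpposite.exists_isDualPair {W W' : Submodule ℝ V} (h : PlaneOpposite W W')
    (hW : IsAnnihilator W) (hW' : IsAnnihilator W') (hd : Module.finrank ℝ W = 2)
    (hd' : Module.finrank ℝ W' = 2) {v w : V} (hv : v ∈ W) (hw : w ∈ W') (hvw : q v w = 1 / 2) :
    ∃ x y, IsDualPair v x w y ∧ Submodule.span ℝ {v, x} = W ∧ Submodule.span ℝ {w, y} = W' := by
  obtain ⟨x, hx, y, hy, hxw, hvy, hxy⟩ := h.exists_dual hv hw hvw
  have half_ne_zero : (1 / 2 : ℝ) ≠ 0 := one_div_ne_zero two_ne_zero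
  have hspan : Submodule.span ℝ {v, x} = W :=
    span_pair_eq_of_q_ne_zero hd hv hx (hvw.trans_ne half_ne_zero) (hxy.trans_ne half_ne_zero)
      hvy hxw
  have hspan' : Submodule.span ℝ {w, y} = W' :=
    span_pair_eq_of_q_ne_zero hd' hw hy (y₁ := v) (y₂ := x)
      (by rw [q_comm, hvw]; exact half_ne_zero)
      (by rw [q_comm, hxy]; exact half_ne_zero)
      (by rw [q_comm, hxw]) (by rw [q_comm, hvy])
  exact ⟨x, y, ⟨hspan.symm ▸ hW, hspan'.symm ▸ hW', hvw, hxy, hvy, hxw⟩, hspan, hspan'⟩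

lemma ne_zero_of_q_ne_zero {v w : V} (h : q v w ≠ 0) : v ≠ 0 ∧ w ≠ 0 := by
  constructor <;> rintro rfl <;> simp at h

lemma Iso.eq_of_mem {ℓ ℓ' : Ein} {v : V} (hv0 : v ≠ 0) (hv : v ∈ ℓ.1) (hv' : v ∈ ℓ'.1) : ℓ = ℓ' :=
  Subtype.ext <| (eq_span_singleton_of_mem_of_finrank_eq_one ℓ.2.1 hv hv0).trans
    (eq_span_singleton_of_mem_of_finrank_eq_one ℓ'.2.1 hv' hv0).symm

lemma exists_smul_ein_eq {x y x' y' : Ein} (h : NonOrthogonal x.1 y.1)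
    (h' : NonOrthogonal x'.1 y'.1) : ∃ g : G2, g • x = x' ∧ g • y = y' := by
  obtain ⟨v, hv, w, hw, hvw⟩ := h.exists_q_eq_half
  obtain ⟨v', hv', w', hw', hvw'⟩ := h'.exists_q_eq_half
  obtain ⟨hv0', hw0'⟩ := ne_zero_of_q_ne_zero (hvw'.trans_ne (one_div_ne_zero two_ne_zero))
  obtain ⟨g, rfl, rfl⟩ := exists_lin_eq_of_isotropic_pair (x.2.2 v hv v hv) (y.2.2 w hw w hw) hvw
    (x'.2.2 v' hv' v' hv') (y'.2.2 w' hw' w' hw') hvw'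
  exact ⟨g, Iso.eq_of_mem hv0' (Submodule.mem_map_of_mem hv) hv',
    Iso.eq_of_mem hw0' (Submodule.mem_map_of_mem hw) hw'⟩

lemma exists_smul_pho_eq_of_mem {x y x' y' : Pho} (h : PlaneOpposite x.plane y.plane)
    (h' : PlaneOpposite x'.plane y'.plane) {v w v' w' : V} (hv : v ∈ x.plane) (hw : w ∈ y.plane)
    (hvw : q v w = 1 / 2) (hv' : v' ∈ x'.plane) (hw' : w' ∈ y'.plane) (hvw' : q v' w' = 1 / 2) :
    ∃ g : G2, (g • x = x' ∧ g • y = y') ∧ lin g v = v' ∧ lin g w = w' := by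
  obtain ⟨v₂, w₂, hdual, hx, hy⟩ := h.exists_isDualPair x.isAnnihilator y.isAnnihilator
    x.finrank_plane y.finrank_plane hv hw hvw
  obtain ⟨v₂', w₂', hdual', hx', hy'⟩ := h'.exists_isDualPair x'.isAnnihilator y'.isAnnihilator
    x'.finrank_plane y'.finrank_plane hv' hw' hvw'
  obtain ⟨g, ⟨hgv, hgw⟩, hgv₂, hgw₂⟩ := hdual.exists_lin_eq hdual'
  refine ⟨g, ⟨Pho.ext ?_, Pho.ext ?_⟩, hgv, hgw⟩
  · change x.plane.map (lin g) = x'.plane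
    rw [← hx, ← hx', Submodule.map_span, Set.image_pair, hgv, hgv₂]
  · change y.plane.map (lin g) = y'.plane
    rw [← hy, ← hy', Submodule.map_span, Set.image_pair, hgw, hgw₂]

lemma exists_smul_pho_eq {x y x' y' : Pho} (h : PlaneOpposite x.plane y.plane)
    (h' : PlaneOpposite x'.plane y'.plane) : ∃ g : G2, g • x = x' ∧ g • y = y' := by
  obtain ⟨v, hv, w, hw, hvw⟩ := h.nonOrthogonal.exists_q_eq_half
  obtain ⟨v', hv', w', hw', hvw'⟩ := h'.nonOrthogonal.exists_q_eq_half
  exact (exists_smul_pho_eq_of_mem h h' hv hw hvw hv' hw' hvw').imp fun g hg => hg.1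

lemma exists_smul_flag_eq {x y x' y' : F12} (hl : NonOrthogonal x.line y.line)
    (hp : PlaneOpposite x.plane y.plane) (hl' : NonOrthogonal x'.line y'.line)
    (hp' : PlaneOpposite x'.plane y'.plane) : ∃ g : G2, g • x = x' ∧ g • y = y' := by
  obtain ⟨v, hv, w, hw, hvw⟩ := hl.exists_q_eq_half
  obtain ⟨v', hv', w', hw', hvw'⟩ := hl'.exists_q_eq_half
  obtain ⟨hv0', hw0'⟩ := ne_zero_of_q_ne_zero (hvw'.trans_ne (one_div_ne_zero two_ne_zero))
  obtain ⟨g, ⟨hx, hy⟩, rfl, rfl⟩ := exists_smul_pho_eq_of_mem (x := x.1.2) (y := y.1.2)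
    (x' := x'.1.2) (y' := y'.1.2) hp hp' (x.2 hv) (y.2 hw) hvw (x'.2 hv') (y'.2 hw') hvw'
  refine ⟨g, Subtype.ext (Prod.ext ?_ hx), Subtype.ext (Prod.ext ?_ hy)⟩
  · exact Iso.eq_of_mem hv0' (Submodule.mem_map_of_mem hv) hv'
  · exact Iso.eq_of_mem hw0' (Submodule.mem_map_of_mem hw) hw'

/-! ### Criteria for transversality -/

section Criteria

open Filter Topology

variable {G F B : Type*} [Group G] [TopologicalSpace F] [MulAction G F] {R : F → F → Prop}

lemma transverse_of_transitive (hopen : IsOpen {p : F × F | R p.1 p.2})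
    (hinv : ∀ (g : G) x y, R (g • x) (g • y) ↔ R x y)
    (htrans : ∀ x y x' y', R x y → R x' y' → ∃ g : G, g • x = x' ∧ g • y = y') {x y : F}
    (h : R x y) : Transverse G x y := by
  have horbit : MulAction.orbit G (x, y) = {p : F × F | R p.1 p.2} := by
    ext ⟨x', y'⟩
    constructor
    · rintro ⟨g, hg⟩
      rw [← hg]
      exact (hinv g x y).2 h
    · intro h'
      obtain ⟨g, rfl, rfl⟩ := htrans x y x' y' h h'
      exact ⟨g, rfl⟩
  rw [Transverse, horbit]
  exact hopen

lemma not_transverse_of_frequently (hinv : ∀ (g : G) x y, R (g • x) (g • y) ↔ R x y) {x y : F}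
    (h : R x y) (hfreq : ∃ᶠ y' in 𝓝 y, ¬R x y') : ¬Transverse G x y := by
  intro hopen
  have horbit : ∀ᶠ y' in 𝓝 y, (x, y') ∈ MulAction.orbit G (x, y) :=
    (Continuous.prodMk_right x).continuousAt.eventually
      (hopen.mem_nhds (MulAction.mem_orbit_self _))
  obtain ⟨y', hy', g, hg⟩ := (hfreq.and_eventually horbit).exists
  obtain ⟨hgx, rfl⟩ := Prod.ext_iff.1 hg
  have hgy : R (g • x) (g • y) := (hinv g x y).2 h
  rw [show g • x = x from hgx] at hgy
  exact hy' hgy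

lemma maximallyTransverse_fiber {π : F → B} {b : B}
    (hfiber : ∀ x y, π x = b → π y = b → x ≠ y → Transverse G x y)
    (hmax : ∀ z, π z ≠ b → ∃ y, π y = b ∧ ¬Transverse G z y) :
    MaximallyTransverse G (π ⁻¹' {b}) := by
  refine ⟨fun x hx y hy => hfiber x y hx hy, fun T hT hle => hle.antisymm' fun z hz => ?_⟩
  by_contra hzb
  obtain ⟨y, hy, hzy⟩ := hmax z hzb
  exact hzy (hT hz (hle hy) fun h => hzb (h ▸ hy))

end Criteria

lemma map_lin_inf_map_lin_eq_bot_iff (g : G2) {W W' : Submodule ℝ V} :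
    W.map (lin g) ⊓ W'.map (lin g) = ⊥ ↔ W ⊓ W' = ⊥ := by
  rw [← Submodule.map_inf _ (lin_injective g),
    (Submodule.map_injective_of_injective (lin_injective g)).eq_iff' (Submodule.map_bot _)]

lemma transverse_ein_of_nonOrthogonal {x y : Ein} (h : NonOrthogonal x.1 y.1) :
    Transverse G2 x y := by
  have hemb : Continuous fun ℓ : Ein => grEmb ℓ.1 := continuous_induced_dom
  exact transverse_of_transitive (R := fun x y : Ein => NonOrthogonal x.1 y.1)
    (isOpen_nonOrthogonal (hemb.comp continuous_fst) (hemb.comp continuous_snd))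
    (fun g _ _ => nonOrthogonal_map_lin_iff g) (fun _ _ _ _ => exists_smul_ein_eq) h

lemma transverse_pho_of_planeOpposite {x y : Pho} (h : PlaneOpposite x.plane y.plane) :
    Transverse G2 x y := by
  have hemb : Continuous fun W : Pho => grEmb W.plane := continuous_induced_dom
  exact transverse_of_transitive (R := fun x y : Pho => PlaneOpposite x.plane y.plane)
    (isOpen_planeOpposite (hemb.comp continuous_fst) (hemb.comp continuous_snd))
    (fun g _ _ => planeOpposite_map_lin_iff g) (fun _ _ _ _ => exists_smul_pho_eq) h

lemma transverse_flag_of_opposite {x y : F12} (hl : NonOrthogonal x.line y.line)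
    (hp : PlaneOpposite x.plane y.plane) : Transverse G2 x y := by
  have hemb : Continuous F12.emb := continuous_induced_dom
  have hline := continuous_fst.comp hemb
  have hplane := continuous_snd.comp hemb
  exact transverse_of_transitive
    (R := fun x y : F12 => NonOrthogonal x.line y.line ∧ PlaneOpposite x.plane y.plane)
    ((isOpen_nonOrthogonal (hline.comp continuous_fst) (hline.comp continuous_snd)).inter
      (isOpen_planeOpposite (hplane.comp continuous_fst) (hplane.comp continuous_snd)))
    (fun g _ _ => and_congr (nonOrthogonal_map_lin_iff g) (planeOpposite_map_lin_iff g))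
    (fun _ _ _ _ h h' => exists_smul_flag_eq h.1 h.2 h'.1 h'.2) ⟨hl, hp⟩

namespace SymSpace

variable {P : SymSpace} {W W' U : Submodule ℝ V} {a b b' c d d' : V}

/-! ### Distinct points of a fiber are transverse -/

lemma neg_one_lt_q (hb : b ∈ P.perp) (hb' : b' ∈ P.perp) (bb : q b b = -1) (bb' : q b' b' = -1)
    (hne : b ≠ b') : -1 < q b b' := by
  have h := q_self_neg (P.perp.sub_mem hb hb') (sub_ne_zero.2 hne)
  simp only [map_sub, LinearMap.sub_apply, bb, bb', q_comm b' b] at h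
  linarith

lemma exists_unit_map_proj (hW : IsAnnihilator W) (hne : W ≠ ⊥) :
    ∃ a ∈ W.map P.proj, q a a = 1 :=
  exists_unit map_proj_le (by
    rw [finrank_map_proj hW.disjoint_perp]
    exact Nat.pos_of_ne_zero (mt Submodule.finrank_eq_zero.1 hne))

lemma exists_eq_annihilatorOver (hW : IsAnnihilator W) (hW' : IsAnnihilator W')
    (h : W.map P.proj = W'.map P.proj) (hne : W ≠ W') (ha : a ∈ W.map P.proj)
    (haa : q a a = 1) : ∃ b ∈ P.perp, ∃ b' ∈ P.perp, -1 < q b b' ∧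
      W = annihilatorOver a b (W.map P.proj) ∧ W' = annihilatorOver a b' (W.map P.proj) := by
  obtain ⟨b, hb, bb, hab⟩ := exists_add_mem hW ha haa
  obtain ⟨b', hb', bb', hab'⟩ := exists_add_mem hW' (h ▸ ha) haa
  have e := annihilatorOver_map_proj hW (map_proj_le ha) hb haa hab
  have e' := annihilatorOver_map_proj hW' (map_proj_le ha) hb' haa hab'
  rw [← h] at e'
  refine ⟨b, hb, b', hb', neg_one_lt_q hb hb' bb bb' ?_, e.symm, e'.symm⟩
  rintro rfl
  exact hne (e.symm.trans e')

lemma q_graphMap_graphMap_self (ha : a ∈ P.1) (hb : b ∈ P.perp) (hb' : b' ∈ P.perp)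
    (haa : q a a = 1) (hc : c ∈ P.1) :
    q (graphMap a b c) (graphMap a b' c) = q c c * (1 + q b b') := by
  rw [q_graphMap_graphMap ha hb hb' haa hc hc, q_cross_cross_left, q_eq_zero hc hb]
  ring

lemma q_graphMap_graphMap_anticomm (ha : a ∈ P.1) (hb : b ∈ P.perp) (hb' : b' ∈ P.perp)
    (haa : q a a = 1) (hc : c ∈ P.1) (hd : d ∈ P.1) (hcd : q c d = 0) :
    q (graphMap a b c) (graphMap a b' d) = -q (graphMap a b d) (graphMap a b' c) := by
  rw [q_graphMap_graphMap ha hb hb' haa hc hd, q_graphMap_graphMap ha hb hb' haa hd hc,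
    q_comm d c, hcd, q_cross_left_comm, q_cross_left_comm d, cross_left_comm_of_orthogonal hcd
      (q_eq_zero hc hb') (q_eq_zero hd hb'), map_neg]
  ring

lemma nonOrthogonal_of_ne (hW : IsAnnihilator W) (hW' : IsAnnihilator W') (h0 : W ≠ ⊥)
    (h : W.map P.proj = W'.map P.proj) (hne : W ≠ W') : NonOrthogonal W W' := by
  obtain ⟨a, ha, haa⟩ := exists_unit_map_proj (P := P) hW h0
  obtain ⟨b, hb, b', hb', hbb', e, e'⟩ := exists_eq_annihilatorOver hW hW' h hne ha haa
  rw [e, e']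
  refine ⟨_, Submodule.mem_map_of_mem ha, _, Submodule.mem_map_of_mem ha, ?_⟩
  refine (q_graphMap_graphMap_self (map_proj_le ha) hb hb' haa (map_proj_le ha)).trans_ne ?_
  rw [haa]
  linarith

lemma planeOpposite_of_ne (hW : IsAnnihilator W) (hW' : IsAnnihilator W')
    (hd : Module.finrank ℝ W = 2) (h : W.map P.proj = W'.map P.proj) (hne : W ≠ W') :
    PlaneOpposite W W' := by
  have hfin : Module.finrank ℝ (W.map P.proj) = 2 := (finrank_map_proj hW.disjoint_perp).trans hd
  obtain ⟨a, ha, haa⟩ := exists_unit (P := P) map_proj_le (two_pos.trans_eq hfin.symm)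
  obtain ⟨c, hc, hcc, hac⟩ := exists_orthogonal map_proj_le (one_lt_two.trans_eq hfin.symm) ha haa
  obtain ⟨b, hb, b', hb', hbb', e, e'⟩ := exists_eq_annihilatorOver hW hW' h hne ha haa
  have haP := map_proj_le ha
  have hcP := map_proj_le hc
  rw [e, e']
  refine ⟨_, Submodule.mem_map_of_mem ha, _, Submodule.mem_map_of_mem hc, _,
    Submodule.mem_map_of_mem ha, _, Submodule.mem_map_of_mem hc, ?_⟩
  simp only [ContinuousLinearMap.coe_coe]
  rw [q_graphMap_graphMap_self haP hb hb' haa haP, q_graphMap_graphMap_self haP hb hb' haa hcP,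
    q_graphMap_graphMap_anticomm haP hb hb' haa haP hcP hac, haa, hcc]
  have hpos : 0 < (1 + q b b') ^ 2 := pow_pos (by linarith) 2
  nlinarith [sq_nonneg (q (graphMap a b c) (graphMap a b' a))]

/-! ### Small motions of a fiber -/

open Filter Topology

variable (P) in
/-- The neighbourhoods of the identity of `H_P`, for its topology as a set of matrices. -/
def nhdsOne : Filter P.H := comap P.hEmb (𝓝 (P.hEmb 1))

lemma tendsto_grEmb_map_lin (W : Submodule ℝ V) :
    Tendsto (fun h : P.H => grEmb (W.map (lin h.1))) P.nhdsOne (𝓝 (grEmb W)) := by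
  have h := (analyticNear_map_lin (P := P) (eX := P.hEmb) (h := id) (W := fun _ => W) (x₀ := 1)
    .emb (.const _) fun _ => rfl).tendsto
  simp only [id, OneMemClass.coe_one, lin_one, Submodule.map_id] at h
  exact h

lemma tendsto_smul_ein (ℓ : Ein) : Tendsto (fun h : P.H => h • ℓ) P.nhdsOne (𝓝 ℓ) :=
  (IsInducing.mk rfl : IsInducing (Iso.emb : Ein → _)).tendsto_nhds_iff.2
    (tendsto_grEmb_map_lin ℓ.1)

lemma tendsto_smul_pho (W : Pho) : Tendsto (fun h : P.H => h • W) P.nhdsOne (𝓝 W) :=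
  (IsInducing.mk rfl : IsInducing Pho.emb).tendsto_nhds_iff.2
    (tendsto_grEmb_map_lin W.plane)

lemma tendsto_smul_flag (p : F12) : Tendsto (fun h : P.H => h • p) P.nhdsOne (𝓝 p) :=
  (IsInducing.mk rfl : IsInducing F12.emb).tendsto_nhds_iff.2
    ((tendsto_grEmb_map_lin p.line).prodMk_nhds (tendsto_grEmb_map_lin p.plane))

/-- A point of the circle spanned by two vectors; used for orthonormal pairs in `P^⊥`. -/
def circlePoint (d d' : V) (θ : ℝ) : V := Real.cos θ • d + Real.sin θ • d'

lemma circlePoint_mem (hd : d ∈ U) (hd' : d' ∈ U) (θ : ℝ) : circlePoint d d' θ ∈ U :=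
  U.add_mem (U.smul_mem _ hd) (U.smul_mem _ hd')

lemma contDiff_circlePoint (d d' : V) {n : WithTop ℕ∞} : ContDiff ℝ n (circlePoint d d') :=
  (Real.contDiff_cos.smul contDiff_const).add (Real.contDiff_sin.smul contDiff_const)

lemma circlePoint_zero (d d' : V) : circlePoint d d' 0 = d := by
  simp [circlePoint]

lemma q_circlePoint_left (dd : q d d = -1) (dd' : q d d' = 0) (θ : ℝ) :
    q d (circlePoint d d' θ) = -Real.cos θ := by
  simp [circlePoint, dd, dd']

lemma q_circlePoint_self (dd : q d d = -1) (hdd' : q d' d' = -1) (dd' : q d d' = 0) (θ : ℝ) :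
    q (circlePoint d d' θ) (circlePoint d d' θ) = -1 := by
  simp only [circlePoint, map_add, map_smul, LinearMap.add_apply, LinearMap.smul_apply, dd, hdd',
    dd', q_comm d' d, smul_eq_mul]
  linear_combination -Real.sin_sq_add_cos_sq θ

lemma exists_orthogonal_perp (hd : d ∈ P.perp) (dd : q d d = -1) :
    ∃ d' ∈ P.perp, q d' d' = -1 ∧ q d d' = 0 := by
  obtain ⟨x, hx, -, -, xx, -⟩ := P.exists_orthonormal_pair
  refine ⟨cross x d, cross_mem_perp_right hx hd, ?_, ?_⟩
  · rw [q_cross_cross, xx, dd, q_eq_zero hx hd]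
    norm_num
  · rw [q_comm, q_cross_right]

lemma frequently_nhdsOne (hd : d ∈ P.perp) (hd' : d' ∈ P.perp) (dd : q d d = -1)
    (hdd' : q d' d' = -1) (dd' : q d d' = 0) {θ₀ : ℝ} {p : V → Prop}
    (hp : ∀ᶠ θ in 𝓝[≠] θ₀, p (circlePoint d d' θ)) :
    ∃ᶠ h in P.nhdsOne, p (lin h.1 (circlePoint d d' θ₀)) := by
  have hmem := circlePoint_mem hd hd'
  have hunit := q_circlePoint_self dd hdd' dd'
  obtain ⟨T, hT, hTe⟩ := exists_transport (hmem θ₀) (hunit θ₀)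
  choose h hh using fun θ => exists_H_apply_eq (hmem θ₀) (hmem θ) (hunit θ₀) (hunit θ)
  have hh₀ : h θ₀ = 1 := H_eq_one (hmem θ₀) (hunit θ₀) (hh θ₀)
  have hcont : Continuous fun θ => P.hEmb (h θ) := by
    simp only [← hTe, hh]
    exact hT.continuous.comp (contDiff_circlePoint d d' (n := 0)).continuous
  have htend : Tendsto h (𝓝[≠] θ₀) P.nhdsOne := by
    refine tendsto_comap_iff.2 (hcont.tendsto' θ₀ _ ?_ |>.mono_left nhdsWithin_le_nhds)
    rw [hh₀]
  refine htend.frequently (Eventually.frequently (hp.mono fun θ hθ => ?_))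
  rwa [hh]

lemma eventually_cos_ne (θ₀ : ℝ) : ∀ᶠ θ in 𝓝[≠] θ₀, Real.cos θ ≠ Real.cos θ₀ := by
  refine not_frequently.1 fun hfreq => ?_
  have hconst := Real.analyticOnNhd_cos.eqOn_of_preconnected_of_frequently_eq
    analyticOnNhd_const isPreconnected_univ (Set.mem_univ θ₀) hfreq
  have hcos : Real.cos 0 = Real.cos Real.pi :=
    (hconst (Set.mem_univ 0)).trans (hconst (Set.mem_univ Real.pi)).symm
  norm_num at hcos

/-! ### The fibers are maximal -/

lemma lin_add_of_mem (h : P.H) (ha : a ∈ P.1) (b : V) : lin h.1 (a + b) = a + lin h.1 b := by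
  rw [map_add, h.2 a ha]

lemma add_mem_annihilatorOver (hU : U ≤ P.1) (ha : a ∈ U) (hb : b ∈ P.perp) (haa : q a a = 1) :
    a + b ∈ annihilatorOver a b U :=
  graphMap_self (hU ha) hb haa ▸ Submodule.mem_map_of_mem ha

lemma q_mem_Icc (ha : a ∈ P.1) (hc : c ∈ P.1) (haa : q a a = 1) (hcc : q c c = 1) :
    q a c ∈ Set.Icc (-1 : ℝ) 1 := by
  have q_self_nonneg : ∀ x ∈ P.1, 0 ≤ q x x := fun x hx => by
    rcases eq_or_ne x 0 with rfl | hx0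
    · simp
    · exact (P.2.2.1 x hx hx0).le
  have hsub := q_self_nonneg _ (P.1.sub_mem ha hc)
  have hadd := q_self_nonneg _ (P.1.add_mem ha hc)
  simp only [map_sub, map_add, LinearMap.sub_apply, LinearMap.add_apply, haa, hcc,
    q_comm c a] at hsub hadd
  exact ⟨by linarith, by linarith⟩

lemma ein_eq_span (ℓ : Ein) (hc : c ∈ P.1) (hd : d ∈ P.perp) (hcc : q c c = 1)
    (hcd : c + d ∈ ℓ.1) : ℓ.1 = Submodule.span ℝ {c + d} := by
  refine eq_span_singleton_of_mem_of_finrank_eq_one ℓ.2.1 hcd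
    (ne_zero_of_q_ne_zero (v := c) ?_).2
  rw [map_add, hcc, q_eq_zero hc hd]
  norm_num

lemma nonOrthogonal_iff_of_add_mem {ℓ ℓ' : Ein} (hc : c ∈ P.1) (hd : d ∈ P.perp)
    (hcc : q c c = 1) (hcd : c + d ∈ ℓ.1) (ha : a ∈ P.1) (hb : b ∈ P.perp) (haa : q a a = 1)
    (hab : a + b ∈ ℓ'.1) : NonOrthogonal ℓ.1 ℓ'.1 ↔ q c a + q d b ≠ 0 := by
  rw [ein_eq_span ℓ hc hd hcc hcd, ein_eq_span ℓ' ha hb haa hab,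
    nonOrthogonal_span_singleton_iff]
  simp only [map_add, LinearMap.add_apply, q_eq_zero hc hb, q_eq_zero_symm ha hd, add_zero,
    zero_add]

lemma exists_ein_frequently_nonOrthogonal (ℓ : Ein) (U : P.Gr 1) :
    ∃ ℓ' : Ein, P.einProj ℓ' = U ∧ ¬NonOrthogonal ℓ.1 ℓ'.1 ∧
      ∃ᶠ h in P.nhdsOne, NonOrthogonal ℓ.1 (h • ℓ').1 := by
  obtain ⟨a, ha, haa⟩ := exists_unit U.2.1 (one_pos.trans_eq U.2.2.symm)
  obtain ⟨c, hc, hcc⟩ := exists_unit_map_proj (P := P) ℓ.isAnnihilator ℓ.ne_bot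
  obtain ⟨d, hd, dd, hcd⟩ := exists_add_mem ℓ.isAnnihilator hc hcc
  obtain ⟨d', hd', hdd', dd'⟩ := exists_orthogonal_perp hd dd
  have haP := U.2.1 ha
  have hcP := map_proj_le hc
  obtain ⟨θ₀, hθ₀⟩ : ∃ θ₀, Real.cos θ₀ = q c a :=
    have hca := q_mem_Icc hcP haP hcc haa
    ⟨_, Real.cos_arccos hca.1 hca.2⟩
  have hb : circlePoint d d' θ₀ ∈ P.perp := circlePoint_mem hd hd' θ₀
  let ℓ' := einOver hb (q_circlePoint_self dd hdd' dd' θ₀) U ha haa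
  have hmem : a + circlePoint d d' θ₀ ∈ ℓ'.1 := add_mem_annihilatorOver U.2.1 ha hb haa
  refine ⟨ℓ', Subtype.ext (map_proj_annihilatorOver U.2.1 haP hb), ?_, ?_⟩
  · rw [nonOrthogonal_iff_of_add_mem hcP hd hcc hcd haP hb haa hmem,
      q_circlePoint_left dd dd', hθ₀, not_not, add_neg_cancel]
  · refine (frequently_nhdsOne hd hd' dd hdd' dd' (p := fun v => q c a + q d v ≠ 0)
      ((eventually_cos_ne θ₀).mono fun θ hθ => ?_)).mono fun h hh => ?_
    · rw [q_circlePoint_left dd dd', ← hθ₀, ← sub_eq_add_neg]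
      exact sub_ne_zero.2 hθ.symm
    · refine (nonOrthogonal_iff_of_add_mem hcP hd hcc hcd haP (lin_mem_perp h hb) haa ?_).2 hh
      rw [← lin_add_of_mem h haP]
      exact Submodule.mem_map_of_mem hmem

lemma inf_eq_bot_of_map_proj_inf_le (hW : IsAnnihilator W) (hW' : IsAnnihilator W')
    (h : W.map P.proj ⊓ W'.map P.proj ≤ Submodule.span ℝ {a}) (ha : a ∈ P.1) (hb : b ∈ P.perp)
    (hb' : b' ∈ P.perp) (hab : a + b ∈ W) (hab' : a + b' ∈ W') (hne : b ≠ b') : W ⊓ W' = ⊥ := by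
  refine (Submodule.eq_bot_iff _).2 fun w hw => ?_
  obtain ⟨r, hr⟩ := Submodule.mem_span_singleton.1
    (h ⟨Submodule.mem_map_of_mem hw.1, Submodule.mem_map_of_mem hw.2⟩)
  have e : w = r • (a + b) := proj_injOn (P := P) hW.disjoint_perp hw.1 (W.smul_mem r hab)
    (by rw [map_smul, proj_add ha hb, hr])
  have e' : w = r • (a + b') := proj_injOn (P := P) hW'.disjoint_perp hw.2 (W'.smul_mem r hab')
    (by rw [map_smul, proj_add ha hb', hr])
  have hsub : r • (b - b') = 0 := by
    rw [← sub_eq_zero.2 (e.symm.trans e')]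
    module
  rw [e, (smul_eq_zero.1 hsub).resolve_right (sub_ne_zero.2 hne), zero_smul]

lemma finrank_inf_eq_one {U U' : P.Gr 2} (hne : U ≠ U') :
    Module.finrank ℝ (U.1 ⊓ U'.1 : Submodule ℝ V) = 1 := by
  have hsum := Submodule.finrank_sup_add_finrank_inf_eq U.1 U'.1
  have hsup : Module.finrank ℝ (U.1 ⊔ U'.1 : Submodule ℝ V) ≤ 3 :=
    (Submodule.finrank_mono (sup_le U.2.1 U'.2.1)).trans_eq P.2.1
  have hinf : Module.finrank ℝ (U.1 ⊓ U'.1 : Submodule ℝ V) < 2 := by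
    by_contra! hge
    have hle : U.1 ≤ U'.1 := inf_eq_left.1
      (Submodule.eq_of_le_of_finrank_le inf_le_left (U.2.2.trans_le hge))
    exact hne (Subtype.ext (Submodule.eq_of_le_of_finrank_eq hle (U.2.2.trans U'.2.2.symm)))
  have hU := U.2.2
  have hU' := U'.2.2
  omega

lemma exists_pho_frequently_inf_eq_bot (W : Pho) (U : P.Gr 2) (hne : P.phoProj W ≠ U) :
    ∃ W' : Pho, P.phoProj W' = U ∧ W.plane ⊓ W'.plane ≠ ⊥ ∧
      ∃ᶠ h in P.nhdsOne, W.plane ⊓ (h • W').plane = ⊥ := by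
  have hfin := finrank_inf_eq_one hne
  obtain ⟨a, ⟨haW, haU⟩, haa⟩ := exists_unit (inf_le_right.trans U.2.1)
    (one_pos.trans_eq hfin.symm)
  have haP := U.2.1 haU
  have ha0 := (ne_zero_of_q_ne_zero (haa.trans_ne one_ne_zero)).1
  obtain ⟨b, hb, bb, hab⟩ := exists_add_mem W.isAnnihilator haW haa
  obtain ⟨d', hd', hdd', bd'⟩ := exists_orthogonal_perp hb bb
  let W' := phoOver hb bb U haU haa
  have hab' : a + b ∈ W'.plane := add_mem_annihilatorOver U.2.1 haU hb haa
  have hproj : W'.plane.map P.proj = U.1 := map_proj_annihilatorOver U.2.1 haP hb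
  refine ⟨W', Subtype.ext hproj, fun hbot => ?_, ?_⟩
  · have h0 : a + b = 0 := (Submodule.eq_bot_iff _).1 hbot _ ⟨hab, hab'⟩
    rw [← proj_add haP hb, h0, map_zero] at ha0
    exact ha0 rfl
  · have hmoved : ∀ᶠ θ in 𝓝[≠] 0, b ≠ circlePoint b d' θ := by
      filter_upwards [eventually_cos_ne 0] with θ hθ h
      have hq := q_circlePoint_left bb bd' θ
      rw [← h, bb, neg_inj, ← Real.cos_zero] at hq
      exact hθ hq.symm
    refine (frequently_nhdsOne hb hd' bb hdd' bd' hmoved).mono fun h hh => ?_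
    rw [circlePoint_zero] at hh
    refine inf_eq_bot_of_map_proj_inf_le W.isAnnihilator (h • W').isAnnihilator ?_ haP hb
      (lin_mem_perp h hb) hab ?_ hh
    · refine (inf_le_inf_left _ ((map_proj_map_lin h _).trans hproj).le).trans_eq ?_
      exact eq_span_singleton_of_mem_of_finrank_eq_one hfin ⟨haW, haU⟩ ha0
    · rw [← lin_add_of_mem h haP]
      exact Submodule.mem_map_of_mem hab'

lemma maximallyTransverse_ein (U : P.Gr 1) : MaximallyTransverse G2 (P.einProj ⁻¹' {U}) := by
  refine maximallyTransverse_fiber (fun x y hx hy hne => ?_) fun ℓ _ => ?_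
  · exact transverse_ein_of_nonOrthogonal (nonOrthogonal_of_ne x.isAnnihilator y.isAnnihilator
      x.ne_bot (congrArg Subtype.val (hx.trans hy.symm)) (mt Subtype.ext hne))
  · obtain ⟨ℓ', hℓ', horth, hfreq⟩ := exists_ein_frequently_nonOrthogonal ℓ U
    exact ⟨ℓ', hℓ', not_transverse_of_frequently (R := fun x y : Ein => ¬NonOrthogonal x.1 y.1)
      (fun g _ _ => (nonOrthogonal_map_lin_iff g).not) horth
      ((tendsto_smul_ein ℓ').frequently (hfreq.mono fun _ => not_not.2))⟩

lemma maximallyTransverse_pho (U : P.Gr 2) : MaximallyTransverse G2 (P.phoProj ⁻¹' {U}) := by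
  refine maximallyTransverse_fiber (fun x y hx hy hne => ?_) fun W hW => ?_
  · exact transverse_pho_of_planeOpposite (planeOpposite_of_ne x.isAnnihilator y.isAnnihilator
      x.finrank_plane (congrArg Subtype.val (hx.trans hy.symm)) (mt Pho.ext hne))
  · obtain ⟨W', hW', hmeet, hfreq⟩ := exists_pho_frequently_inf_eq_bot W U hW
    exact ⟨W', hW', not_transverse_of_frequently (R := fun x y : Pho => x.plane ⊓ y.plane ≠ ⊥)
      (fun g _ _ => (map_lin_inf_map_lin_eq_bot_iff g).not) hmeet
      ((tendsto_smul_pho W').frequently (hfreq.mono fun _ => not_not.2))⟩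

lemma exists_flagProj_eq (U : P.Flag) {ℓ : Ein} (hℓ : P.einProj ℓ = U.1.1) :
    ∃ p : F12, P.flagProj p = U ∧ p.1.1 = ℓ := by
  obtain ⟨p, rfl⟩ := isPrincipalBundle_flagProj.surjective U
  obtain ⟨h, rfl⟩ := (isPrincipalBundle_einProj.fiber_iff p.1.1 ℓ).1 hℓ.symm
  exact ⟨h • p, flagProj_smul h p, rfl⟩

lemma maximallyTransverse_flag (U : P.Flag) : MaximallyTransverse G2 (P.flagProj ⁻¹' {U}) := by
  refine maximallyTransverse_fiber (fun x y hx hy hne => ?_) fun p _ => ?_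
  · obtain ⟨h, rfl⟩ := (isPrincipalBundle_flagProj.fiber_iff x y).1 (hx.trans hy.symm)
    have hh : h ≠ 1 := by
      rintro rfl
      exact hne (one_smul _ x).symm
    refine transverse_flag_of_opposite ?_ ?_
    · exact nonOrthogonal_of_ne x.1.1.isAnnihilator (h • x).1.1.isAnnihilator x.1.1.ne_bot
        (map_proj_map_lin h x.line).symm fun e => hh (eq_one_of_smul_ein_eq h x.1.1
          (Subtype.ext e.symm))
    · exact planeOpposite_of_ne x.1.2.isAnnihilator (h • x).1.2.isAnnihilator x.1.2.finrank_plane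
        (map_proj_map_lin h x.plane).symm fun e => hh (eq_one_of_smul_pho_eq h x.1.2
          (Pho.ext e.symm))
  · obtain ⟨ℓ', hℓ', horth, hfreq⟩ := exists_ein_frequently_nonOrthogonal p.1.1 U.1.1
    obtain ⟨p', hp', rfl⟩ := exists_flagProj_eq U hℓ'
    exact ⟨p', hp', not_transverse_of_frequently
      (R := fun x y : F12 => ¬NonOrthogonal x.line y.line)
      (fun g _ _ => (nonOrthogonal_map_lin_iff g).not) horth
      ((tendsto_smul_flag p').frequently (hfreq.mono fun _ => not_not.2))⟩

end SymSpace

/-! ### Subspaces of signature `(1,4)` and `(2,4)` -/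

lemma map_map_eq_of_le_range {K E F : Type*} [Field K] [AddCommGroup E] [Module K E]
    [AddCommGroup F] [Module K F] {f : E →ₗ[K] F} {g : F →ₗ[K] E} (hgf : g ∘ₗ f = LinearMap.id)
    {W : Submodule K F} (hW : W ≤ LinearMap.range f) : (W.map g).map f = W := by
  obtain ⟨X, rfl⟩ : ∃ X : Submodule K E, X.map f = W :=
    ⟨W.comap f, Submodule.map_comap_eq_of_le hW⟩
  rw [← Submodule.map_comp f g X, hgf, Submodule.map_id]

lemma diagForm_single_right {n : ℕ} (w : Fin n → ℝ) (x : EuclideanSpace ℝ (Fin n)) (i : Fin n) :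
    diagForm w x (EuclideanSpace.single i 1) = w i * x i := by
  simp [diagForm]

lemma w14_ne_zero (i : Fin 5) : w14 i ≠ 0 := by fin_cases i <;> simp [w14]

lemma w24_ne_zero (i : Fin 6) : w24 i ≠ 0 := by fin_cases i <;> simp [w24]

namespace IsIsometric

section Embedding

variable {n k : ℕ} {w : Fin n → ℝ} {f : EuclideanSpace ℝ (Fin n) →ₗ[ℝ] V}

lemma injective (hf : IsIsometric w f) (hw : ∀ i, w i ≠ 0) : Function.Injective f := by
  refine (injective_iff_map_eq_zero f).2 fun x hx => ?_
  ext i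
  have h := hf x (EuclideanSpace.single i 1)
  rw [hx, map_zero, LinearMap.zero_apply, diagForm_single_right] at h
  exact (mul_eq_zero.1 h.symm).resolve_left (hw i)

/-- The isotropic subspaces of the source of an isometric embedding `f`, identified through `f`
with those of `ℝ^{3,4}` contained in its image; `g` is any left inverse of `f`. -/
def isoEquiv (hf : IsIsometric w f) (k : ℕ) {g : V →ₗ[ℝ] EuclideanSpace ℝ (Fin n)}
    (hgf : g ∘ₗ f = LinearMap.id) : Iso w k ≃ {W : Iso w34 k | W.1 ≤ LinearMap.range f} :=
  have hdim (X : Submodule ℝ (EuclideanSpace ℝ (Fin n))) :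
      Module.finrank ℝ (X.map f) = Module.finrank ℝ X :=
    (Submodule.equivMapOfInjective f
      (Function.LeftInverse.injective (LinearMap.congr_fun hgf)) X).finrank_eq.symm
  { toFun W := ⟨⟨W.1.map f, (hdim _).trans W.2.1, by
      rintro _ ⟨x, hx, rfl⟩ _ ⟨y, hy, rfl⟩
      exact (hf x y).trans (W.2.2 x hx y hy)⟩, LinearMap.map_le_range⟩
    invFun W := ⟨W.1.1.map g,
      (hdim _).symm.trans ((map_map_eq_of_le_range hgf W.2).symm ▸ W.1.2.1), fun x hx y hy => by
      have hmap := (map_map_eq_of_le_range hgf W.2).le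
      rw [← hf]
      exact W.1.2.2 _ (hmap ⟨x, hx, rfl⟩) _ (hmap ⟨y, hy, rfl⟩)⟩
    left_inv W := Subtype.ext <| by
      change (W.1.map f).map g = W.1
      rw [← Submodule.map_comp, hgf, Submodule.map_id]
    right_inv W := Subtype.ext (Subtype.ext (map_map_eq_of_le_range hgf W.2)) }

lemma exists_diffeo (hf : IsIsometric w f) (hw : ∀ i, w i ≠ 0) :
    ∃ Φ : Iso w k ≃ {W : Iso w34 k | W.1 ≤ LinearMap.range f},
      IsDiffeo Iso.emb (fun W => Iso.emb W.1) Φ ∧ ∀ W, (Φ W).1.1 = W.1.map f := by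
  obtain ⟨g, hgf⟩ :=
    LinearMap.exists_leftInverse_of_injective f (LinearMap.ker_eq_bot.2 (hf.injective hw))
  refine ⟨hf.isoEquiv k hgf, ⟨smoothMap_of_analyticNear fun W₀ => ?_,
    smoothMap_of_analyticNear fun W₀ => ?_⟩, fun _ => rfl⟩
  · exact AnalyticNear.grEmb_map (W := fun W : Iso w k => W.1)
      (.const (LinearMap.toContinuousLinearMap f)) .emb (fun _ => rfl)
      fun W => (hf.isoEquiv k hgf W).1.2.1.trans (hf.isoEquiv k hgf W₀).1.2.1.symm
  · exact AnalyticNear.grEmb_map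
      (W := fun W : {W : Iso w34 k | W.1 ≤ LinearMap.range f} => W.1.1)
      (.const (LinearMap.toContinuousLinearMap g)) .emb (fun _ => rfl)
      fun W => ((hf.isoEquiv k hgf).symm W).2.1.trans ((hf.isoEquiv k hgf).symm W₀).2.1.symm

end Embedding

end IsIsometric

/-- The standard inclusion `ℝ^{1,4} → ℝ^{3,4}`. -/
def incl14 : EuclideanSpace ℝ (Fin 5) →ₗ[ℝ] V where
  toFun t := !₂[t 0, 0, 0, t 1, t 2, t 3, t 4]
  map_add' x y := by ext i; fin_cases i <;> simp
  map_smul' c x := by ext i; fin_cases i <;> simp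

/-- The standard inclusion `ℝ^{2,4} → ℝ^{3,4}`. -/
def incl24 : EuclideanSpace ℝ (Fin 6) →ₗ[ℝ] V where
  toFun t := !₂[t 0, t 1, 0, t 2, t 3, t 4, t 5]
  map_add' x y := by ext i; fin_cases i <;> simp
  map_smul' c x := by ext i; fin_cases i <;> simp

/-- The inclusion of the negative definite coordinate subspace of `ℝ^{2,4}`. -/
def incl04 : EuclideanSpace ℝ (Fin 4) →ₗ[ℝ] EuclideanSpace ℝ (Fin 6) where
  toFun b := !₂[0, 0, b 0, b 1, b 2, b 3]
  map_add' x y := by ext i; fin_cases i <;> simp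
  map_smul' c x := by ext i; fin_cases i <;> simp

lemma incl14_apply (t : EuclideanSpace ℝ (Fin 5)) :
    incl14 t = !₂[t 0, 0, 0, t 1, t 2, t 3, t 4] := rfl

lemma incl24_apply (t : EuclideanSpace ℝ (Fin 6)) :
    incl24 t = !₂[t 0, t 1, 0, t 2, t 3, t 4, t 5] := rfl

lemma isIsometric_lin_comp_incl14 (g : G2) : IsIsometric w14 (lin g ∘ₗ incl14) := fun x y => by
  rw [LinearMap.comp_apply, LinearMap.comp_apply, q_lin, q_apply, incl14_apply, incl14_apply]
  simp [diagForm, w14, Fin.sum_univ_succ]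
  ring

lemma isIsometric_lin_comp_incl24 (g : G2) : IsIsometric w24 (lin g ∘ₗ incl24) := fun x y => by
  rw [LinearMap.comp_apply, LinearMap.comp_apply, q_lin, q_apply, incl24_apply, incl24_apply]
  simp [diagForm, w24, Fin.sum_univ_succ]
  ring

lemma diagForm_incl04 (b : EuclideanSpace ℝ (Fin 4)) :
    diagForm w24 (incl04 b) (incl04 b) = -‖b‖ ^ 2 := by
  rw [EuclideanSpace.real_norm_sq_eq]
  simp [diagForm, incl04, w24, Fin.sum_univ_succ]
  ring

/-- The coordinate subspace of `ℝ^{3,4}` on which `q` is negative definite. -/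
def negPart : Submodule ℝ V where
  carrier := {v | fstQ v = 0}
  zero_mem' := by ext <;> simp
  add_mem' {v w} hv hw := by
    have hadd : fstQ (v + w) = fstQ v + fstQ w := by ext <;> simp
    exact hadd.trans (by rw [hv, hw, add_zero])
  smul_mem' c v hv := by
    have hsmul : fstQ (c • v) = c • fstQ v := by ext <;> simp
    exact hsmul.trans (by rw [hv, smul_zero])

lemma mem_range_incl24 {v : V} : v ∈ LinearMap.range incl24 ↔ v 2 = 0 := by
  constructor
  · rintro ⟨t, rfl⟩
    simp [incl24_apply]
  · intro h
    refine ⟨!₂[v 0, v 1, v 3, v 4, v 5, v 6], ?_⟩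
    rw [incl24_apply]
    ext i; fin_cases i <;> simp [h]

lemma range_incl14 :
    LinearMap.range incl14 = Submodule.span ℝ {EuclideanSpace.single 0 1} ⊔ negPart := by
  ext v
  simp only [Submodule.mem_sup, Submodule.mem_span_singleton]
  constructor
  · rintro ⟨t, rfl⟩
    refine ⟨_, ⟨t 0, rfl⟩, !₂[0, 0, 0, t 1, t 2, t 3, t 4], by ext <;> simp, ?_⟩
    rw [incl14_apply]
    ext i; fin_cases i <;> simp
  · rintro ⟨_, ⟨c, rfl⟩, u, hu, rfl⟩
    have hI : u 0 = 0 := congrArg QuaternionAlgebra.imI hu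
    have hJ : u 1 = 0 := congrArg QuaternionAlgebra.imJ hu
    have hK : u 2 = 0 := congrArg QuaternionAlgebra.imK hu
    refine ⟨!₂[c, u 3, u 4, u 5, u 6], ?_⟩
    rw [incl14_apply]
    ext i; fin_cases i <;> simp [hI, hJ, hK]

lemma range_incl24 :
    LinearMap.range incl24 =
      Submodule.span ℝ {EuclideanSpace.single 0 1, EuclideanSpace.single 1 1} ⊔ negPart := by
  ext v
  simp only [mem_range_incl24, Submodule.mem_sup, Submodule.mem_span_pair]
  constructor
  · intro h
    refine ⟨_, ⟨v 0, v 1, rfl⟩, !₂[0, 0, 0, v 3, v 4, v 5, v 6], by ext <;> simp, ?_⟩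
    ext i; fin_cases i <;> simp [h]
  · rintro ⟨_, ⟨c, d, rfl⟩, u, hu, rfl⟩
    have hK : u 2 = 0 := congrArg QuaternionAlgebra.imK hu
    simp [hK]

namespace SymSpace

variable {P : SymSpace}

lemma Adapted.map_negPart {g : G2} (hg : P.Adapted g) : negPart.map (lin g) = P.perp := by
  ext v
  constructor
  · rintro ⟨u, hu, rfl⟩
    exact (hg.2 u).2 hu
  · intro hv
    exact ⟨lin g⁻¹ v, (hg.2 _).1 (by rwa [lin_apply_inv]), lin_apply_inv g v⟩

lemma exists_map_range_incl14 (U : P.Gr 1) :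
    ∃ g : G2, (LinearMap.range incl14).map (lin g) = U.1 ⊔ P.perp := by
  obtain ⟨a, ha, haa⟩ := exists_unit U.2.1 (by rw [U.2.2]; norm_num)
  have haP := U.2.1 ha
  obtain ⟨y, hy, hyy, hay⟩ := exists_orthogonal (P := P) le_rfl (by rw [P.2.1]; norm_num) haP haa
  obtain ⟨z, hz, hzz⟩ := P.exists_mem_perp
  have ht := isTriad haP hy hz haa hyy hay hzz
  have hframe : lin ht.frame (EuclideanSpace.single 0 1) = a := by
    simp [ht.lin_frame, frameMap_apply]
  have ha0 : a ≠ 0 := (ne_zero_of_q_ne_zero (haa.trans_ne one_ne_zero)).1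
  refine ⟨ht.frame, ?_⟩
  rw [range_incl14, Submodule.map_sup, (adapted_frame haP hy hz ht).map_negPart,
    Submodule.map_span, Set.image_singleton, hframe,
    ← eq_span_singleton_of_mem_of_finrank_eq_one U.2.2 ha ha0]

lemma exists_map_range_incl24 (U : P.Gr 2) :
    ∃ g : G2, (LinearMap.range incl24).map (lin g) = U.1 ⊔ P.perp := by
  obtain ⟨a, ha, haa⟩ := exists_unit U.2.1 (by rw [U.2.2]; norm_num)
  obtain ⟨y, hy, hyy, hay⟩ := exists_orthogonal U.2.1 (by rw [U.2.2]; norm_num) ha haa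
  obtain ⟨z, hz, hzz⟩ := P.exists_mem_perp
  have ht := isTriad (U.2.1 ha) (U.2.1 hy) hz haa hyy hay hzz
  have hframe : lin ht.frame (EuclideanSpace.single 0 1) = a ∧
      lin ht.frame (EuclideanSpace.single 1 1) = y := by
    simp [ht.lin_frame, frameMap_apply]
  have hspan : Submodule.span ℝ {a, y} = U.1 :=
    span_pair_eq_of_q_ne_zero U.2.2 ha hy (haa.trans_ne one_ne_zero) (hyy.trans_ne one_ne_zero)
      hay (by rw [q_comm, hay])
  refine ⟨ht.frame, ?_⟩
  rw [range_incl24, Submodule.map_sup, (adapted_frame (U.2.1 ha) (U.2.1 hy) hz ht).map_negPart,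
    Submodule.map_span, Set.image_pair, hframe.1, hframe.2, hspan]

end SymSpace

namespace IsIsometric

variable {f : EuclideanSpace ℝ (Fin 6) →ₗ[ℝ] V}

lemma q_self_pos_of_normal (hf : IsIsometric w24 f) {v : V} (hv0 : v ≠ 0)
    (hv : ∀ x, q (f x) v = 0) : 0 < q v v := by
  by_contra hle
  let L : EuclideanSpace ℝ (Fin 4) × ℝ →ₗ[ℝ] V :=
    (f ∘ₗ incl04).coprod (LinearMap.toSpanSingleton ℝ V v)
  have hL (b : EuclideanSpace ℝ (Fin 4)) (t : ℝ) : L (b, t) = f (incl04 b) + t • v := by simp [L]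
  have hq (b : EuclideanSpace ℝ (Fin 4)) (t : ℝ) :
      q (L (b, t)) (L (b, t)) = -‖b‖ ^ 2 + t ^ 2 * q v v := by
    rw [← diagForm_incl04, ← hf, hL]
    simp only [map_add, map_smul, LinearMap.add_apply, LinearMap.smul_apply, hv,
      q_comm v (f (incl04 b)), smul_eq_mul]
    ring
  have hnonpos (p) : q (L p) (L p) ≤ 0 := by
    rw [hq]
    nlinarith [sq_nonneg ‖p.1‖, sq_nonneg p.2]
  have hinj : Function.Injective L := by
    refine (injective_iff_map_eq_zero L).2 fun ⟨b, t⟩ hbt => ?_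
    rw [hL] at hbt
    have hnorm : -‖b‖ ^ 2 = 0 := by
      rw [← diagForm_incl04, ← hf]
      nth_rewrite 2 [eq_neg_of_add_eq_zero_left hbt]
      rw [map_neg, map_smul, hv, smul_zero, neg_zero]
    have hb : b = 0 := by simpa using hnorm
    rw [hb, map_zero, map_zero, zero_add] at hbt
    rw [hb, (smul_eq_zero.1 hbt).resolve_right hv0]
    rfl
  have hdim : 4 < Module.finrank ℝ (LinearMap.range L) := by
    rw [LinearMap.finrank_range_of_inj hinj]
    simp
  obtain ⟨_, ⟨p, rfl⟩, hp⟩ := exists_pos_of_four_lt_finrank hdim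
  exact (hnonpos p).not_gt hp

lemma exists_unit_normal (hf : IsIsometric w24 f) :
    ∃ v, (∀ x, q (f x) v = 0) ∧ q v v = 1 := by
  have hker : LinearMap.ker (LinearMap.lcomp ℝ ℝ f ∘ₗ q) ≠ ⊥ :=
    LinearMap.ker_ne_bot_of_finrank_lt (by rw [Module.finrank_linearMap]; simp)
  obtain ⟨v, hv, hv0⟩ := Submodule.exists_mem_ne_zero_of_ne_bot hker
  have hnormal (x) : q (f x) v = 0 :=
    (q_comm _ _).trans (LinearMap.congr_fun (LinearMap.mem_ker.1 hv) x)
  obtain ⟨c, -, hc⟩ := exists_smul_q_eq_one (hf.q_self_pos_of_normal hv0 hnormal)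
  exact ⟨c • v, fun x => by rw [map_smul, hnormal, smul_zero], hc⟩

lemma exists_map_range_incl24 (hf : IsIsometric w24 f) :
    ∃ g : G2, (LinearMap.range incl24).map (lin g) = LinearMap.range f := by
  obtain ⟨v, hv, hvv⟩ := hf.exists_unit_normal
  obtain ⟨j, hj⟩ := exists_isTriad (s := v) (t := f (EuclideanSpace.single 2 1)) hvv
    (by rw [hf, diagForm_single_right]; simp [w24]) ((q_comm _ _).trans (hv _))
  have hframe : lin hj.rotate.frame (EuclideanSpace.single 2 1) = v := by
    simp [hj.rotate.lin_frame, frameMap_apply, hj.cross_snd_cross_fst_snd]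
  have hle : LinearMap.range f ≤ (LinearMap.range incl24).map (lin hj.rotate.frame) := by
    rintro _ ⟨u, rfl⟩
    refine ⟨lin hj.rotate.frame⁻¹ (f u), mem_range_incl24.2 ?_, lin_apply_inv _ _⟩
    have h := q_lin hj.rotate.frame (lin hj.rotate.frame⁻¹ (f u)) (EuclideanSpace.single 2 1)
    rw [lin_apply_inv, hframe, hv, q_apply] at h
    simpa using h.symm
  refine ⟨hj.rotate.frame, (Submodule.eq_of_le_of_finrank_eq hle ?_).symm⟩
  rw [← LinearMap.range_comp, LinearMap.finrank_range_of_inj (hf.injective w24_ne_zero),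
    LinearMap.finrank_range_of_inj
      ((isIsometric_lin_comp_incl24 hj.rotate.frame).injective w24_ne_zero)]

end IsIsometric

lemma image_smul_phoIn (g : G2) (X : Submodule ℝ V) :
    (fun W : Pho => g • W) '' PhoIn X = PhoIn (X.map (lin g)) := by
  ext W
  constructor
  · rintro ⟨W, hW, rfl⟩
    exact Submodule.map_mono hW
  · intro hW
    refine ⟨g⁻¹ • W, ?_, smul_inv_smul g W⟩
    rintro _ ⟨w, hw, rfl⟩
    obtain ⟨x, hx, rfl⟩ := hW hw
    rw [lin_inv_apply]
    exact hx

namespace SymSpace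

variable {P : SymSpace}

lemma einProj_preimage_singleton (U : P.Gr 1) :
    P.einProj ⁻¹' {U} = {ℓ : Ein | ℓ.1 ≤ U.1 ⊔ P.perp} :=
  Set.ext fun ℓ => Subtype.ext_iff.trans
    (map_proj_eq_iff ℓ.isAnnihilator.disjoint_perp U.2.1 (ℓ.2.1.trans U.2.2.symm))

lemma phoProj_preimage_singleton (U : P.Gr 2) : P.phoProj ⁻¹' {U} = PhoIn (U.1 ⊔ P.perp) :=
  Set.ext fun W => Subtype.ext_iff.trans
    (map_proj_eq_iff W.isAnnihilator.disjoint_perp U.2.1 (W.1.2.1.trans U.2.2.symm))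

lemma flagProj_preimage_singleton (U : P.Flag) :
    P.flagProj ⁻¹' {U} =
      {p | P.IsGraphOver U.1.1.1 p.line ∧ P.IsGraphOver U.1.2.1 p.plane} :=
  Set.ext fun p => Subtype.ext_iff.trans <| Prod.ext_iff.trans <| and_congr
    (Subtype.ext_iff.trans
      (isGraphOver_iff p.1.1.isAnnihilator.disjoint_perp U.1.1.2.1).symm)
    (Subtype.ext_iff.trans
      (isGraphOver_iff p.1.2.isAnnihilator.disjoint_perp U.1.2.2.1).symm)

lemma exists_isometry_and_diffeo_einProj_preimage (U : P.Gr 1) :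
    ∃ f : EuclideanSpace ℝ (Fin 5) →ₗ[ℝ] V, IsIsometric w14 f ∧
      LinearMap.range f = U.1 ⊔ P.perp ∧
      ∃ Φ : Ein03 ≃ P.einProj ⁻¹' {U}, IsDiffeo Iso.emb (fun ℓ => Iso.emb ℓ.1) Φ ∧
        ∀ ℓ, (Φ ℓ).1.1 = ℓ.1.map f := by
  obtain ⟨g, hg⟩ := exists_map_range_incl14 U
  rw [← LinearMap.range_comp] at hg
  have hf := isIsometric_lin_comp_incl14 g
  refine ⟨_, hf, hg, ?_⟩
  rw [einProj_preimage_singleton, ← hg]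
  exact hf.exists_diffeo w14_ne_zero

lemma exists_isometry_range_eq_sup_perp (U : P.Gr 2) :
    ∃ f : EuclideanSpace ℝ (Fin 6) →ₗ[ℝ] V, IsIsometric w24 f ∧
      LinearMap.range f = U.1 ⊔ P.perp := by
  obtain ⟨g, hg⟩ := exists_map_range_incl24 U
  exact ⟨_, isIsometric_lin_comp_incl24 g, (LinearMap.range_comp _ _).trans hg⟩

lemma exists_image_phoProj_preimage_eq (U : P.Gr 2) {f : EuclideanSpace ℝ (Fin 6) →ₗ[ℝ] V}
    (hf : IsIsometric w24 f) :
    ∃ g : G2, (fun W => g • W) '' (P.phoProj ⁻¹' {U}) = PhoIn (LinearMap.range f) := by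
  obtain ⟨g, hg⟩ := exists_map_range_incl24 U
  obtain ⟨k, hk⟩ := hf.exists_map_range_incl24
  refine ⟨k * g⁻¹, ?_⟩
  rw [phoProj_preimage_singleton, image_smul_phoIn, ← hg, ← hk, ← Submodule.map_comp, ← lin_mul,
    inv_mul_cancel_right]

end SymSpace

end SplitG2

end

open SplitG2

theorem mainTheorem10 (P : SymSpace) :
    -- the structure group is `Sp(1)`, the unit quaternions
    (∃ φ : unitary ℍ[ℝ] ≃* P.H, IsDiffeo (fun a : unitary ℍ[ℝ] => a.1) P.hEmb φ.toEquiv) ∧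
    -- isotropic lines
    (∃ π : Ein → P.Gr 1, (∀ ℓ, (π ℓ).1 = ℓ.1.map P.proj) ∧
      IsPrincipalBundle Iso.emb SymSpace.Gr.emb P.hEmb π ∧
      ∀ U : P.Gr 1,
        IsThreeSphere Iso.emb (π ⁻¹' {U}) ∧
        MaximallyTransverse G2 (π ⁻¹' {U}) ∧
        π ⁻¹' {U} = {ℓ : Ein | ℓ.1 ≤ U.1 ⊔ P.perp} ∧
        ∃ f : EuclideanSpace ℝ (Fin 5) →ₗ[ℝ] V, IsIsometric w14 f ∧
          LinearMap.range f = U.1 ⊔ P.perp ∧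
          ∃ Φ : Ein03 ≃ π ⁻¹' {U}, IsDiffeo Iso.emb (fun ℓ => Iso.emb ℓ.1) Φ ∧
            ∀ ℓ, (Φ ℓ).1.1 = ℓ.1.map f) ∧
    -- annihilator photons
    (∃ π : Pho → P.Gr 2, (∀ W, (π W).1 = W.plane.map P.proj) ∧
      IsPrincipalBundle Pho.emb SymSpace.Gr.emb P.hEmb π ∧
      ∀ U : P.Gr 2,
        IsThreeSphere Pho.emb (π ⁻¹' {U}) ∧
        MaximallyTransverse G2 (π ⁻¹' {U}) ∧
        π ⁻¹' {U} = PhoIn (U.1 ⊔ P.perp) ∧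
        (∃ f : EuclideanSpace ℝ (Fin 6) →ₗ[ℝ] V, IsIsometric w24 f ∧
          LinearMap.range f = U.1 ⊔ P.perp) ∧
        ∀ f : EuclideanSpace ℝ (Fin 6) →ₗ[ℝ] V, IsIsometric w24 f →
          ∃ g : G2, (fun W => g • W) '' (π ⁻¹' {U}) = PhoIn (LinearMap.range f)) ∧
    -- pointed annihilator photons
    (∃ π : F12 → P.Flag,
      (∀ p, (π p).1.1.1 = p.line.map P.proj ∧ (π p).1.2.1 = p.plane.map P.proj) ∧
      IsPrincipalBundle F12.emb SymSpace.Flag.emb P.hEmb π ∧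
      ∀ U : P.Flag,
        IsThreeSphere F12.emb (π ⁻¹' {U}) ∧
        MaximallyTransverse G2 (π ⁻¹' {U}) ∧
        π ⁻¹' {U} =
          {p | P.IsGraphOver U.1.1.1 p.line ∧ P.IsGraphOver U.1.2.1 p.plane}) := by
  have hH := P.exists_unitary_mulEquiv
  refine ⟨hH, ⟨P.einProj, fun _ => rfl, SymSpace.isPrincipalBundle_einProj, fun U => ?_⟩,
    ⟨P.phoProj, fun _ => rfl, SymSpace.isPrincipalBundle_phoProj, fun U => ?_⟩,
    ⟨P.flagProj, fun _ => ⟨rfl, rfl⟩, SymSpace.isPrincipalBundle_flagProj, fun U => ?_⟩⟩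
  · exact ⟨SymSpace.isPrincipalBundle_einProj.isThreeSphere hH U,
      SymSpace.maximallyTransverse_ein U, SymSpace.einProj_preimage_singleton U,
      SymSpace.exists_isometry_and_diffeo_einProj_preimage U⟩
  · exact ⟨SymSpace.isPrincipalBundle_phoProj.isThreeSphere hH U,
      SymSpace.maximallyTransverse_pho U, SymSpace.phoProj_preimage_singleton U,
      SymSpace.exists_isometry_range_eq_sup_perp U,
      fun _ => SymSpace.exists_image_phoProj_preimage_eq U⟩
  · exact ⟨SymSpace.isPrincipalBundle_flagProj.isThreeSphere hH U,
      SymSpace.maximallyTransverse_flag U, SymSpace.flagProj_preimage_singleton U⟩
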